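/- Let $n\ge 2$ and let $\mathbb{R}^n$ carry the Minkowski inner product $\eta=\omega^1\otimes\omega^2+\omega^2\otimes\omega^1+\omega^3\otimes\omega^3+\dots+\omega^n\otimes\omega^n$, where $\omega^1,\dots,\omega^n$ is the dual of the standard basis $e_1,\dots,e_n$, and put $k=e_1$. Let $GN\subset GL(n,\mathbb{R})$ be the Lie group of invertible linear maps $f$ with $f(k)\in\mathbb{R}k$, $\eta(f(w),f(\tilde w))=\eta(w,\tilde w)$ for all $w,\tilde w\in\{k\}^{\perp}$, and $\eta(f(k),f(z))=\eta(k,z)$ for all $z\in\mathbb{R}^n$. Let $M$ be a smooth (Hausdorff) $n$-dimensional manifold and let $P\to M$ be a $GN$-structure, i.e. a smooth reduction of the frame bundle of $M$ to $GN$. Its associated distributions are $\lambda_x=u(\mathbb{R}k)$ and $\Lambda_x=u(\{k\}^{\perp})$, for any frame $u\in P_x$, regarded as a linear isomorphism $u:\mathbb{R}^n\to T_xM$. A vector field on an open set is an infinitesimal automorphism of $P$ if the differentials of its (local) flow map frames in $P$ to frames in $P$. The $GN$-structure $P$ is called a Kundt structure if $\Lambda$ is integrable (i.e. closed under the Lie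 bracket of vector fields) and about each point of $M$ there exists a nowhere vanishing smooth local vector field belonging to $\lambda$ which is an infinitesimal automorphism of $P$. Then the following are equivalent: (i) $P$ is a Kundt structure. (ii) For each point $p\in M$ there are an open neighborhood $U$ of $p$ and a smooth torsion-free linear connection on $U$ that is a connection in the restriction of $P$ to $U$, i.e. whose connection forms with respect to the smooth local frames belonging to $P$ take values in the Lie algebra $\mathfrak{gn}$ of $GN$. -/

import Mathlib

open scoped Manifold ContDiff Matrix

namespace KundtGN

/-! ### The structure group -/

/-- The Minkowski inner product on `ℝ^(m+2)`, in the standard null basis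
`k = e₀, l = e₁, m₁ = e₂, …, m_m = e_(m+1)`. -/
def eta {m : ℕ} (x y : Fin (m + 2) → ℝ) : ℝ :=
  x 0 * y 1 + x 1 * y 0 + ∑ i : Fin m, x i.succ.succ * y i.succ.succ

/-- The null vector `k = e₀`. -/
def kVec (m : ℕ) : Fin (m + 2) → ℝ := Pi.single 0 1

theorem eta_comm {m : ℕ} (x y : Fin (m + 2) → ℝ) : eta x y = eta y x := by
  simp only [eta, mul_comm (y _)]
  ring

theorem eta_smul_left {m : ℕ} (c : ℝ) (x y : Fin (m + 2) → ℝ) :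
    eta (c • x) y = c * eta x y := by
  simp only [eta, Pi.smul_apply, smul_eq_mul, mul_add, Finset.mul_sum, mul_assoc]

/-- The three conditions defining the group `GN`, for a linear map given by its matrix. -/
structure IsGN {m : ℕ} (A : Matrix (Fin (m + 2)) (Fin (m + 2)) ℝ) : Prop where
  map_k : A *ᵥ kVec m ∈ Submodule.span ℝ {kVec m}
  eta_perp : ∀ w w' : Fin (m + 2) → ℝ, eta (kVec m) w = 0 → eta (kVec m) w' = 0 →
    eta (A *ᵥ w) (A *ᵥ w') = eta w w'
  eta_k : ∀ z : Fin (m + 2) → ℝ, eta (A *ᵥ kVec m) (A *ᵥ z) = eta (kVec m) z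

theorem eta_kVec_single {m : ℕ} : eta (kVec m) (Pi.single 1 1) = 1 := by
  simp [eta, kVec, Fin.ext_iff]

theorem IsGN.exists_map_k {m : ℕ} {A : Matrix (Fin (m + 2)) (Fin (m + 2)) ℝ} (hA : IsGN A) :
    ∃ c : ℝ, c ≠ 0 ∧ A *ᵥ kVec m = c • kVec m := by
  obtain ⟨c, hc⟩ := Submodule.mem_span_singleton.1 hA.map_k
  refine ⟨c, ?_, hc.symm⟩
  rintro rfl
  have h := hA.eta_k (Pi.single 1 1)
  rw [← hc, eta_smul_left, eta_kVec_single] at h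
  simp at h

theorem IsGN.perp_iff {m : ℕ} {A : Matrix (Fin (m + 2)) (Fin (m + 2)) ℝ} (hA : IsGN A)
    (w : Fin (m + 2) → ℝ) : eta (kVec m) (A *ᵥ w) = 0 ↔ eta (kVec m) w = 0 := by
  obtain ⟨c, hc0, hc⟩ := hA.exists_map_k
  have h := hA.eta_k w
  rw [hc, eta_smul_left] at h
  rw [← h]
  simp [hc0]

/-- The Lie group `GN ⊂ GL(m+2, ℝ)`. -/
def GN (m : ℕ) : Subgroup (GL (Fin (m + 2)) ℝ) where
  carrier := {a | IsGN (a : Matrix (Fin (m + 2)) (Fin (m + 2)) ℝ)}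
  one_mem' := by
    refine ⟨?_, ?_, ?_⟩ <;> simp [Submodule.mem_span_singleton_self]
  mul_mem' := by
    intro a b ha hb
    obtain ⟨c, -, hc⟩ := IsGN.exists_map_k ha
    obtain ⟨d, -, hd⟩ := IsGN.exists_map_k hb
    refine ⟨?_, ?_, ?_⟩
    · rw [Units.val_mul, ← Matrix.mulVec_mulVec, hd, Matrix.mulVec_smul, hc, smul_smul]
      exact Submodule.smul_mem _ _ (Submodule.mem_span_singleton_self _)
    · intro w w' hw hw'
      rw [Units.val_mul, ← Matrix.mulVec_mulVec, ← Matrix.mulVec_mulVec,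
        IsGN.eta_perp ha _ _ ((IsGN.perp_iff hb w).2 hw) ((IsGN.perp_iff hb w').2 hw'),
        IsGN.eta_perp hb _ _ hw hw']
    · intro z
      rw [Units.val_mul, ← Matrix.mulVec_mulVec, ← Matrix.mulVec_mulVec, ← IsGN.eta_k hb z, hd,
        Matrix.mulVec_smul, eta_smul_left, eta_smul_left, IsGN.eta_k ha]
  inv_mem' := by
    intro a ha
    obtain ⟨c, hc0, hc⟩ := IsGN.exists_map_k ha
    have hinv : ∀ z : Fin (m + 2) → ℝ,
        (a : Matrix (Fin (m + 2)) (Fin (m + 2)) ℝ) *ᵥ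
          (((a⁻¹ : GL (Fin (m + 2)) ℝ) : Matrix (Fin (m + 2)) (Fin (m + 2)) ℝ) *ᵥ z) = z := by
      intro z
      rw [Matrix.mulVec_mulVec, ← Units.val_mul, mul_inv_cancel, Units.val_one, Matrix.one_mulVec]
    have hinv' : ∀ z : Fin (m + 2) → ℝ,
        ((a⁻¹ : GL (Fin (m + 2)) ℝ) : Matrix (Fin (m + 2)) (Fin (m + 2)) ℝ) *ᵥ
          ((a : Matrix (Fin (m + 2)) (Fin (m + 2)) ℝ) *ᵥ z) = z := by
      intro z
      rw [Matrix.mulVec_mulVec, ← Units.val_mul, inv_mul_cancel, Units.val_one, Matrix.one_mulVec]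
    have hk : ((a⁻¹ : GL (Fin (m + 2)) ℝ) : Matrix (Fin (m + 2)) (Fin (m + 2)) ℝ) *ᵥ kVec m
        = c⁻¹ • kVec m := by
      have h := hinv' (kVec m)
      rw [hc, Matrix.mulVec_smul] at h
      rw [← h, smul_smul, inv_mul_cancel₀ hc0, one_smul, h]
    refine ⟨?_, ?_, ?_⟩
    · rw [hk]
      exact Submodule.smul_mem _ _ (Submodule.mem_span_singleton_self _)
    · intro w w' hw hw'
      rw [← IsGN.eta_perp ha _ _ ((IsGN.perp_iff ha _).1 (by rwa [hinv]))
        ((IsGN.perp_iff ha _).1 (by rwa [hinv])), hinv, hinv]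
    · intro z
      rw [hk, eta_smul_left, ← IsGN.eta_k ha, hinv, hc, eta_smul_left, ← mul_assoc,
        inv_mul_cancel₀ hc0, one_mul]

/-- The Lie algebra of a closed matrix group: all `A` with `exp (t A) ∈ G` for every real `t`. -/
def matrixLieAlgebra {n : ℕ} (G : Subgroup (GL (Fin n) ℝ)) : Set (Matrix (Fin n) (Fin n) ℝ) :=
  {A | ∀ t : ℝ, ∃ g ∈ G, (g : Matrix (Fin n) (Fin n) ℝ) = NormedSpace.exp (t • A)}

/-! ### `G`-structures -/

section Manifold

variable {n : ℕ} {M : Type*} [TopologicalSpace M] [ChartedSpace (EuclideanSpace ℝ (Fin n)) M]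
  [IsManifold (𝓡 n) ∞ M]

/-- The linear map `ℝⁿ → T_x M` determined by a frame `u = (u₁, …, u_n)` at `x`. -/
noncomputable def frameMap {x : M} (u : Fin n → TangentSpace (𝓡 n) x) (w : Fin n → ℝ) : TangentSpace (𝓡 n) x :=
  ∑ i, w i • u i

/-- The right action `u ↦ u a` of matrices on frames, `(u a)_j = u (a e_j) = ∑ᵢ aᵢⱼ uᵢ`. -/
noncomputable def frameMul {x : M} (u : Fin n → TangentSpace (𝓡 n) x) (a : Matrix (Fin n) (Fin n) ℝ) :
    Fin n → TangentSpace (𝓡 n) x :=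
  fun j => ∑ i, a i j • u i

/-- `X` is smooth as a vector field on the set `U` (its values off `U` are irrelevant). -/
def SmoothFieldOn (X : (x : M) → TangentSpace (𝓡 n) x) (U : Set M) : Prop :=
  ContMDiffOn (𝓡 n) (𝓡 n).tangent ∞
    (fun x => (⟨x, X x⟩ : TangentBundle (𝓡 n) M)) U

/-- A `G`-structure on `M`: a subbundle of the frame bundle whose fibres are orbits of the right
action of `G` and which has smooth local sections, i.e. a reduction of the frame bundle to `G`. -/
structure GStructure (G : Subgroup (GL (Fin n) ℝ)) (M : Type*) [TopologicalSpace M]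
    [ChartedSpace (EuclideanSpace ℝ (Fin n)) M] [IsManifold (𝓡 n) ∞ M] where
  /-- The fibre over `x`: a set of frames of `T_x M`. -/
  fibre : (x : M) → Set (Fin n → TangentSpace (𝓡 n) x)
  linearIndependent : ∀ x, ∀ u ∈ fibre x, LinearIndependent ℝ u
  mul_mem : ∀ x, ∀ u ∈ fibre x, ∀ a ∈ G, frameMul u (a : Matrix (Fin n) (Fin n) ℝ) ∈ fibre x
  transitive : ∀ x, ∀ u ∈ fibre x, ∀ u' ∈ fibre x,
    ∃ a ∈ G, u' = frameMul u (a : Matrix (Fin n) (Fin n) ℝ)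
  exists_section : ∀ p : M, ∃ U : Set M, IsOpen U ∧ p ∈ U ∧
    ∃ e : Fin n → (x : M) → TangentSpace (𝓡 n) x,
      (∀ i, SmoothFieldOn (e i) U) ∧ ∀ x ∈ U, (fun i => e i x) ∈ fibre x

/-- `e` is a smooth local section over `U` (a smooth local frame) of the `G`-structure `P`. -/
def GStructure.IsLocalSection {G : Subgroup (GL (Fin n) ℝ)} (P : GStructure G M)
    (e : Fin n → (x : M) → TangentSpace (𝓡 n) x) (U : Set M) : Prop :=
  (∀ i, SmoothFieldOn (e i) U) ∧ ∀ x ∈ U, (fun i => e i x) ∈ P.fibre x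

/-- `φ : (a, b) × V → U` is a smooth local flow of the vector field `X` on the open set `U`. -/
structure IsLocalFlow (X : (x : M) → TangentSpace (𝓡 n) x) (U : Set M) (a b : ℝ) (V : Set M)
    (φ : ℝ → M → M) : Prop where
  neg : a < 0
  pos : 0 < b
  isOpen : IsOpen V
  mapsTo : ∀ t ∈ Set.Ioo a b, ∀ x ∈ V, φ t x ∈ U
  smooth : ContMDiffOn (𝓘(ℝ, ℝ).prod (𝓡 n)) (𝓡 n) ∞ (fun q : ℝ × M => φ q.1 q.2)
    (Set.Ioo a b ×ˢ V)
  init : ∀ x ∈ V, φ 0 x = x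
  integralCurve : ∀ x ∈ V, IsMIntegralCurveOn (fun t => φ t x) X (Set.Ioo a b)

/-- The vector field `X` on the open set `U` is an infinitesimal automorphism of (the restriction
to `U` of) `P`: the differentials of all maps `φ_t` of its flow map frames in `P` to frames
in `P`. The flow of a field on an open set is only locally defined, so this is required of every
local flow. -/
def GStructure.IsInfAutOn {G : Subgroup (GL (Fin n) ℝ)} (P : GStructure G M)
    (X : (x : M) → TangentSpace (𝓡 n) x) (U : Set M) : Prop :=
  ∀ (a b : ℝ) (V : Set M) (φ : ℝ → M → M), IsLocalFlow X U a b V φ →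
    ∀ t ∈ Set.Ioo a b, ∀ x ∈ V, ∀ u ∈ P.fibre x,
      (fun i => (mfderiv (𝓡 n) (𝓡 n) (φ t) x (u i) : TangentSpace (𝓡 n) (φ t x)))
        ∈ P.fibre (φ t x)

/-- A distribution (a field of subsets of the tangent spaces) is integrable: it is closed under the
Lie bracket of smooth local vector fields. -/
def IsIntegrable (D : (x : M) → Set (TangentSpace (𝓡 n) x)) : Prop :=
  ∀ U : Set M, IsOpen U → ∀ X Y : (x : M) → TangentSpace (𝓡 n) x,
    SmoothFieldOn X U → SmoothFieldOn Y U → (∀ x ∈ U, X x ∈ D x) → (∀ x ∈ U, Y x ∈ D x) →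
    ∀ x ∈ U, VectorField.mlieBracket (𝓡 n) X Y x ∈ D x

/-! ### Connections -/

/-- A linear connection on the open set `U`, as a smooth covariant derivative on vector fields;
`cov Y x (X x)` is `(∇_X Y)(x)`. -/
structure IsConnectionOn
    (cov : ((x : M) → TangentSpace (𝓡 n) x) →
      ((x : M) → TangentSpace (𝓡 n) x →L[ℝ] TangentSpace (𝓡 n) x))
    (U : Set M) : Prop where
  isCovariantDerivativeOn : IsCovariantDerivativeOn (EuclideanSpace ℝ (Fin n)) cov U
  smooth : ContMDiffCovariantDerivativeOn (EuclideanSpace ℝ (Fin n)) ∞ cov U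

/-- `∇_X Y - ∇_Y X = [X, Y]` on `U`. -/
def IsTorsionFreeOn
    (cov : ((x : M) → TangentSpace (𝓡 n) x) →
      ((x : M) → TangentSpace (𝓡 n) x →L[ℝ] TangentSpace (𝓡 n) x))
    (U : Set M) : Prop :=
  ∀ x ∈ U, ∀ X Y : (x : M) → TangentSpace (𝓡 n) x,
    MDifferentiableAt (𝓡 n) (𝓡 n).tangent (fun y => (⟨y, X y⟩ : TangentBundle (𝓡 n) M)) x →
    MDifferentiableAt (𝓡 n) (𝓡 n).tangent (fun y => (⟨y, Y y⟩ : TangentBundle (𝓡 n) M)) x →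
    cov Y x (X x) - cov X x (Y x) = VectorField.mlieBracket (𝓡 n) X Y x

/-- The connection `cov` on `U` is a connection in the restriction of `P` to `U`: in every smooth
local frame `e` of `P`, its connection form `A`, given by `∇_v e_j = ∑ᵢ A(v)ᵢⱼ eᵢ`, takes values in
the Lie algebra of `G`. -/
def GStructure.HasConnectionOn {G : Subgroup (GL (Fin n) ℝ)} (P : GStructure G M)
    (cov : ((x : M) → TangentSpace (𝓡 n) x) →
      ((x : M) → TangentSpace (𝓡 n) x →L[ℝ] TangentSpace (𝓡 n) x))
    (U : Set M) : Prop :=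
  ∀ W : Set M, IsOpen W → W ⊆ U → ∀ e : Fin n → (x : M) → TangentSpace (𝓡 n) x,
    P.IsLocalSection e W → ∀ x ∈ W, ∀ v : TangentSpace (𝓡 n) x,
      ∃ A ∈ matrixLieAlgebra G, ∀ j, cov (e j) x v = ∑ i, A i j • e i x

end Manifold

/-! ### `GN`-structures -/

section GNStructure

variable {m : ℕ} {M : Type*} [TopologicalSpace M]
  [ChartedSpace (EuclideanSpace ℝ (Fin (m + 2))) M]
  [IsManifold (𝓡 (m + 2)) ∞ M]

/-- The line distribution `λ_x = u(ℝ k)`, `u ∈ P_x`. -/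
def nullLine (P : GStructure (GN m) M) (x : M) : Set (TangentSpace (𝓡 (m + 2)) x) :=
  {v | ∃ u ∈ P.fibre x, ∃ w ∈ Submodule.span ℝ {kVec m}, v = frameMap u w}

/-- The hyperplane distribution `Λ_x = u({k}^⊥)`, `u ∈ P_x`. -/
def nullPerp (P : GStructure (GN m) M) (x : M) : Set (TangentSpace (𝓡 (m + 2)) x) :=
  {v | ∃ u ∈ P.fibre x, ∃ w : Fin (m + 2) → ℝ, eta (kVec m) w = 0 ∧ v = frameMap u w}

/-- Kundt structures: `Λ` is integrable and about each point there is a nowhere vanishing local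
vector field in `λ` which is an infinitesimal automorphism. -/
structure IsKundt (P : GStructure (GN m) M) : Prop where
  integrable : IsIntegrable (nullPerp P)
  exists_infAut : ∀ p : M, ∃ U : Set M, IsOpen U ∧ p ∈ U ∧
    ∃ X : (x : M) → TangentSpace (𝓡 (m + 2)) x,
      SmoothFieldOn X U ∧ (∀ x ∈ U, X x ∈ nullLine P x) ∧ (∀ x ∈ U, X x ≠ 0) ∧ P.IsInfAutOn X U

end GNStructure

end KundtGN

/-! Everything is reduced to matrices by working in a local section e of P, with e 0 spanning λ and
e i, i ≠ 1, spanning Λ. By `isInfGN_iff`, a matrix A lies in the Lie algebra of `GN` when column 0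
vanishes below the diagonal, row 1 vanishes from column 2 on, A 0 0 + A 1 1 = 0, and the block of
indices at least 2 is skew. The entries (0, j) with j ≠ 0 and (i, 1) with i ≥ 2 are free. This is
larger than the stabiliser of a null line in the Lorentz algebra, where those entries are linked.

The flow condition on a field X becomes a bracket condition. In the frame e the matrix C(t) of the
differential of the flow satisfies C' = -B C, where column j of B holds the components of [X, e j]
along the orbit (`IsLocalFlow.hasDerivAt_coeff`). Hence X is an infinitesimal automorphism exactly
when B is infinitesimally in `GN`: one direction differentiates C at 0 on an existing flow
(`isInfGN_mlieBracket`), the other uses uniqueness for linear equations (`isInfAutOn_of_isInfGN`).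
Existence of smooth flows is obtained by inverting a smooth map on a space of continuous paths.

From a connection to Kundt: row 1 of the connection form is diagonal, so ∇ preserves Λ, and [X, Y] =
∇_X Y - ∇_Y X makes Λ integrable. For X = f e 0, vanishing torsion gives B = f A(e 0) minus a matrix
supported in row 0. The only surviving condition is the one on B 0 0 + B 1 1, which reads e 0 (f) =
-f A(e 0) 0 0; writing f = exp g turns it into a linear equation, solvable along the nonvanishing
field e 0 (`exists_mvfderiv_apply_eq`).

From Kundt to a connection: the frame is rescaled within P so that e 0 is the given infinitesimal
automorphism. The structure functions c a i j then satisfy two constraints: the matrix c · 0 · is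
infinitesimally in `GN`, and c 1 i j = 0 for i, j ≠ 1 by integrability. Under these, `christoffel`
solves Γ a i j - Γ a j i = c a i j with every Γ · i · in the Lie algebra: the free entries absorb
most of the torsion, and the skew block is handled by Koszul's formula. A change of section alters
the connection form by a conjugation and a logarithmic derivative in `GN`, so one section suffices
(`hasConnectionOn_frameConnection`). -/

namespace KundtGN

/-! ### Smooth dependence of flows on initial conditions -/

section Flow

universe u

open Set Filter Topology

variable {K E F : Type*} [TopologicalSpace K] [CompactSpace K]
  [NormedAddCommGroup E] [NormedSpace ℝ E] [NormedAddCommGroup F] [NormedSpace ℝ F]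

/-- Pointwise application of a continuous family of linear maps to a continuous map. -/
noncomputable def pointwiseApply (K E F : Type*) [TopologicalSpace K] [CompactSpace K]
    [NormedAddCommGroup E] [NormedSpace ℝ E] [NormedAddCommGroup F] [NormedSpace ℝ F] :
    C(K, E →L[ℝ] F) →L[ℝ] C(K, E) →L[ℝ] C(K, F) :=
  LinearMap.mkContinuous₂
    (LinearMap.mk₂ ℝ (fun (A : C(K, E →L[ℝ] F)) (y : C(K, E)) =>
        (⟨fun s => A s (y s), A.continuous.clm_apply y.continuous⟩ : C(K, F)))
      (fun A A' y => by ext; simp) (fun c A y => by ext; simp)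
      (fun A y y' => by ext; simp) (fun c A y => by ext; simp))
    1 (fun A y => by
      rw [one_mul, ContinuousMap.norm_le _ (by positivity)]
      intro s
      refine ((A s).le_opNorm _).trans ?_
      gcongr
      · exact A.norm_coe_le_norm s
      · exact y.norm_coe_le_norm s)

/-- The range of y is compact, so g' is uniformly close to its values there on a uniform
neighbourhood. The mean value inequality at each s then bounds the remainder with the same ε for all
s. -/
theorem hasFDerivAt_continuousMap_comp {g : C(E, F)} {g' : C(E, E →L[ℝ] F)}
    (hg : ∀ x, HasFDerivAt g (g' x) x) (y : C(K, E)) :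
    HasFDerivAt (fun y : C(K, E) => g.comp y) (pointwiseApply K E F (g'.comp y)) y := by
  rw [hasFDerivAt_iff_isLittleO, Asymptotics.isLittleO_iff]
  intro ε hε
  have hcomp : IsCompact (range y) := isCompact_range y.continuous
  have hu := hcomp.uniformContinuousAt_of_continuousAt g'
    (fun a _ => g'.continuous.continuousAt) (Metric.dist_mem_uniformity hε)
  obtain ⟨δ, hδ, hu⟩ := Metric.mem_uniformity_dist.1 hu
  filter_upwards [Metric.ball_mem_nhds y hδ] with z hz
  rw [ContinuousMap.norm_le _ (by positivity)]
  intro s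
  have hzs : dist (z s) (y s) < δ := (ContinuousMap.dist_apply_le_dist s).trans_lt hz
  have := (convex_ball (y s) δ).norm_image_sub_le_of_norm_hasFDerivWithin_le'
    (f := g) (f' := g') (φ := g' (y s)) (C := ε) (x := y s) (y := z s)
    (fun w _ => (hg w).hasFDerivWithinAt)
    (fun w hw => by
      have h1 : dist (g' (y s)) (g' w) < ε := hu (by rw [dist_comm]; exact hw) ⟨s, rfl⟩
      rw [dist_comm, dist_eq_norm] at h1
      exact h1.le)
    (Metric.mem_ball_self hδ) hzs
  refine this.trans ?_
  gcongr
  exact (z - y).norm_coe_le_norm s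

/-- Induction on n: the derivative of y ↦ g ∘ y is the continuous linear map `pointwiseApply`
applied to y ↦ g' ∘ y, which is a map of the same kind with target E →L[ℝ] F. The target F is
therefore quantified inside the induction and kept in the universe of E. -/
theorem contDiff_nat_continuousMap_comp {K : Type*} {E : Type u} [TopologicalSpace K]
    [CompactSpace K] [NormedAddCommGroup E] [NormedSpace ℝ E] (n : ℕ) :
    ∀ {F : Type u} [NormedAddCommGroup F] [NormedSpace ℝ F] (g : C(E, F)),
      ContDiff ℝ n g → ContDiff ℝ n (fun y : C(K, E) => g.comp y) := by
  induction n with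
  | zero =>
    intro F _ _ g _
    rw [Nat.cast_zero, contDiff_zero]
    exact g.continuous_postcomp
  | succ n ih =>
    intro F _ _ g hg
    have hg1 : ContDiff ℝ (n + 1) g := by exact_mod_cast hg
    obtain ⟨g', hg', hd⟩ := contDiff_succ_iff_hasFDerivAt.1 hg1
    have h1 : ContDiff ℝ n (fun y : C(K, E) => (⟨g', hg'.continuous⟩ : C(E, E →L[ℝ] F)).comp y) :=
      ih ⟨g', hg'.continuous⟩ hg'
    have h0 : ContDiff ℝ n (fun A => pointwiseApply K E F A) :=
      ContinuousLinearMap.contDiff (𝕜 := ℝ) (E := C(K, E →L[ℝ] F)) (F := C(K, E) →L[ℝ] C(K, F))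
        (pointwiseApply K E F)
    have h2 : ContDiff ℝ n (fun y : C(K, E) => pointwiseApply K E F
        ((⟨g', hg'.continuous⟩ : C(E, E →L[ℝ] F)).comp y)) :=
      ContDiff.comp (g := fun A => pointwiseApply K E F A) h0 h1
    have h : ContDiff ℝ (n + 1) (fun y : C(K, E) => g.comp y) :=
      contDiff_succ_iff_hasFDerivAt.2
        ⟨_, h2, fun y => hasFDerivAt_continuousMap_comp (g' := ⟨g', hg'.continuous⟩) hd y⟩
    exact_mod_cast h

/-- Composition with a smooth map is smooth on the space of continuous maps. -/
theorem contDiff_continuousMap_comp {K : Type*} {E F : Type u} [TopologicalSpace K]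
    [CompactSpace K] [NormedAddCommGroup E] [NormedSpace ℝ E] [NormedAddCommGroup F]
    [NormedSpace ℝ F] (g : C(E, F)) (hg : ContDiff ℝ ∞ g) :
    ContDiff ℝ ∞ (fun y : C(K, E) => g.comp y) :=
  contDiff_infty.2 fun n => contDiff_nat_continuousMap_comp n g (contDiff_infty.1 hg n)

/-- The inverse function theorem, with a smooth inverse on the whole target. -/
theorem exists_smooth_localInverse [CompleteSpace E] {f : E → F} {a : E} {f' : E ≃L[ℝ] F}
    (hf : ∀ᶠ x in 𝓝 a, ContDiffAt ℝ ∞ f x) (hf' : HasFDerivAt f (f' : E →L[ℝ] F) a) :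
    ∃ φ : OpenPartialHomeomorph E F, a ∈ φ.source ∧ (φ : E → F) = f ∧
      ContDiffOn ℝ ∞ φ.symm φ.target := by
  have hfa : ContDiffAt ℝ ∞ f a := hf.self_of_nhds
  set φ := hfa.toOpenPartialHomeomorph f hf' (by simp)
  -- Invertible operators form an open set, so the derivative stays invertible near a. Restricting
  -- the source to such points makes the inverse smooth on the whole target.
  have hinv : ∀ᶠ x in 𝓝 a, fderiv ℝ f x ∈ range ((↑) : (E ≃L[ℝ] F) → E →L[ℝ] F) := by
    have hc : ContinuousAt (fderiv ℝ f) a :=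
      (hfa.fderiv_right (m := 0) (by simp)).continuousAt
    refine hc.eventually (ContinuousLinearEquiv.isOpen.mem_nhds ?_)
    exact ⟨f', hf'.fderiv.symm⟩
  obtain ⟨W, hW, hWo, haW⟩ := mem_nhds_iff.1 (hf.and hinv)
  refine ⟨φ.restrOpen W hWo, ⟨hfa.mem_toOpenPartialHomeomorph_source hf' (by simp), haW⟩,
    rfl, ?_⟩
  intro y hy
  have hy1 : (φ.restrOpen W hWo).symm y ∈ (φ.restrOpen W hWo).source :=
    (φ.restrOpen W hWo).map_target hy
  obtain ⟨h1, e, he⟩ := hW hy1.2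
  refine ((φ.restrOpen W hWo).contDiffAt_symm hy (f₀' := e) ?_ h1).contDiffWithinAt
  rw [he]
  exact (h1.differentiableAt (by simp)).hasFDerivAt

/-- Multiplication by a bump function. It replaces a local field by a global one, as needed for the
composition operator on continuous paths. -/
theorem exists_contDiff_eventuallyEq [FiniteDimensional ℝ E] {f : E → F} {Ω : Set E}
    (hΩ : IsOpen Ω) (hf : ContDiffOn ℝ ∞ f Ω) {x₀ : E} (hx₀ : x₀ ∈ Ω) :
    ∃ g : E → F, ContDiff ℝ ∞ g ∧ ∃ W, IsOpen W ∧ x₀ ∈ W ∧ W ⊆ Ω ∧ EqOn g f W := by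
  obtain ⟨r, hr, hrΩ⟩ := Metric.nhds_basis_closedBall.mem_iff.1 (hΩ.mem_nhds hx₀)
  let χ : ContDiffBump x₀ := ⟨r / 2, r, by positivity, by linarith⟩
  refine ⟨fun x => χ x • f x, ?_, Metric.ball x₀ (r / 2), Metric.isOpen_ball,
    Metric.mem_ball_self (by positivity),
    (Metric.ball_subset_closedBall.trans (Metric.closedBall_subset_closedBall (by linarith))).trans
      hrΩ, fun x hx => ?_⟩
  · rw [contDiff_iff_contDiffAt]
    intro x
    by_cases hx : x ∈ Ω
    · exact χ.contDiffAt.smul (hf.contDiffAt (hΩ.mem_nhds hx))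
    · have hx' : x ∈ (Metric.closedBall x₀ r)ᶜ := fun h => hx (hrΩ h)
      refine (contDiffAt_const (c := (0 : F))).congr_of_eventuallyEq ?_
      filter_upwards [Metric.isClosed_closedBall.isOpen_compl.mem_nhds hx'] with z hz
      have hz' : r < dist z x₀ := by simpa using hz
      rw [χ.zero_of_le_dist hz'.le, zero_smul]
  · have : χ x = 1 := χ.one_of_mem_closedBall (Metric.ball_subset_closedBall hx)
    simp [this]

/-- Integration from `0`, as an operator on continuous maps on the unit interval. -/
noncomputable def integralOperator (E : Type*) [NormedAddCommGroup E] [NormedSpace ℝ E] :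
    C(unitInterval, E) →L[ℝ] C(unitInterval, E) :=
  LinearMap.mkContinuous
    { toFun := fun y => ⟨fun s => ∫ σ in (0 : ℝ)..s, y (projIcc 0 1 zero_le_one σ),
        (intervalIntegral.continuous_primitive (fun a b =>
          (y.continuous.comp continuous_projIcc).intervalIntegrable a b) 0).comp
            continuous_subtype_val⟩
      map_add' := fun y z => by
        ext s
        exact intervalIntegral.integral_add
          ((y.continuous.comp continuous_projIcc).intervalIntegrable _ _)
          ((z.continuous.comp continuous_projIcc).intervalIntegrable _ _)
      map_smul' := fun c y => by
        ext s
        exact intervalIntegral.integral_smul c _ }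
    1 (fun y => by
      rw [one_mul, ContinuousMap.norm_le _ (norm_nonneg _)]
      intro s
      refine (intervalIntegral.norm_integral_le_of_norm_le_const (C := ‖y‖)
        fun σ _ => y.norm_coe_le_norm _).trans ?_
      rw [sub_zero, abs_of_nonneg s.2.1]
      exact mul_le_of_le_one_right (norm_nonneg _) s.2.2)

theorem integralOperator_apply (y : C(unitInterval, E)) (s : unitInterval) :
    integralOperator E y s = ∫ σ in (0 : ℝ)..s, y (projIcc 0 1 zero_le_one σ) := rfl

/-- The substitution σ ↦ s σ. It shows that slowing a path down by the factor s amounts to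
multiplying the time parameter of the integral equation by s. -/
theorem integralOperator_comp_mul (y : C(unitInterval, E)) (s r : unitInterval) :
    (s : ℝ) • integralOperator E (y.comp ⟨fun r => s * r, by fun_prop⟩) r =
      integralOperator E y (s * r) := by
  rw [integralOperator_apply, integralOperator_apply]
  have h := intervalIntegral.smul_integral_comp_mul_left (a := 0) (b := r)
    (fun σ => y (projIcc 0 1 zero_le_one σ)) (s : ℝ)
  rw [mul_zero] at h
  rw [Set.Icc.coe_mul, ← h]
  congr 1
  refine intervalIntegral.integral_congr fun σ hσ => ?_
  rw [uIcc_of_le r.2.1] at hσ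
  have hσ1 : σ ∈ Icc (0 : ℝ) 1 := ⟨hσ.1, hσ.2.trans r.2.2⟩
  have hσ2 : (s : ℝ) * σ ∈ Icc (0 : ℝ) 1 :=
    ⟨mul_nonneg s.2.1 hσ.1, mul_le_one₀ s.2.2 hσ.1 hσ1.2⟩
  simp only [ContinuousMap.comp_apply, ContinuousMap.coe_mk, projIcc_of_mem _ hσ1,
    projIcc_of_mem _ hσ2]
  rfl

/-- A smooth vector field has a smooth local flow. -/
theorem exists_smooth_flow_of_contDiff {E : Type u} [NormedAddCommGroup E] [NormedSpace ℝ E]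
    [CompleteSpace E] {f : E → E} (hf : ContDiff ℝ ∞ f) (x₀ : E) :
    ∃ ε > 0, ∃ V : Set E, IsOpen V ∧ x₀ ∈ V ∧ ∃ φ : ℝ → E → E,
      ContDiffOn ℝ ∞ (fun q : ℝ × E => φ q.1 q.2) (Ioo (-ε) ε ×ˢ V) ∧ (∀ x ∈ V, φ 0 x = x) ∧
      ∀ t ∈ Ioo (-ε) ε, ∀ x ∈ V, HasDerivAt (fun s => φ s x) (f (φ t x)) t := by
  let J := integralOperator E
  let N : C(unitInterval, E) → C(unitInterval, E) := fun y => (⟨f, hf.continuous⟩ : C(E, E)).comp y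
  let c : E →L[ℝ] C(unitInterval, E) := ContinuousLinearMap.const ℝ unitInterval
  have hN : ContDiff ℝ ∞ N := contDiff_continuousMap_comp _ hf
  -- Time is rescaled to the unit interval: G (t, y) = (t, const x) says y(s) = x + t ∫₀ˢ f(y), so
  -- that y(s) is the flow at time t s. At t = 0 the derivative in y is the identity, and the
  -- inverse function theorem applies without any smallness assumption.
  let G : ℝ × C(unitInterval, E) → ℝ × C(unitInterval, E) :=
    fun q => (q.1, q.2 - q.1 • J (N q.2))
  have hJN : ContDiff ℝ ∞ (fun y => J (N y)) := J.contDiff.comp hN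
  have hG : ContDiff ℝ ∞ G :=
    contDiff_fst.prodMk (contDiff_snd.sub (contDiff_fst.smul (hJN.comp contDiff_snd)))
  let w := J (N (c x₀))
  let G' : (ℝ × C(unitInterval, E)) ≃L[ℝ] ℝ × C(unitInterval, E) :=
    ContinuousLinearEquiv.equivOfInverse
      ((ContinuousLinearMap.fst ℝ ℝ _).prod (ContinuousLinearMap.snd ℝ ℝ _ -
        (ContinuousLinearMap.fst ℝ ℝ _).smulRight w))
      ((ContinuousLinearMap.fst ℝ ℝ _).prod (ContinuousLinearMap.snd ℝ ℝ _ +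
        (ContinuousLinearMap.fst ℝ ℝ _).smulRight w))
      (fun q => by ext <;> simp) (fun q => by ext <;> simp)
  have hG' : HasFDerivAt G (G' : (ℝ × C(unitInterval, E)) →L[ℝ] ℝ × C(unitInterval, E))
      (0, c x₀) := by
    have h1 : HasFDerivAt (fun q : ℝ × C(unitInterval, E) => J (N q.2)) _ (0, c x₀) :=
      ((hJN.differentiable (by simp)).comp differentiable_snd).differentiableAt.hasFDerivAt
    have h2 := (hasFDerivAt_fst (𝕜 := ℝ) (p := ((0 : ℝ), c x₀))).prodMk
      ((hasFDerivAt_snd (𝕜 := ℝ) (p := ((0 : ℝ), c x₀))).sub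
        ((hasFDerivAt_fst (𝕜 := ℝ) (p := ((0 : ℝ), c x₀))).smul h1))
    refine h2.congr_fderiv ?_
    ext q <;> simp [G', w]
  obtain ⟨Φ, hΦs, hΦG, hΦ⟩ := exists_smooth_localInverse
    (Eventually.of_forall fun x => hG.contDiffAt) hG'
  have hG0 : G (0, c x₀) = (0, c x₀) := by simp [G]
  have hΦt : (0, c x₀) ∈ Φ.target := by
    have := Φ.map_source hΦs
    rwa [hΦG, hG0] at this
  have hΦ0 : Φ.symm (0, c x₀) = (0, c x₀) := by
    have := Φ.left_inv hΦs
    rwa [hΦG, hG0] at this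
  let Y : ℝ × E → C(unitInterval, E) := fun q => (Φ.symm (q.1, c q.2)).2
  have hpc : Continuous (fun q : ℝ × E => (q.1, c q.2)) := by fun_prop
  have hpcd : ContDiff ℝ ∞ (fun q : ℝ × E => (q.1, c q.2)) :=
    contDiff_fst.prodMk (c.contDiff.comp contDiff_snd)
  have hYd : ContDiffOn ℝ ∞ Y ((fun q : ℝ × E => (q.1, c q.2)) ⁻¹' Φ.target) :=
    contDiff_snd.comp_contDiffOn (hΦ.comp hpcd.contDiffOn (fun q hq => hq))
  have hYeq : ∀ q : ℝ × E, (q.1, c q.2) ∈ Φ.target →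
      Y q - q.1 • J (N (Y q)) = c q.2 ∧ Φ.symm (q.1, c q.2) = (q.1, Y q) := by
    intro q hq
    have h := Φ.right_inv hq
    rw [hΦG] at h
    have h1 : (Φ.symm (q.1, c q.2)).1 = q.1 := congrArg Prod.fst h
    have h2 := congrArg Prod.snd h
    simp only [G] at h2
    rw [h1] at h2
    exact ⟨h2, Prod.ext h1 rfl⟩
  -- The whole ρ-ball lies in the source of Φ, where G is injective. It is stable under t ↦ t s and
  -- under reparametrising paths by r ↦ s r, since the latter does not increase the sup distance to
  -- a constant path.
  obtain ⟨ρ, hρ, hρs⟩ := Metric.mem_nhds_iff.1 (Φ.open_source.mem_nhds hΦs)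
  have htgt : (fun q : ℝ × E => (q.1, c q.2)) ⁻¹' Φ.target ∈ 𝓝 ((0 : ℝ), x₀) :=
    (Φ.open_target.preimage hpc).mem_nhds hΦt
  have hYc : ContinuousAt Y (0, x₀) := hYd.continuousOn.continuousAt htgt
  have hY0 : Y (0, x₀) = c x₀ := congrArg Prod.snd hΦ0
  have hnear : ∀ᶠ q in 𝓝 ((0 : ℝ), x₀), Y q ∈ Metric.ball (c x₀) ρ :=
    hYc.eventually (by rw [hY0]; exact Metric.ball_mem_nhds _ hρ)
  obtain ⟨ε, hε, hball⟩ := Metric.mem_nhds_iff.1 (inter_mem htgt hnear)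
  have hprod : ∀ t ∈ Ioo (-(min ε ρ)) (min ε ρ), ∀ x ∈ Metric.ball x₀ ε,
      (t, c x) ∈ Φ.target ∧ Y (t, x) ∈ Metric.ball (c x₀) ρ := by
    intro t ht x hx
    have : (t, x) ∈ Metric.ball ((0 : ℝ), x₀) ε := by
      rw [← ball_prod_same]
      refine ⟨?_, hx⟩
      rw [Metric.mem_ball, dist_zero_right, Real.norm_eq_abs, abs_lt]
      exact ⟨(neg_le_neg (min_le_left _ _)).trans_lt ht.1, ht.2.trans_le (min_le_left _ _)⟩
    exact hball this
  -- The slowed-down path solves the equation with parameter t s, and injectivity of G identifies it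
  -- with Y (t s, x). Thus the endpoint of Y (t s, x) is the value of Y (t, x) at s.
  have hscale : ∀ t ∈ Ioo (-(min ε ρ)) (min ε ρ), ∀ x ∈ Metric.ball x₀ ε, ∀ s : unitInterval,
      Y (t * s, x) = (Y (t, x)).comp ⟨fun r => s * r, by fun_prop⟩ := by
    intro t ht x hx s
    set z := (Y (t, x)).comp ⟨fun r => s * r, by fun_prop⟩ with hz
    have hts : t * s ∈ Ioo (-(min ε ρ)) (min ε ρ) := by
      rw [mem_Ioo, ← abs_lt] at ht ⊢
      rw [abs_mul, abs_of_nonneg s.2.1]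
      exact (mul_le_of_le_one_right (abs_nonneg _) s.2.2).trans_lt ht
    obtain ⟨h1, h2⟩ := hprod t ht x hx
    obtain ⟨h3, -⟩ := hprod _ hts x hx
    have hzG : G (t * s, z) = (t * s, c x) := by
      refine Prod.ext rfl ?_
      ext r
      have h4 := congrArg (fun y : C(unitInterval, E) => y (s * r)) (hYeq (t, x) h1).1
      have h5 := integralOperator_comp_mul (N (Y (t, x))) s r
      have h6 : (N (Y (t, x))).comp ⟨fun r => s * r, by fun_prop⟩ = N z := rfl
      rw [h6] at h5
      change z r - (t * s) • J (N z) r = x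
      rw [mul_smul, h5]
      exact h4
    have hzs : (t * s, z) ∈ Φ.source := by
      refine hρs ?_
      rw [← ball_prod_same]
      constructor
      · rw [Metric.mem_ball, dist_zero_right, Real.norm_eq_abs, abs_lt]
        exact ⟨(neg_le_neg (min_le_right _ _)).trans_lt hts.1, hts.2.trans_le (min_le_right _ _)⟩
      · rw [Metric.mem_ball, ContinuousMap.dist_lt_iff hρ] at h2 ⊢
        intro r
        exact h2 (s * r)
    have h7 := Φ.left_inv hzs
    rw [hΦG, hzG, (hYeq (t * s, x) h3).2] at h7
    exact congrArg Prod.snd h7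
  refine ⟨min ε ρ, lt_min hε hρ, Metric.ball x₀ ε, Metric.isOpen_ball, Metric.mem_ball_self hε,
    fun t x => Y (t, x) 1, ?_, ?_, ?_⟩
  · exact (ContinuousMap.evalCLM ℝ (1 : unitInterval)).contDiff.comp_contDiffOn
      (ContDiffOn.mono (t := Ioo (-(min ε ρ)) (min ε ρ) ×ˢ Metric.ball x₀ ε) hYd
        fun q hq => (hprod q.1 hq.1 q.2 hq.2).1)
  · intro x hx
    have h0 : (0 : ℝ) ∈ Ioo (-(min ε ρ)) (min ε ρ) := by
      have := lt_min hε hρ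
      constructor <;> linarith
    have h := (hYeq (0, x) (hprod 0 h0 x hx).1).1
    rw [zero_smul, sub_zero] at h
    change Y (0, x) 1 = x
    rw [h]
    rfl
  · intro t ht x hx
    have hcont : ContinuousOn (fun τ => f (Y (τ, x) 1)) (Ioo (-(min ε ρ)) (min ε ρ)) := by
      refine hf.continuous.comp_continuousOn
        ((ContinuousMap.evalCLM ℝ (1 : unitInterval)).continuous.comp_continuousOn ?_)
      exact hYd.continuousOn.comp (by fun_prop) fun τ hτ => (hprod τ hτ x hx).1
    -- By the scaling identity the path equation becomes the usual integral equation for t ↦ Y (t,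
    -- x) 1, to which the fundamental theorem of calculus applies.
    have hint : ∀ t ∈ Ioo (-(min ε ρ)) (min ε ρ),
        Y (t, x) 1 = x + ∫ τ in (0 : ℝ)..t, f (Y (τ, x) 1) := by
      intro t ht
      have h := congrArg (fun y : C(unitInterval, E) => y 1) (hYeq (t, x) (hprod t ht x hx).1).1
      have h1 : Y (t, x) 1 - t • J (N (Y (t, x))) 1 = x := h
      rw [sub_eq_iff_eq_add] at h1
      rw [h1]
      congr 1
      have h2 : J (N (Y (t, x))) 1 = ∫ σ in (0 : ℝ)..1, f (Y (t * σ, x) 1) := by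
        change ∫ σ in (0 : ℝ)..1, f (Y (t, x) (projIcc 0 1 zero_le_one σ)) = _
        refine intervalIntegral.integral_congr fun σ hσ => ?_
        rw [uIcc_of_le zero_le_one] at hσ
        have h3 := hscale t ht x hx ⟨σ, hσ⟩
        rw [show Y (t * σ, x) = _ from h3, projIcc_of_mem _ hσ]
        simp
      rw [h2]
      have h4 := intervalIntegral.smul_integral_comp_mul_left (a := 0) (b := 1)
        (fun τ => f (Y (τ, x) 1)) t
      rw [mul_zero, mul_one] at h4
      exact h4
    have h0 : (0 : ℝ) ∈ Ioo (-(min ε ρ)) (min ε ρ) := by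
      have := lt_min hε hρ
      constructor <;> linarith
    have hsub : uIcc 0 t ⊆ Ioo (-(min ε ρ)) (min ε ρ) := ordConnected_Ioo.uIcc_subset h0 ht
    have hd := intervalIntegral.integral_hasDerivAt_right
      ((hcont.mono hsub).intervalIntegrable)
      (hcont.stronglyMeasurableAtFilter isOpen_Ioo t ht)
      (hcont.continuousAt (isOpen_Ioo.mem_nhds ht))
    refine (hd.const_add x).congr_of_eventuallyEq ?_
    filter_upwards [isOpen_Ioo.mem_nhds ht] with τ hτ using hint τ hτ

/-- A smooth vector field on an open set has a smooth local flow about each point. -/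
theorem exists_smooth_flow {E : Type u} [NormedAddCommGroup E] [NormedSpace ℝ E]
    [FiniteDimensional ℝ E] {f : E → E} {Ω : Set E} (hΩ : IsOpen Ω) (hf : ContDiffOn ℝ ∞ f Ω)
    {x₀ : E} (hx₀ : x₀ ∈ Ω) :
    ∃ ε > 0, ∃ V : Set E, IsOpen V ∧ x₀ ∈ V ∧ ∃ φ : ℝ → E → E,
      ContDiffOn ℝ ∞ (fun q : ℝ × E => φ q.1 q.2) (Ioo (-ε) ε ×ˢ V) ∧ (∀ x ∈ V, φ 0 x = x) ∧
      (∀ t ∈ Ioo (-ε) ε, ∀ x ∈ V, φ t x ∈ Ω) ∧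
      ∀ t ∈ Ioo (-ε) ε, ∀ x ∈ V, HasDerivAt (fun s => φ s x) (f (φ t x)) t := by
  have : CompleteSpace E := FiniteDimensional.complete ℝ E
  obtain ⟨g, hg, W, hW, hx₀W, hWΩ, hgf⟩ := exists_contDiff_eventuallyEq hΩ hf hx₀
  obtain ⟨ε, hε, V, hV, hx₀V, φ, hφ, hφ0, hφd⟩ := exists_smooth_flow_of_contDiff hg x₀
  have h0 : ((0 : ℝ), x₀) ∈ Ioo (-ε) ε ×ˢ V := ⟨⟨by linarith, hε⟩, hx₀V⟩
  have hc : ContinuousAt (fun q : ℝ × E => φ q.1 q.2) (0, x₀) :=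
    hφ.continuousOn.continuousAt ((isOpen_Ioo.prod hV).mem_nhds h0)
  -- Times and initial points are cut down so that orbits remain in W, where the global field g
  -- coincides with f.
  have hmem : ∀ᶠ q in 𝓝 ((0 : ℝ), x₀), φ q.1 q.2 ∈ W :=
    hc.eventually (by simpa [hφ0 x₀ hx₀V] using hW.mem_nhds hx₀W)
  obtain ⟨δ, hδ, hball⟩ := Metric.mem_nhds_iff.1 hmem
  have hsub : ∀ t ∈ Ioo (-(min ε δ)) (min ε δ), t ∈ Ioo (-ε) ε ∧ t ∈ Metric.ball (0 : ℝ) δ := by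
    intro t ht
    rw [mem_Ioo, ← abs_lt] at ht
    refine ⟨?_, ?_⟩
    · rw [mem_Ioo, ← abs_lt]
      exact ht.trans_le (min_le_left _ _)
    · rw [Metric.mem_ball, dist_zero_right, Real.norm_eq_abs]
      exact ht.trans_le (min_le_right _ _)
  have hW' : ∀ t ∈ Ioo (-(min ε δ)) (min ε δ), ∀ x ∈ V ∩ Metric.ball x₀ δ, φ t x ∈ W := by
    intro t ht x hx
    refine @hball (t, x) ?_
    rw [← ball_prod_same]
    exact ⟨(hsub t ht).2, hx.2⟩
  refine ⟨min ε δ, lt_min hε hδ, V ∩ Metric.ball x₀ δ, hV.inter Metric.isOpen_ball,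
    ⟨hx₀V, Metric.mem_ball_self hδ⟩, φ, hφ.mono ?_, fun x hx => hφ0 x hx.1,
    fun t ht x hx => hWΩ (hW' t ht x hx), fun t ht x hx => ?_⟩
  · rintro q ⟨hq1, hq2⟩
    exact ⟨(hsub _ hq1).1, hq2.1⟩
  · rw [← hgf (hW' t ht x hx)]
    exact hφd t (hsub t ht).1 x hx.1

end Flow
-- Linearised flows, and first-order equations along a field
section FlowCalculus

open Set Filter Topology

universe u

variable {E : Type u} [NormedAddCommGroup E] [NormedSpace ℝ E]

/-- The linearised flow satisfies the variational equation. -/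
theorem hasDerivAt_fderiv_flow {φ : ℝ → E → E} {I : Set ℝ} {V : Set E} (hI : IsOpen I)
    (hV : IsOpen V) (hφ : ContDiffOn ℝ ∞ (fun q : ℝ × E => φ q.1 q.2) (I ×ˢ V)) {f : E → E}
    (hf : ∀ t ∈ I, ∀ x ∈ V, DifferentiableAt ℝ f (φ t x))
    (hd : ∀ t ∈ I, ∀ x ∈ V, HasDerivAt (fun s => φ s x) (f (φ t x)) t)
    {t : ℝ} (ht : t ∈ I) {x : E} (hx : x ∈ V) (v : E) :
    HasDerivAt (fun s => fderiv ℝ (φ s) x v) (fderiv ℝ f (φ t x) (fderiv ℝ (φ t) x v)) t := by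
  set Φ : ℝ × E → E := fun q => φ q.1 q.2 with hΦ
  have hcd : ∀ s ∈ I, ∀ y ∈ V, ContDiffAt ℝ ∞ Φ (s, y) := fun s hs y hy =>
    hφ.contDiffAt ((hI.prod hV).mem_nhds ⟨hs, hy⟩)
  have hΦd : ∀ s ∈ I, ∀ y ∈ V, HasFDerivAt Φ (fderiv ℝ Φ (s, y)) (s, y) := fun s hs y hy =>
    ((hcd s hs y hy).differentiableAt (by simp)).hasFDerivAt
  have hspace : ∀ s ∈ I, ∀ y ∈ V,
      HasFDerivAt (φ s) ((fderiv ℝ Φ (s, y)).comp (ContinuousLinearMap.inr ℝ ℝ E)) y := by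
    intro s hs y hy
    exact (hΦd s hs y hy).comp y (hasFDerivAt_prodMk_right s y)
  have htime : ∀ s ∈ I, ∀ y ∈ V, fderiv ℝ Φ (s, y) (1, 0) = f (φ s y) := by
    intro s hs y hy
    have h1 : HasDerivAt (fun r => Φ (r, y)) (fderiv ℝ Φ (s, y) (1, 0)) s :=
      (hΦd s hs y hy).comp_hasDerivAt (f := fun r => (r, y)) s ((hasDerivAt_id s).prodMk (hasDerivAt_const s y))
    exact h1.unique (hd s hs y hy)
  have hD : HasFDerivAt (fderiv ℝ Φ) (fderiv ℝ (fderiv ℝ Φ) (t, x)) (t, x) :=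
    (((hcd t ht x hx).fderiv_right (m := 1) (by rw [one_add_one_eq_two]; exact ENat.LEInfty.out)).differentiableAt
      one_ne_zero).hasFDerivAt
  -- Symmetry of the second derivative exchanges ∂_t with the derivative in x; the latter is then
  -- applied to ∂_t Φ = f ∘ Φ.
  have hsymm : IsSymmSndFDerivAt ℝ Φ (t, x) := (hcd t ht x hx).isSymmSndFDerivAt
    (by rw [minSmoothness_of_isRCLikeNormedField]; exact ENat.LEInfty.out)
  have h1 : HasDerivAt (fun s => fderiv ℝ Φ (s, x) (0, v))
      (fderiv ℝ (fderiv ℝ Φ) (t, x) (1, 0) (0, v)) t := by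
    have h := hD.comp_hasDerivAt t ((hasDerivAt_id t).prodMk (hasDerivAt_const t x))
    exact ((ContinuousLinearMap.apply ℝ E ((0 : ℝ), v)).hasFDerivAt).comp_hasDerivAt t h
  have h2 : HasFDerivAt (fun y => fderiv ℝ Φ (t, y) (1, 0))
      ((ContinuousLinearMap.apply ℝ E ((1 : ℝ), (0 : E))).comp
        ((fderiv ℝ (fderiv ℝ Φ) (t, x)).comp (ContinuousLinearMap.inr ℝ ℝ E))) x :=
    ((ContinuousLinearMap.apply ℝ E ((1 : ℝ), (0 : E))).hasFDerivAt).comp x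
      (hD.comp x (hasFDerivAt_prodMk_right t x))
  have h3 : HasFDerivAt (fun y => fderiv ℝ Φ (t, y) (1, 0))
      ((fderiv ℝ f (φ t x)).comp (fderiv ℝ (φ t) x)) x := by
    refine HasFDerivAt.congr_of_eventuallyEq
      ((hf t ht x hx).hasFDerivAt.comp x (hspace t ht x hx).differentiableAt.hasFDerivAt) ?_
    filter_upwards [hV.mem_nhds hx] with y hy using htime t ht y hy
  have h4 := congrArg (fun L : E →L[ℝ] E => L v) (h2.unique h3)
  simp only [ContinuousLinearMap.comp_apply, ContinuousLinearMap.inr_apply,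
    ContinuousLinearMap.apply_apply] at h4
  rw [hsymm.eq, h4] at h1
  refine h1.congr_of_eventuallyEq ?_
  filter_upwards [hI.mem_nhds ht] with s hs
  rw [(hspace s hs x hx).fderiv]
  rfl

/-- The components of a vector transported by a flow, in a moving frame, satisfy a linear equation
governed by the brackets of the generator with the frame. -/
theorem hasDerivAt_flow_component {ι : Type*} [Fintype ι] [DecidableEq ι]
    {φ : ℝ → E → E} {I : Set ℝ} {V : Set E}
    (hI : IsOpen I) (hV : IsOpen V)
    (hφ : ContDiffOn ℝ ∞ (fun q : ℝ × E => φ q.1 q.2) (I ×ˢ V)) {f : E → E}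
    (hf : ∀ t ∈ I, ∀ x ∈ V, DifferentiableAt ℝ f (φ t x))
    (hd : ∀ t ∈ I, ∀ x ∈ V, HasDerivAt (fun s => φ s x) (f (φ t x)) t)
    {e : ι → E → E} {θ : ι → E → E →L[ℝ] ℝ}
    {t : ℝ} (ht : t ∈ I) {x : E} (hx : x ∈ V)
    (he : ∀ i, DifferentiableAt ℝ (e i) (φ t x)) (hθ : ∀ i, DifferentiableAt ℝ (θ i) (φ t x))
    (hdual : ∀ i j, ∀ᶠ y in 𝓝 (φ t x), θ i y (e j y) = if i = j then 1 else 0)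
    (hspan : ∀ w, w = ∑ k, θ k (φ t x) w • e k (φ t x)) (v : E) (i : ι) :
    HasDerivAt (fun s => θ i (φ s x) (fderiv ℝ (φ s) x v))
      (-∑ k, θ i (φ t x) (VectorField.lieBracket ℝ f (e k) (φ t x)) *
        θ k (φ t x) (fderiv ℝ (φ t) x v)) t := by
  have h1 := (hθ i).hasFDerivAt.comp_hasDerivAt t (hd t ht x hx)
  have h2 := hasDerivAt_fderiv_flow hI hV hφ hf hd ht hx v
  have h3 := h1.clm_apply h2
  refine h3.congr_deriv ?_
  set w := fderiv ℝ (φ t) x v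
  set y := φ t x
  -- The derivative along f of the constant pairing of θ i with e k. It trades the derivative of θ i
  -- for that of e k, which completes the bracket.
  have h4 : ∀ k, fderiv ℝ (θ i) y (f y) (e k y) + θ i y (fderiv ℝ (e k) y (f y)) = 0 := by
    intro k
    have h5 := (hθ i).hasFDerivAt.clm_apply (he k).hasFDerivAt
    have h6 : HasFDerivAt (fun z => θ i z (e k z)) (0 : E →L[ℝ] ℝ) y :=
      (hasFDerivAt_const (if i = k then (1 : ℝ) else 0) y).congr_of_eventuallyEq (hdual i k)
    have h7 := congrArg (fun L : E →L[ℝ] ℝ => L (f y)) (h5.unique h6)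
    simp only [add_apply, ContinuousLinearMap.comp_apply,
      ContinuousLinearMap.flip_apply, zero_apply] at h7
    linarith
  have h8 : ∀ L : E →L[ℝ] ℝ, L w = ∑ k, L (e k y) * θ k y w := by
    intro L
    conv_lhs => rw [hspan w]
    simp [mul_comm]
  have h9 : θ i y (fderiv ℝ f y w) = ∑ k, θ i y (fderiv ℝ f y (e k y)) * θ k y w :=
    h8 ((θ i y).comp (fderiv ℝ f y))
  change fderiv ℝ (θ i) y (f y) w + θ i y (fderiv ℝ f y w) = _
  rw [h8, h9, ← Finset.sum_add_distrib, ← Finset.sum_neg_distrib]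
  refine Finset.sum_congr rfl fun k _ => ?_
  rw [VectorField.lieBracket, map_sub]
  linear_combination (θ k y w) * h4 k

/-- Local solvability of `f · g = a` near a point where the field `f` does not vanish. -/
theorem exists_primitive_along_field [FiniteDimensional ℝ E] {f : E → E} {a : E → ℝ} {Ω : Set E}
    (hΩ : IsOpen Ω) (hf : ContDiffOn ℝ ∞ f Ω) (ha : ContDiffOn ℝ ∞ a Ω) {x₀ : E} (hx₀ : x₀ ∈ Ω)
    (hf0 : f x₀ ≠ 0) :
    ∃ W : Set E, IsOpen W ∧ x₀ ∈ W ∧ ∃ g : E → ℝ, ContDiffOn ℝ ∞ g W ∧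
      ∀ y ∈ W, fderiv ℝ g y (f y) = a y := by
  have : CompleteSpace E := FiniteDimensional.complete ℝ E
  -- Method of characteristics: the extra coordinate accumulates the integral of a along the orbits
  -- of f.
  let A : E × ℝ → E × ℝ := fun q => (f q.1, a q.1)
  have hA : ContDiffOn ℝ ∞ A (Ω ×ˢ univ) :=
    (hf.comp contDiff_fst.contDiffOn fun q hq => hq.1).prodMk
      (ha.comp contDiff_fst.contDiffOn fun q hq => hq.1)
  obtain ⟨ε, hε, V, hV, hxV, φ, hφ, hφ0, -, hφd⟩ :=
    exists_smooth_flow (E := E × ℝ) (hΩ.prod isOpen_univ) hA (x₀ := (x₀, 0)) ⟨hx₀, mem_univ _⟩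
  obtain ⟨ℓ, hℓ⟩ := SeparatingDual.exists_eq_one (R := ℝ) hf0
  set v := f x₀ with hv
  -- z is split into the flow time ℓ z and a starting point on the hyperplane x₀ + ker ℓ, with
  -- accumulated value 0 there. Moving z along v changes only the time.
  let κ : E → ℝ × E × ℝ := fun z => (ℓ z, x₀ + z - ℓ z • v, 0)
  have hκ : ContDiff ℝ ∞ κ :=
    ℓ.contDiff.prodMk (((contDiff_const.add contDiff_id).sub
      (ℓ.contDiff.smul contDiff_const)).prodMk contDiff_const)
  let N : Set E := κ ⁻¹' (Ioo (-ε) ε ×ˢ V)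
  have hN : IsOpen N := (isOpen_Ioo.prod hV).preimage hκ.continuous
  have h0N : (0 : E) ∈ N := by
    refine ⟨?_, ?_⟩
    · simpa [κ] using hε
    · simpa [κ] using hxV
  let Q : E → E × ℝ := fun z => φ (κ z).1 (κ z).2
  have hQ : ContDiffOn ℝ ∞ Q N := hφ.comp hκ.contDiffOn fun z hz => hz
  have hQat : ∀ z ∈ N, ContDiffAt ℝ ∞ Q z := fun z hz => hQ.contDiffAt (hN.mem_nhds hz)
  have hQd : ∀ z ∈ N, HasFDerivAt Q (fderiv ℝ Q z) z := fun z hz =>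
    ((hQat z hz).differentiableAt (by simp)).hasFDerivAt
  have hQv : ∀ z ∈ N, fderiv ℝ Q z v = A (Q z) := by
    intro z hz
    have hl : HasDerivAt (fun s : ℝ => z + s • v) v 0 := by
      simpa using ((hasDerivAt_id (0 : ℝ)).smul_const v).const_add z
    have h1 : HasDerivAt (fun s : ℝ => Q (z + s • v)) (fderiv ℝ Q z v) 0 := by
      have h0 : HasFDerivAt Q (fderiv ℝ Q z) (z + (0 : ℝ) • v) := by simpa using hQd z hz
      exact h0.comp_hasDerivAt (0 : ℝ) hl
    have h2 : HasDerivAt (fun s : ℝ => φ (ℓ z + s) (κ z).2) (A (Q z)) 0 := by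
      have h3 : HasDerivAt (fun s : ℝ => φ s (κ z).2) (A (Q z)) (ℓ z + 0) := by
        rw [add_zero]
        exact hφd _ hz.1 _ hz.2
      exact h3.comp_const_add (ℓ z) 0
    refine h1.unique (h2.congr_of_eventuallyEq (Eventually.of_forall fun s => ?_))
    have : κ (z + s • v) = (ℓ z + s, (κ z).2) := by
      simp only [κ, map_add, map_smul, hℓ, smul_eq_mul, mul_one, add_smul]
      congr 2
      abel
    simp only [Q, this]
  have hQ0 : Q 0 = (x₀, 0) := by
    simp only [Q, κ, map_zero, zero_smul, add_zero, sub_zero]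
    exact hφ0 _ hxV
  let Ψ : E → E := fun z => (Q z).1
  let σ : E → ℝ := fun z => (Q z).2
  have hΨ : ∀ z ∈ N, ContDiffAt ℝ ∞ Ψ z := fun z hz => contDiffAt_fst.comp z (hQat z hz)
  have hσ : ∀ z ∈ N, ContDiffAt ℝ ∞ σ z := fun z hz => contDiffAt_snd.comp z (hQat z hz)
  have hΨd : ∀ z ∈ N, HasFDerivAt Ψ ((ContinuousLinearMap.fst ℝ E ℝ).comp (fderiv ℝ Q z)) z :=
    fun z hz => (hQd z hz).fst
  have hσd : ∀ z ∈ N, HasFDerivAt σ ((ContinuousLinearMap.snd ℝ E ℝ).comp (fderiv ℝ Q z)) z :=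
    fun z hz => (hQd z hz).snd
  -- On ker ℓ the flow time is 0 and Ψ is translation by x₀; along v the derivative is f x₀ = v.
  -- Together these give the identity.
  have hΨ0 : HasFDerivAt Ψ ((ContinuousLinearEquiv.refl ℝ E : E ≃L[ℝ] E) : E →L[ℝ] E) 0 := by
    refine (hΨd 0 h0N).congr_fderiv ?_
    ext w
    have hker : ∀ u : E, ℓ u = 0 → (fderiv ℝ Q 0 u).1 = u := by
      intro u hu
      have hl : HasDerivAt (fun s : ℝ => s • u) u 0 := by
        simpa using (hasDerivAt_id (0 : ℝ)).smul_const u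
      have h1 : HasDerivAt (fun s : ℝ => Ψ (s • u)) (fderiv ℝ Q 0 u).1 0 := by
        have h2 := hΨd 0 h0N
        exact HasFDerivAt.comp_hasDerivAt (0 : ℝ) (by simpa using h2) hl
      refine h1.unique ((hl.const_add x₀).congr_of_eventuallyEq ?_)
      have hc : ContinuousAt (fun s : ℝ => κ (s • u)) 0 := by
        exact (hκ.continuous.comp (continuous_id.smul continuous_const)).continuousAt
      have hmem : ∀ᶠ s in 𝓝 (0 : ℝ), κ (s • u) ∈ Ioo (-ε) ε ×ˢ V :=
        hc.eventually ((isOpen_Ioo.prod hV).mem_nhds (by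
          change (0 : ℝ) • u ∈ N
          rwa [zero_smul]))
      filter_upwards [hmem] with s hs
      have hκs : κ (s • u) = (0, x₀ + s • u, 0) := by simp [κ, hu]
      have h3 := hs.2
      rw [hκs] at h3
      simp only [Ψ, Q, hκs]
      rw [hφ0 _ h3]
    have h5 := hker (w - ℓ w • v) (by simp [hℓ])
    have h6 := hQv 0 h0N
    rw [hQ0] at h6
    rw [map_sub, map_smul, h6] at h5
    simpa [A, ← hv] using h5
  obtain ⟨P, h0P, hP, hPs⟩ := exists_smooth_localInverse
    (eventually_of_mem (hN.mem_nhds h0N) hΨ) hΨ0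
  have hΨ0' : Ψ 0 = x₀ := congrArg Prod.fst hQ0
  refine ⟨P.target ∩ P.symm ⁻¹' N, P.isOpen_inter_preimage_symm hN, ⟨?_, ?_⟩, σ ∘ P.symm, ?_, ?_⟩
  · have := P.map_source h0P
    rwa [hP, hΨ0'] at this
  · have := P.left_inv h0P
    rw [hP, hΨ0'] at this
    rw [mem_preimage, this]
    exact h0N
  · intro y hy
    exact (hσ _ hy.2).comp_contDiffWithinAt y ((hPs y hy.1).mono inter_subset_left)
  · rintro y ⟨hyt, hyN⟩
    set z := P.symm y with hz
    have hyz : y = Ψ z := by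
      have := P.right_inv hyt
      rw [hP] at this
      exact this.symm
    have hzs : z ∈ P.source := P.map_target hyt
    have hgd : DifferentiableAt ℝ (σ ∘ P.symm) y :=
      ((hσ _ hyN).differentiableAt (by simp)).comp y
        (((hPs y hyt).contDiffAt (P.open_target.mem_nhds hyt)).differentiableAt (by simp))
    -- With g = σ ∘ Ψ⁻¹, the two expressions for the derivative of g ∘ Ψ = σ are compared on v,
    -- where DQ v = (f, a) at the image point.
    have h1 : HasFDerivAt (fun w => (σ ∘ P.symm) (Ψ w))
        ((fderiv ℝ (σ ∘ P.symm) y).comp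
          ((ContinuousLinearMap.fst ℝ E ℝ).comp (fderiv ℝ Q z))) z := by
      refine HasFDerivAt.comp (g := σ ∘ P.symm) z ?_ (hΨd z hyN)
      rw [← hyz]
      exact hgd.hasFDerivAt
    have h2 : HasFDerivAt (fun w => (σ ∘ P.symm) (Ψ w))
        ((ContinuousLinearMap.snd ℝ E ℝ).comp (fderiv ℝ Q z)) z := by
      refine (hσd z hyN).congr_of_eventuallyEq ?_
      filter_upwards [P.open_source.mem_nhds hzs] with w hw
      have := P.left_inv hw
      rw [hP] at this
      simp [this]
    have h3 := congrArg (fun L : E →L[ℝ] ℝ => L v) (h1.unique h2)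
    simp only [ContinuousLinearMap.comp_apply, hQv z hyN] at h3
    change fderiv ℝ (σ ∘ P.symm) y (f (Ψ z)) = a (Ψ z) at h3
    rw [← hyz] at h3
    exact h3

end FlowCalculus
/-! ### The Lie algebra of `GN` -/

section LieAlgebra

open Set Filter Topology

variable {m : ℕ}

theorem eta_add_left (x y z : Fin (m + 2) → ℝ) : eta (x + y) z = eta x z + eta y z := by
  simp only [eta, Pi.add_apply, add_mul, Finset.sum_add_distrib]
  ring

theorem eta_add_right (x y z : Fin (m + 2) → ℝ) : eta x (y + z) = eta x y + eta x z := by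
  rw [eta_comm, eta_add_left, eta_comm y, eta_comm z]

theorem eta_smul_right (c : ℝ) (x y : Fin (m + 2) → ℝ) : eta x (c • y) = c * eta x y := by
  rw [eta_comm, eta_smul_left, eta_comm]

theorem eta_zero_left (x : Fin (m + 2) → ℝ) : eta 0 x = 0 := by
  simp [eta]

theorem eta_kVec (w : Fin (m + 2) → ℝ) : eta (kVec m) w = w 1 := by
  simp [eta, kVec, Fin.ext_iff]

theorem eta_single_succ_succ (w : Fin (m + 2) → ℝ) (i : Fin m) :
    eta w (Pi.single i.succ.succ 1) = w i.succ.succ := by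
  have h1 : (1 : Fin (m + 2)) ≠ i.succ.succ := by simp [Fin.ext_iff]
  have h0 : (0 : Fin (m + 2)) ≠ i.succ.succ := by simp [Fin.ext_iff]
  simp [eta, Pi.single_apply, h1, h0]

theorem kVec_zero : kVec m 0 = 1 := by simp [kVec]

theorem kVec_of_ne {i : Fin (m + 2)} (hi : i ≠ 0) : kVec m i = 0 := by simp [kVec, hi]

theorem mulVec_kVec (A : Matrix (Fin (m + 2)) (Fin (m + 2)) ℝ) (i : Fin (m + 2)) :
    (A *ᵥ kVec m) i = A i 0 := by
  simp [kVec]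

theorem mem_span_kVec {v : Fin (m + 2) → ℝ} :
    v ∈ Submodule.span ℝ {kVec m} ↔ ∀ i, i ≠ 0 → v i = 0 := by
  rw [Submodule.mem_span_singleton]
  constructor
  · rintro ⟨c, rfl⟩ i hi
    simp [kVec_of_ne hi]
  · intro h
    refine ⟨v 0, ?_⟩
    ext i
    by_cases hi : i = 0
    · subst hi
      simp [kVec_zero]
    · simp [kVec_of_ne hi, h i hi]

theorem hasDerivAt_eta {x y : ℝ → Fin (m + 2) → ℝ} {x' y' : Fin (m + 2) → ℝ} {t : ℝ}
    (hx : HasDerivAt x x' t) (hy : HasDerivAt y y' t) :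
    HasDerivAt (fun s => eta (x s) (y s)) (eta x' (y t) + eta (x t) y') t := by
  rw [hasDerivAt_pi] at hx hy
  have h := (((hx 0).mul (hy 1)).add ((hx 1).mul (hy 0))).add
    (HasDerivAt.fun_sum (u := Finset.univ) fun (i : Fin m) _ =>
      (hx i.succ.succ).mul (hy i.succ.succ))
  refine h.congr_deriv ?_
  simp only [eta, Finset.sum_add_distrib]
  ring

theorem hasDerivAt_mulVec {n : ℕ} {C : ℝ → Matrix (Fin n) (Fin n) ℝ}
    {C' : Matrix (Fin n) (Fin n) ℝ} {t : ℝ}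
    (hC : ∀ i j, HasDerivAt (fun s => C s i j) (C' i j) t) (w : Fin n → ℝ) :
    HasDerivAt (fun s => C s *ᵥ w) (C' *ᵥ w) t := by
  rw [hasDerivAt_pi]
  intro i
  change HasDerivAt (fun x => ∑ j, C x i j * w j) (∑ j, C' i j * w j) t
  exact HasDerivAt.fun_sum fun j _ => (hC i j).mul_const (w j)

/-- A kernel vector is orthogonal to k, hence to all of k^⊥ by the isometry condition, so it is a
multiple of k. On ℝ k the matrix acts by a nonzero scalar. Invertibility is thus a consequence of
the three conditions. -/
theorem IsGN.mulVec_injective {A : Matrix (Fin (m + 2)) (Fin (m + 2)) ℝ} (hA : IsGN A) :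
    Function.Injective A.mulVec := by
  have h0 : ∀ z, A *ᵥ z = 0 → z = 0 := by
    intro z hz
    obtain ⟨c, hc0, hc⟩ := hA.exists_map_k
    have h1 : eta (kVec m) z = 0 := by
      rw [← hA.eta_k z, hz, eta_comm, eta_zero_left]
    have h2 : ∀ w, eta (kVec m) w = 0 → eta z w = 0 := by
      intro w hw
      rw [← hA.eta_perp z w h1 hw, hz, eta_zero_left]
    have h3 : z ∈ Submodule.span ℝ {kVec m} := by
      rw [mem_span_kVec]
      intro i
      refine Fin.cases (fun h => absurd rfl h) (fun i => ?_) i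
      refine Fin.cases (fun _ => ?_) (fun i _ => ?_) i
      · rw [eta_kVec] at h1
        exact h1
      · have h4 := h2 (Pi.single i.succ.succ 1) (by
          rw [eta_kVec, Pi.single_eq_of_ne]
          simp [Fin.ext_iff])
        rwa [eta_single_succ_succ] at h4
    obtain ⟨d, rfl⟩ := Submodule.mem_span_singleton.1 h3
    rw [Matrix.mulVec_smul, hc, smul_smul] at hz
    have h5 := congrFun hz 0
    simp only [Pi.smul_apply, kVec_zero, smul_eq_mul, mul_one, Pi.zero_apply] at h5
    rcases mul_eq_zero.1 h5 with h | h
    · rw [h, zero_smul]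
    · exact absurd h hc0
  intro x y hxy
  have h := h0 (x - y) (by rw [Matrix.mulVec_sub, sub_eq_zero]; exact hxy)
  exact sub_eq_zero.1 h

theorem IsGN.exists_mem_GN {A : Matrix (Fin (m + 2)) (Fin (m + 2)) ℝ} (hA : IsGN A) :
    ∃ g ∈ GN m, (g : Matrix (Fin (m + 2)) (Fin (m + 2)) ℝ) = A := by
  obtain ⟨g, hg⟩ := Matrix.mulVec_injective_iff_isUnit.1 hA.mulVec_injective
  refine ⟨g, ?_, hg⟩
  change IsGN (g : Matrix (Fin (m + 2)) (Fin (m + 2)) ℝ)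
  rwa [hg]

/-- The linearisation of the conditions defining `GN`. -/
structure IsInfGN (A : Matrix (Fin (m + 2)) (Fin (m + 2)) ℝ) : Prop where
  map_k : A *ᵥ kVec m ∈ Submodule.span ℝ {kVec m}
  eta_perp : ∀ w w' : Fin (m + 2) → ℝ, eta (kVec m) w = 0 → eta (kVec m) w' = 0 →
    eta (A *ᵥ w) w' + eta w (A *ᵥ w') = 0
  eta_k : ∀ z : Fin (m + 2) → ℝ, eta (A *ᵥ kVec m) z + eta (kVec m) (A *ᵥ z) = 0

theorem IsInfGN.perp {A : Matrix (Fin (m + 2)) (Fin (m + 2)) ℝ} (hA : IsInfGN A)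
    {w : Fin (m + 2) → ℝ} (hw : eta (kVec m) w = 0) : eta (kVec m) (A *ᵥ w) = 0 := by
  obtain ⟨μ, hμ⟩ := Submodule.mem_span_singleton.1 hA.map_k
  have h := hA.eta_k w
  rwa [← hμ, eta_smul_left, hw, mul_zero, zero_add] at h

theorem IsInfGN.add {A B : Matrix (Fin (m + 2)) (Fin (m + 2)) ℝ} (hA : IsInfGN A)
    (hB : IsInfGN B) : IsInfGN (A + B) where
  map_k := by
    rw [Matrix.add_mulVec]
    exact Submodule.add_mem _ hA.map_k hB.map_k
  eta_perp w w' hw hw' := by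
    rw [Matrix.add_mulVec, Matrix.add_mulVec, eta_add_left, eta_add_right]
    linear_combination hA.eta_perp w w' hw hw' + hB.eta_perp w w' hw hw'
  eta_k z := by
    rw [Matrix.add_mulVec, Matrix.add_mulVec, eta_add_left, eta_add_right]
    linear_combination hA.eta_k z + hB.eta_k z

theorem IsInfGN.zero : IsInfGN (0 : Matrix (Fin (m + 2)) (Fin (m + 2)) ℝ) where
  map_k := by
    rw [Matrix.zero_mulVec]
    exact Submodule.zero_mem _
  eta_perp w w' _ _ := by
    rw [Matrix.zero_mulVec, Matrix.zero_mulVec, eta_zero_left, eta_comm, eta_zero_left, add_zero]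
  eta_k z := by
    rw [Matrix.zero_mulVec, Matrix.zero_mulVec, eta_zero_left, eta_comm, eta_zero_left, add_zero]

theorem IsInfGN.smul {A : Matrix (Fin (m + 2)) (Fin (m + 2)) ℝ} (hA : IsInfGN A) (c : ℝ) :
    IsInfGN (c • A) where
  map_k := by
    rw [Matrix.smul_mulVec]
    exact Submodule.smul_mem _ _ hA.map_k
  eta_perp w w' hw hw' := by
    rw [Matrix.smul_mulVec, Matrix.smul_mulVec, eta_smul_left, eta_smul_right]
    linear_combination c * hA.eta_perp w w' hw hw'
  eta_k z := by
    rw [Matrix.smul_mulVec, Matrix.smul_mulVec, eta_smul_left, eta_smul_right]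
    linear_combination c * hA.eta_k z

theorem IsInfGN.neg {A : Matrix (Fin (m + 2)) (Fin (m + 2)) ℝ} (hA : IsInfGN A) :
    IsInfGN (-A) := by
  simpa using hA.smul (-1)

theorem IsInfGN.sum {ι : Type*} (s : Finset ι) {A : ι → Matrix (Fin (m + 2)) (Fin (m + 2)) ℝ}
    (hA : ∀ i, IsInfGN (A i)) : IsInfGN (∑ i ∈ s, A i) :=
  Finset.sum_induction _ IsInfGN (fun _ _ h h' => h.add h') IsInfGN.zero fun i _ => hA i

/-- The entries in row 0 off the diagonal and in column 1 from row 2 on do not occur. This freedom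
is what makes the torsion equations solvable. -/
theorem isInfGN_iff {A : Matrix (Fin (m + 2)) (Fin (m + 2)) ℝ} :
    IsInfGN A ↔ (∀ i, i ≠ 0 → A i 0 = 0) ∧ (∀ j : Fin m, A 1 j.succ.succ = 0) ∧
      A 0 0 + A 1 1 = 0 ∧ ∀ i j : Fin m, A i.succ.succ j.succ.succ + A j.succ.succ i.succ.succ = 0 := by
  have hsingle : ∀ j i : Fin (m + 2), (A *ᵥ (Pi.single j 1 : Fin (m + 2) → ℝ)) i = A i j := by
    intro j i
    simp
  have hperp : ∀ j : Fin m, eta (kVec m) (Pi.single j.succ.succ 1) = 0 := by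
    intro j
    rw [eta_kVec, Pi.single_eq_of_ne]
    simp [Fin.ext_iff]
  constructor
  · intro hA
    have h1 : ∀ i, i ≠ 0 → A i 0 = 0 := by
      intro i hi
      rw [← mulVec_kVec A i]
      exact mem_span_kVec.1 hA.map_k i hi
    refine ⟨h1, fun j => ?_, ?_, fun i j => ?_⟩
    · have h := hA.perp (hperp j)
      rwa [eta_kVec, hsingle] at h
    · have h := hA.eta_k (Pi.single 1 1)
      rw [eta_kVec, hsingle] at h
      simpa [eta, Pi.single_apply, Fin.ext_iff, mulVec_kVec] using h
    · have h := hA.eta_perp _ _ (hperp i) (hperp j)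
      rw [eta_single_succ_succ, eta_comm, eta_single_succ_succ, hsingle, hsingle] at h
      linarith
  · rintro ⟨h1, h2, h3, h4⟩
    have hrow : ∀ (w : Fin (m + 2) → ℝ) (i : Fin m), (A *ᵥ w) i.succ.succ =
        A i.succ.succ 1 * w 1 + ∑ j : Fin m, A i.succ.succ j.succ.succ * w j.succ.succ := by
      intro w i
      simp only [Matrix.mulVec, dotProduct, Fin.sum_univ_succ]
      rw [h1 _ (by simp [Fin.ext_iff])]
      simp
    have hrow1 : ∀ w : Fin (m + 2) → ℝ, (A *ᵥ w) 1 = A 1 1 * w 1 := by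
      intro w
      simp only [Matrix.mulVec, dotProduct, Fin.sum_univ_succ, h2]
      rw [h1 _ (by simp)]
      simp
    refine ⟨?_, ?_, ?_⟩
    · rw [mem_span_kVec]
      intro i hi
      rw [mulVec_kVec]
      exact h1 i hi
    · intro w w' hw hw'
      rw [eta_kVec] at hw hw'
      simp only [eta, hrow, hrow1, hw, hw', mul_zero, zero_add, zero_mul, add_zero,
        Finset.sum_mul, Finset.mul_sum]
      rw [Finset.sum_comm, ← Finset.sum_add_distrib]
      refine Finset.sum_eq_zero fun i _ => ?_
      rw [← Finset.sum_add_distrib]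
      refine Finset.sum_eq_zero fun j _ => ?_
      linear_combination (w i.succ.succ * w' j.succ.succ) * h4 i j
    · intro z
      rw [eta_kVec, hrow1]
      have h5 : A *ᵥ kVec m = A 0 0 • kVec m := by
        ext i
        rw [mulVec_kVec]
        by_cases hi : i = 0
        · subst hi
          simp [kVec_zero]
        · simp [h1 i hi, kVec_of_ne hi]
      rw [h5, eta_smul_left, eta_kVec]
      linear_combination z 1 * h3

/-- Invariance of the Lie algebra under the adjoint action of `GN`. With the relation written as a B
= Ω a, each condition on B follows by applying a and using the condition on Ω. -/
theorem IsInfGN.conj {a B Ω : Matrix (Fin (m + 2)) (Fin (m + 2)) ℝ} (ha : IsGN a)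
    (hΩ : IsInfGN Ω) (h : a * B = Ω * a) : IsInfGN B := by
  obtain ⟨c, hc0, hc⟩ := ha.exists_map_k
  obtain ⟨μ, hμ⟩ := Submodule.mem_span_singleton.1 hΩ.map_k
  have hv : ∀ w, a *ᵥ (B *ᵥ w) = Ω *ᵥ (a *ᵥ w) := by
    intro w
    rw [Matrix.mulVec_mulVec, h, Matrix.mulVec_mulVec]
  have hBk : B *ᵥ kVec m = μ • kVec m := by
    apply ha.mulVec_injective
    rw [hv, hc, Matrix.mulVec_smul, Matrix.mulVec_smul, ← hμ, hc, smul_comm]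
  have hk : ∀ z, eta (B *ᵥ kVec m) z + eta (kVec m) (B *ᵥ z) = 0 := by
    intro z
    have h1 := hΩ.eta_k (a *ᵥ z)
    have h2 := ha.eta_k z
    have h3 := ha.eta_k (B *ᵥ z)
    rw [hv, hc, eta_smul_left] at h3
    rw [hc, eta_smul_left] at h2
    rw [← hμ, eta_smul_left] at h1
    rw [hBk, eta_smul_left, ← h3, ← h2]
    linear_combination c * h1
  have hp : ∀ w, eta (kVec m) w = 0 → eta (kVec m) (B *ᵥ w) = 0 := by
    intro w hw
    have h1 := hk w
    rwa [hBk, eta_smul_left, hw, mul_zero, zero_add] at h1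
  refine ⟨?_, fun w w' hw hw' => ?_, hk⟩
  · rw [hBk]
    exact Submodule.smul_mem _ _ (Submodule.mem_span_singleton_self _)
  · rw [← ha.eta_perp _ _ (hp w hw) hw', ← ha.eta_perp _ _ hw (hp w' hw'), hv, hv]
    exact hΩ.eta_perp _ _ ((ha.perp_iff w).2 hw) ((ha.perp_iff w').2 hw')

theorem IsGN.mul {A B : Matrix (Fin (m + 2)) (Fin (m + 2)) ℝ} (hA : IsGN A) (hB : IsGN B) :
    IsGN (A * B) := by
  obtain ⟨a, ha, rfl⟩ := hA.exists_mem_GN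
  obtain ⟨b, hb, rfl⟩ := hB.exists_mem_GN
  exact (GN m).mul_mem ha hb

/-- The logarithmic derivative of a curve in `GN` is infinitesimally in `GN`. -/
theorem isInfGN_of_hasDerivAt {C : ℝ → Matrix (Fin (m + 2)) (Fin (m + 2)) ℝ}
    {C' B : Matrix (Fin (m + 2)) (Fin (m + 2)) ℝ} {t : ℝ} (hC : ∀ᶠ s in 𝓝 t, IsGN (C s))
    (hd : ∀ i j, HasDerivAt (fun s => C s i j) (C' i j) t) (hB : C t * B = C') : IsInfGN B := by
  have hCt : IsGN (C t) := hC.self_of_nhds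
  obtain ⟨c, hc0, hc⟩ := hCt.exists_map_k
  have hv : ∀ w, C' *ᵥ w = C t *ᵥ (B *ᵥ w) := by
    intro w
    rw [Matrix.mulVec_mulVec, hB]
  -- A constant value of η along the curve has zero derivative. Since C' = C B, the factor C t
  -- appears on both arguments and is removed later by the `GN` conditions on C t itself.
  have hconst : ∀ x y : Fin (m + 2) → ℝ, (∀ᶠ s in 𝓝 t, eta (C s *ᵥ x) (C s *ᵥ y) = eta x y) →
      eta (C t *ᵥ (B *ᵥ x)) (C t *ᵥ y) + eta (C t *ᵥ x) (C t *ᵥ (B *ᵥ y)) = 0 := by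
    intro x y hxy
    have h1 := hasDerivAt_eta (hasDerivAt_mulVec hd x) (hasDerivAt_mulVec hd y)
    rw [hv, hv] at h1
    exact h1.unique ((hasDerivAt_const t (eta x y)).congr_of_eventuallyEq hxy)
  have hBk : ∃ μ : ℝ, μ • kVec m = B *ᵥ kVec m := by
    have h1 : C' *ᵥ kVec m ∈ Submodule.span ℝ {kVec m} := by
      rw [mem_span_kVec]
      intro i hi
      rw [mulVec_kVec]
      refine (hd i 0).unique ((hasDerivAt_const t (0 : ℝ)).congr_of_eventuallyEq ?_)
      filter_upwards [hC] with s hs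
      rw [← mulVec_kVec (C s) i]
      exact mem_span_kVec.1 hs.map_k i hi
    obtain ⟨ν, hν⟩ := Submodule.mem_span_singleton.1 h1
    refine ⟨ν / c, hCt.mulVec_injective ?_⟩
    rw [← hv, ← hν, Matrix.mulVec_smul, hc, smul_smul, div_mul_cancel₀ _ hc0]
  obtain ⟨μ, hμ⟩ := hBk
  have hk : ∀ z, eta (B *ᵥ kVec m) z + eta (kVec m) (B *ᵥ z) = 0 := by
    intro z
    have h1 := hconst (kVec m) z (hC.mono fun s hs => hs.eta_k z)
    rwa [← hμ, Matrix.mulVec_smul, eta_smul_left, hCt.eta_k, hCt.eta_k, ← eta_smul_left, hμ] at h1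
  have hp : ∀ w, eta (kVec m) w = 0 → eta (kVec m) (B *ᵥ w) = 0 := by
    intro w hw
    have h1 := hk w
    rwa [← hμ, eta_smul_left, hw, mul_zero, zero_add] at h1
  refine ⟨Submodule.mem_span_singleton.2 ⟨μ, hμ⟩, fun w w' hw hw' => ?_, hk⟩
  rw [← hCt.eta_perp _ _ (hp w hw) hw', ← hCt.eta_perp _ _ hw (hp w' hw')]
  exact hconst w w' (hC.mono fun s hs => hs.eta_perp w w' hw hw')

/-- A homogeneous linear equation with zero initial value has only the zero solution. -/
theorem eq_zero_of_hasDerivAt_mulVec {n : ℕ} {a b : ℝ} (ha : a < 0) (hb : 0 < b)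
    {D : ℝ → Matrix (Fin n) (Fin n) ℝ} (hD : ∀ i j, ContinuousOn (fun t => D t i j) (Ioo a b))
    {y : ℝ → Fin n → ℝ} (hy : ∀ t ∈ Ioo a b, HasDerivAt y (D t *ᵥ y t) t) (hy0 : y 0 = 0) :
    ∀ t ∈ Ioo a b, y t = 0 := by
  intro t ht
  -- The coefficients may be unbounded near the ends of the interval, so a uniform Lipschitz
  -- constant is found on a compact subinterval containing 0 and t.
  obtain ⟨a', ha', hat⟩ := exists_between (lt_min ha ht.1)
  obtain ⟨b', hbt, hb'⟩ := exists_between (max_lt hb ht.2)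
  have hsub : Icc a' b' ⊆ Ioo a b := fun s hs => ⟨ha'.trans_le hs.1, hs.2.trans_lt hb'⟩
  let L : ℝ → (Fin n → ℝ) →L[ℝ] (Fin n → ℝ) := fun t =>
    LinearMap.toContinuousLinearMap (Matrix.toLin' (D t))
  have hL : ContinuousOn L (Icc a' b') := by
    refine ContinuousOn.mono ?_ hsub
    have h1 : ContinuousOn D (Ioo a b) := continuousOn_pi.2 fun i => continuousOn_pi.2 (hD i)
    let T : Matrix (Fin n) (Fin n) ℝ →ₗ[ℝ] (Fin n → ℝ) →L[ℝ] (Fin n → ℝ) :=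
      LinearMap.toContinuousLinearMap.toLinearMap ∘ₗ (Matrix.toLin' (R := ℝ)).toLinearMap
    exact (LinearMap.continuous_of_finiteDimensional T).comp_continuousOn h1
  obtain ⟨K, hK⟩ := isCompact_Icc.exists_bound_of_continuousOn hL
  have hLip : ∀ s ∈ Ioo a' b', LipschitzOnWith K.toNNReal (fun x => D s *ᵥ x) univ := by
    intro s hs
    refine ((L s).lipschitz.weaken ?_).lipschitzOnWith
    rw [← NNReal.coe_le_coe, coe_nnnorm]
    exact (hK s (Ioo_subset_Icc_self hs)).trans (Real.le_coe_toNNReal K)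
  have h0 : (0 : ℝ) ∈ Ioo a' b' :=
    ⟨hat.trans_le (min_le_left _ _), (le_max_left _ _).trans_lt hbt⟩
  have hts : t ∈ Ioo a' b' :=
    ⟨hat.trans_le (min_le_right _ _), (le_max_right _ _).trans_lt hbt⟩
  refine ODE_solution_unique_of_mem_Ioo (v := fun s x => D s *ᵥ x) (s := fun _ => univ)
    (g := fun _ => 0) hLip h0
    (fun s hs => ⟨hy s (hsub (Ioo_subset_Icc_self hs)), mem_univ _⟩)
    (fun s hs => ⟨?_, mem_univ _⟩) hy0 hts
  simpa using hasDerivAt_const s (0 : Fin n → ℝ)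

/-- A solution of a linear equation with coefficients infinitesimally in `GN` stays in `GN`. -/
theorem isGN_of_hasDerivAt {a b : ℝ} (ha : a < 0) (hb : 0 < b)
    {C D : ℝ → Matrix (Fin (m + 2)) (Fin (m + 2)) ℝ}
    (hD : ∀ i j, ContinuousOn (fun t => D t i j) (Ioo a b)) (hDgn : ∀ t ∈ Ioo a b, IsInfGN (D t))
    (hC : ∀ t ∈ Ioo a b, ∀ i j, HasDerivAt (fun s => C s i j) ((D t * C t) i j) t)
    (hC0 : C 0 = 1) : ∀ t ∈ Ioo a b, IsGN (C t) := by
  have h0 : (0 : ℝ) ∈ Ioo a b := ⟨ha, hb⟩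
  have hd : ∀ (w : Fin (m + 2) → ℝ), ∀ t ∈ Ioo a b,
      HasDerivAt (fun s => C s *ᵥ w) (D t *ᵥ (C t *ᵥ w)) t := by
    intro w t ht
    rw [Matrix.mulVec_mulVec]
    exact hasDerivAt_mulVec (hC t ht) w
  have hk : ∀ t ∈ Ioo a b, C t *ᵥ kVec m ∈ Submodule.span ℝ {kVec m} := by
    -- Column 0 of D vanishes off the diagonal, so the components of C k other than the 0-th satisfy
    -- a closed homogeneous linear system with zero initial value. Component 0 is masked out to keep
    -- the index type.
    have h1 := eq_zero_of_hasDerivAt_mulVec ha hb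
      (D := fun t => Matrix.of fun i j => if i = 0 then 0 else D t i j)
      (y := fun t i => if i = 0 then 0 else (C t *ᵥ kVec m) i) ?_ ?_ ?_
    · intro t ht
      rw [mem_span_kVec]
      intro i hi
      have := congrFun (h1 t ht) i
      simpa [hi] using this
    · intro i j
      by_cases hi : i = 0
      · simp [hi, continuousOn_const]
      · simpa [hi] using hD i j
    · intro t ht
      rw [hasDerivAt_pi]
      intro i
      by_cases hi : i = 0
      · simpa [hi, Matrix.mulVec, dotProduct] using hasDerivAt_const t (0 : ℝ)
      · simp only [hi, if_false]
        refine (hasDerivAt_pi.1 (hd (kVec m) t ht) i).congr_deriv ?_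
        simp only [Matrix.mulVec, dotProduct, Matrix.of_apply, hi, if_false]
        refine Finset.sum_congr rfl fun j _ => ?_
        by_cases hj : j = 0
        · rw [hj, (isInfGN_iff.1 (hDgn t ht)).1 i hi]
          simp
        · simp [hj]
    · ext i
      by_cases hi : i = 0
      · simp [hi]
      · simp [hi, hC0, kVec_of_ne hi]
  have hconst : ∀ x y : Fin (m + 2) → ℝ, (∀ t ∈ Ioo a b,
      eta (D t *ᵥ (C t *ᵥ x)) (C t *ᵥ y) + eta (C t *ᵥ x) (D t *ᵥ (C t *ᵥ y)) = 0) →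
      ∀ t ∈ Ioo a b, eta (C t *ᵥ x) (C t *ᵥ y) = eta x y := by
    intro x y hxy t ht
    have h1 : ∀ s ∈ Ioo a b, HasDerivAt (fun s => eta (C s *ᵥ x) (C s *ᵥ y)) 0 s := by
      intro s hs
      have h := hasDerivAt_eta (hd x s hs) (hd y s hs)
      rwa [hxy s hs] at h
    have h2 := isOpen_Ioo.is_const_of_deriv_eq_zero isPreconnected_Ioo
      (fun s hs => (h1 s hs).differentiableAt.differentiableWithinAt)
      (fun s hs => (h1 s hs).deriv) ht h0
    simpa [hC0] using h2
  -- Because C k stays a multiple of k, the infinitesimal condition at k makes this pairing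
  -- constant. It then forces that multiple to be nonzero, so C also preserves k^⊥.
  have hetak : ∀ z, ∀ t ∈ Ioo a b, eta (C t *ᵥ kVec m) (C t *ᵥ z) = eta (kVec m) z := by
    intro z
    refine hconst _ _ fun t ht => ?_
    obtain ⟨c, hc⟩ := Submodule.mem_span_singleton.1 (hk t ht)
    rw [← hc, Matrix.mulVec_smul, eta_smul_left, eta_smul_left, ← mul_add, (hDgn t ht).eta_k,
      mul_zero]
  have hperp : ∀ w, eta (kVec m) w = 0 → ∀ t ∈ Ioo a b, eta (kVec m) (C t *ᵥ w) = 0 := by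
    intro w hw t ht
    obtain ⟨c, hc⟩ := Submodule.mem_span_singleton.1 (hk t ht)
    have hc0 : c ≠ 0 := by
      rintro rfl
      have h := hetak (Pi.single 1 1) t ht
      rw [← hc, zero_smul, eta_zero_left, eta_kVec_single] at h
      exact zero_ne_one h
    have h := hetak w t ht
    rw [← hc, eta_smul_left, hw] at h
    exact (mul_eq_zero.1 h).resolve_left hc0
  intro t ht
  refine ⟨hk t ht, fun w w' hw hw' => ?_, fun z => hetak z t ht⟩
  exact hconst w w' (fun s hs => (hDgn s hs).eta_perp _ _ (hperp w hw s hs) (hperp w' hw' s hs)) t ht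

open scoped Matrix.Norms.Operator in
theorem hasDerivAt_exp_smul_apply {n : ℕ} (A : Matrix (Fin n) (Fin n) ℝ) (t : ℝ) (i j : Fin n) :
    HasDerivAt (fun s : ℝ => NormedSpace.exp (s • A) i j)
      ((A * NormedSpace.exp (t • A)) i j) t := by
  have h := hasDerivAt_exp_smul_const' (𝕂 := ℝ) A t
  exact (LinearMap.toContinuousLinearMap (Matrix.entryLinearMap ℝ ℝ i j)).hasFDerivAt.comp_hasDerivAt
    t h

/-- Differentiating exp (s A) at 0 gives one direction. For the other, exp (s A) solves C' = A C
with C(0) = 1, so it stays in `GN`. -/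
theorem mem_matrixLieAlgebra_GN {A : Matrix (Fin (m + 2)) (Fin (m + 2)) ℝ} :
    A ∈ matrixLieAlgebra (GN m) ↔ IsInfGN A := by
  constructor
  · intro hA
    refine isInfGN_of_hasDerivAt (t := 0) (C := fun s : ℝ => NormedSpace.exp (s • A)) (C' := A)
      (Eventually.of_forall fun s => ?_) (fun i j => ?_) ?_
    · obtain ⟨g, hg, hgA⟩ := hA s
      rw [← hgA]
      exact hg
    · simpa using hasDerivAt_exp_smul_apply A 0 i j
    · simp
  · intro hA t
    refine IsGN.exists_mem_GN ?_
    refine isGN_of_hasDerivAt (a := -(|t| + 1)) (b := |t| + 1)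
      (C := fun s : ℝ => NormedSpace.exp (s • A)) (D := fun _ => A)
      (by linarith [abs_nonneg t]) (by positivity) (fun i j => continuousOn_const)
      (fun _ _ => hA) (fun s _ i j => hasDerivAt_exp_smul_apply A s i j) (by simp) t ?_
    rw [mem_Ioo, ← abs_lt]
    linarith

end LieAlgebra
/-! ### Smooth local frames -/

section Frames

open Set Filter Topology Bundle

variable {n : ℕ} {M : Type*} [TopologicalSpace M] [ChartedSpace (EuclideanSpace ℝ (Fin n)) M]
  [IsManifold (𝓡 n) ∞ M] {ι : Type*}
  {e : ι → (x : M) → TangentSpace (𝓡 n) x} {U : Set M}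

theorem SmoothFieldOn.contMDiffAt {X : (x : M) → TangentSpace (𝓡 n) x} (hX : SmoothFieldOn X U)
    (hU : IsOpen U) {x : M} (hx : x ∈ U) :
    ContMDiffAt (𝓡 n) (𝓡 n).tangent ∞ (fun y => (⟨y, X y⟩ : TangentBundle (𝓡 n) M)) x :=
  ContMDiffOn.contMDiffAt hX (hU.mem_nhds hx)

theorem SmoothFieldOn.mdifferentiableAt {X : (x : M) → TangentSpace (𝓡 n) x}
    (hX : SmoothFieldOn X U) (hU : IsOpen U) {x : M} (hx : x ∈ U) :
    MDifferentiableAt (𝓡 n) (𝓡 n).tangent (fun y => (⟨y, X y⟩ : TangentBundle (𝓡 n) M)) x :=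
  (hX.contMDiffAt hU hx).mdifferentiableAt (by simp)

section

variable (he : IsLocalFrameOn (𝓡 n) (EuclideanSpace ℝ (Fin n)) ∞ e U)
include he

theorem coeff_eq_repr {x : M} (hx : x ∈ U) (i : ι) (v : TangentSpace (𝓡 n) x) :
    he.coeff i x v = (he.toBasisAt hx).repr v i := by
  simp [IsLocalFrameOn.coeff, hx]

theorem sum_coeff_smul [Fintype ι] {x : M} (hx : x ∈ U) (v : TangentSpace (𝓡 n) x) :
    ∑ i, he.coeff i x v • e i x = v := by
  simp only [coeff_eq_repr he hx]
  simpa using (he.toBasisAt hx).sum_repr v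

theorem coeff_sum_smul [Fintype ι] {x : M} (hx : x ∈ U) (c : ι → ℝ) (i : ι) :
    he.coeff i x (∑ j, c j • e j x) = c i := by
  rw [coeff_eq_repr he hx]
  have h : ∑ j, c j • e j x = ∑ j, c j • he.toBasisAt hx j := by simp
  rw [h, Module.Basis.repr_sum_self]

theorem coeff_frame [DecidableEq ι] {x : M} (hx : x ∈ U) (i j : ι) :
    he.coeff i x (e j x) = if i = j then 1 else 0 := by
  rw [coeff_eq_repr he hx, ← he.toBasisAt_coe hx, Module.Basis.repr_self,
    Finsupp.single_apply]
  simp [eq_comm]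

theorem ext_coeff [Fintype ι] {x : M} (hx : x ∈ U) {v w : TangentSpace (𝓡 n) x}
    (h : ∀ i, he.coeff i x v = he.coeff i x w) : v = w := by
  rw [← sum_coeff_smul he hx v, ← sum_coeff_smul he hx w]
  simp only [h]

variable [Fintype ι]

/-- In the trivialization about `x` the coefficients in a smooth local frame are given by a smooth
family of linear maps. -/
theorem exists_smooth_coeff {x : M} (hU : U ∈ 𝓝 x) :
    ∃ A : M → EuclideanSpace ℝ (Fin n) →L[ℝ] (ι → ℝ),
      ContMDiffAt (𝓡 n) 𝓘(ℝ, EuclideanSpace ℝ (Fin n) →L[ℝ] (ι → ℝ)) ∞ A x ∧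
      ∀ᶠ y in 𝓝 x, ∀ (v : TangentSpace (𝓡 n) y) (i : ι), he.coeff i y v =
        A y (trivializationAt (EuclideanSpace ℝ (Fin n)) (TangentSpace (𝓡 n)) x
          (⟨y, v⟩ : TangentBundle (𝓡 n) M)).2 i := by
  set t := trivializationAt (EuclideanSpace ℝ (Fin n)) (TangentSpace (𝓡 n) : M → Type _) x with ht
  -- L y sends coefficients to the trivialised vector they define. It depends smoothly on y, and the
  -- coefficient map is its inverse, so smoothness follows from that of operator inversion.
  let L : M → (ι → ℝ) →L[ℝ] EuclideanSpace ℝ (Fin n) := fun y =>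
    ∑ j, (ContinuousLinearMap.proj (R := ℝ) (φ := fun _ : ι => ℝ) j).smulRight
      (t (⟨y, e j y⟩ : TangentBundle (𝓡 n) M)).2
  have hL : ∀ y ∈ U ∩ t.baseSet, ∃ A : (ι → ℝ) ≃L[ℝ] EuclideanSpace ℝ (Fin n),
      (A : (ι → ℝ) →L[ℝ] EuclideanSpace ℝ (Fin n)) = L y ∧
      ∀ (v : TangentSpace (𝓡 n) y), A (fun i => he.coeff i y v) =
        (t (⟨y, v⟩ : TangentBundle (𝓡 n) M)).2 := by
    rintro y ⟨hyU, hyt⟩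
    let B : (ι → ℝ) ≃ₗ[ℝ] EuclideanSpace ℝ (Fin n) :=
      (he.toBasisAt hyU).equivFun.symm ≪≫ₗ t.linearEquivAt ℝ y hyt
    have hB : ∀ c, B c = t.linearEquivAt ℝ y hyt (∑ j, c j • e j y) := by
      intro c
      change t.linearEquivAt ℝ y hyt ((he.toBasisAt hyU).equivFun.symm c) = _
      simp only [Module.Basis.equivFun_symm_apply, he.toBasisAt_coe]
    refine ⟨B.toContinuousLinearEquiv, ?_, fun v => ?_⟩
    · ext1 c
      change B c = _
      rw [hB, map_sum]
      simp [L]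
    · change B _ = _
      rw [hB, sum_coeff_smul he hyU]
      rfl
  have hmem : U ∩ t.baseSet ∈ 𝓝 x :=
    inter_mem hU (t.open_baseSet.mem_nhds (FiberBundle.mem_baseSet_trivializationAt' x))
  refine ⟨fun y => (L y).inverse, ?_, ?_⟩
  · obtain ⟨A, hA, -⟩ := hL x (mem_of_mem_nhds hmem)
    have h1 : ContMDiffAt (𝓡 n) 𝓘(ℝ, (ι → ℝ) →L[ℝ] EuclideanSpace ℝ (Fin n)) ∞ L x := by
      refine ContMDiffAt.sum fun j _ => ?_
      have h2 := (contMDiffAt_section x).1 ((he.contMDiffOn j).contMDiffAt hU)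
      exact (ContinuousLinearMap.smulRightL ℝ (ι → ℝ) (EuclideanSpace ℝ (Fin n))
        (ContinuousLinearMap.proj (R := ℝ) (φ := fun _ : ι => ℝ)
          j)).contDiff.contMDiff.contMDiffAt.comp x h2
    have h3 : ContDiffAt ℝ ∞ ContinuousLinearMap.inverse (L x) := by
      rw [← hA]
      exact contDiffAt_map_inverse A
    exact h3.contMDiffAt.comp x h1
  · filter_upwards [hmem] with y hy v i
    obtain ⟨A, hA, hA'⟩ := hL y hy
    rw [← hA' v, ← hA, ContinuousLinearMap.inverse_equiv]
    simp

theorem contMDiffAt_coeff {x : M} (hU : U ∈ 𝓝 x) {k : WithTop ℕ∞} (hk : k ≤ ∞)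
    {Y : (x : M) → TangentSpace (𝓡 n) x}
    (hY : ContMDiffAt (𝓡 n) (𝓡 n).tangent k (fun y => (⟨y, Y y⟩ : TangentBundle (𝓡 n) M)) x)
    (i : ι) : ContMDiffAt (𝓡 n) 𝓘(ℝ, ℝ) k (fun y => he.coeff i y (Y y)) x := by
  obtain ⟨A, hA, hA'⟩ := exists_smooth_coeff he hU
  have h1 := (hA.of_le hk).clm_apply ((contMDiffAt_section x).1 hY)
  have h2 := ((ContinuousLinearMap.proj (R := ℝ) (φ := fun _ : ι => ℝ) i).contDiff.contMDiff
    (n := k)).contMDiffAt.comp x h1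
  refine h2.congr_of_eventuallyEq ?_
  filter_upwards [hA'] with y hy
  exact hy _ i

theorem mdifferentiableAt_coeff {x : M} (hU : U ∈ 𝓝 x) {Y : (x : M) → TangentSpace (𝓡 n) x}
    (hY : MDifferentiableAt (𝓡 n) (𝓡 n).tangent
      (fun y => (⟨y, Y y⟩ : TangentBundle (𝓡 n) M)) x)
    (i : ι) : MDifferentiableAt (𝓡 n) 𝓘(ℝ, ℝ) (fun y => he.coeff i y (Y y)) x := by
  obtain ⟨A, hA, hA'⟩ := exists_smooth_coeff he hU
  have h1 := (hA.mdifferentiableAt (by simp)).clm_apply ((mdifferentiableAt_section _ _).1 hY)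
  have h2 := ((ContinuousLinearMap.proj (R := ℝ) (φ := fun _ : ι => ℝ) i).contDiff.contMDiff
    (n := 1)).mdifferentiable (by simp)
  refine (h2.mdifferentiableAt.comp x h1).congr_of_eventuallyEq ?_
  filter_upwards [hA'] with y hy
  exact hy _ i

end

/-- A family of endomorphisms of the tangent spaces is smooth if it is smooth on a local frame. -/
theorem contMDiffAt_hom_of_frame [Fintype ι]
    (he : IsLocalFrameOn (𝓡 n) (EuclideanSpace ℝ (Fin n)) ∞ e U)
    {x : M} (hU : U ∈ 𝓝 x) {T : (x : M) → TangentSpace (𝓡 n) x →L[ℝ] TangentSpace (𝓡 n) x}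
    (hT : ∀ i, ContMDiffAt (𝓡 n) (𝓡 n).tangent ∞
      (fun y => (⟨y, T y (e i y)⟩ : TangentBundle (𝓡 n) M)) x) :
    ContMDiffAt (𝓡 n)
      ((𝓡 n).prod 𝓘(ℝ, EuclideanSpace ℝ (Fin n) →L[ℝ] EuclideanSpace ℝ (Fin n))) ∞
      (fun y => (⟨y, T y⟩ : TotalSpace (EuclideanSpace ℝ (Fin n) →L[ℝ] EuclideanSpace ℝ (Fin n))
        (fun x : M => TangentSpace (𝓡 n) x →L[ℝ] TangentSpace (𝓡 n) x))) x := by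
  set t := trivializationAt (EuclideanSpace ℝ (Fin n)) (TangentSpace (𝓡 n) : M → Type _) x with ht
  obtain ⟨A, hA, hA'⟩ := exists_smooth_coeff he hU
  rw [contMDiffAt_hom_bundle]
  refine ⟨contMDiffAt_id, ?_⟩
  have hmem : t.baseSet ∈ 𝓝 x :=
    t.open_baseSet.mem_nhds (FiberBundle.mem_baseSet_trivializationAt' x)
  have h1 : ContMDiffAt (𝓡 n) 𝓘(ℝ, EuclideanSpace ℝ (Fin n) →L[ℝ] EuclideanSpace ℝ (Fin n)) ∞
      (fun y => ∑ i, ((ContinuousLinearMap.proj (R := ℝ) (φ := fun _ : ι => ℝ) i) ∘L A y).smulRight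
        (t (⟨y, T y (e i y)⟩ : TangentBundle (𝓡 n) M)).2) x := by
    refine ContMDiffAt.sum fun i _ => ?_
    have h2 := (contMDiffAt_section x).1 (hT i)
    have h3 : ContMDiffAt (𝓡 n) 𝓘(ℝ, EuclideanSpace ℝ (Fin n) →L[ℝ] ℝ) ∞
        (fun y => (ContinuousLinearMap.proj (R := ℝ) (φ := fun _ : ι => ℝ) i) ∘L A y) x :=
      contMDiffAt_const.clm_comp hA
    have h4 : ContDiff ℝ ∞ (fun q : (EuclideanSpace ℝ (Fin n) →L[ℝ] ℝ) × EuclideanSpace ℝ (Fin n) =>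
        q.1.smulRight q.2) := contDiff_fst.smulRight contDiff_snd
    exact h4.contMDiff.contMDiffAt.comp x (h3.prodMk_space h2)
  refine h1.congr_of_eventuallyEq ?_
  filter_upwards [hmem, hU, hA'] with y hy hyU hyA
  rw [ContinuousLinearMap.inCoordinates_eq hy hy]
  ext1 w
  have h4 := sum_coeff_smul he hyU ((t.continuousLinearEquivAt ℝ y hy).symm w)
  have h5 : (t (⟨y, (t.continuousLinearEquivAt ℝ y hy).symm w⟩ : TangentBundle (𝓡 n) M)).2 = w :=
    (t.continuousLinearEquivAt ℝ y hy).apply_symm_apply w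
  change t.continuousLinearEquivAt ℝ y hy (T y ((t.continuousLinearEquivAt ℝ y hy).symm w)) = _
  rw [← h4]
  simp only [map_sum, map_smul, hyA, ← ht, h5]
  simp

/-- The derivative of a smooth function along a smooth vector field is smooth. -/
theorem contMDiffAt_mvfderiv_apply (hU : IsOpen U) {g : M → ℝ}
    (hg : ContMDiffOn (𝓡 n) 𝓘(ℝ, ℝ) ∞ g U) {X : (x : M) → TangentSpace (𝓡 n) x} {x : M}
    (hx : x ∈ U)
    (hX : ContMDiffAt (𝓡 n) (𝓡 n).tangent ∞ (fun y => (⟨y, X y⟩ : TangentBundle (𝓡 n) M)) x) :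
    ContMDiffAt (𝓡 n) 𝓘(ℝ, ℝ) ∞ (fun y => mvfderiv (𝓡 n) g y (X y)) x := by
  -- The derivative of g along X is the fibre component of the tangent map of g composed with the
  -- section X.
  have h1 := hg.contMDiffOn_tangentMapWithin (m := ∞) (by simp) hU.uniqueMDiffOn
  have h2 : (TotalSpace.proj ⁻¹' U : Set (TangentBundle (𝓡 n) M)) ∈
      𝓝 (⟨x, X x⟩ : TangentBundle (𝓡 n) M) :=
    (hU.preimage (FiberBundle.continuous_proj _ _)).mem_nhds hx
  have h3 := (h1.contMDiffAt h2).comp x hX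
  have h4 := ((contMDiff_snd_tangentBundle_modelSpace (n := ∞) ℝ 𝓘(ℝ, ℝ)).contMDiffAt).comp x h3
  refine h4.congr_of_eventuallyEq ?_
  filter_upwards [hU.mem_nhds hx] with y hy
  simp only [Function.comp, tangentMapWithin]
  rw [mfderivWithin_of_isOpen hU hy]
  rfl

end Frames
/-! ### Vector fields and flows in a chart -/

section Charts

open Set Filter Topology

variable {n : ℕ} {M : Type*} [TopologicalSpace M] [ChartedSpace (EuclideanSpace ℝ (Fin n)) M]
  [IsManifold (𝓡 n) ∞ M]

theorem isInvertible_mfderiv_extChartAt_symm (p : M) {y : EuclideanSpace ℝ (Fin n)}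
    (hy : y ∈ (extChartAt (𝓡 n) p).target) :
    (mfderiv 𝓘(ℝ, EuclideanSpace ℝ (Fin n)) (𝓡 n) (extChartAt (𝓡 n) p).symm y).IsInvertible := by
  have h := isInvertible_mfderivWithin_extChartAt_symm hy
  rwa [ModelWithCorners.range_eq_univ, mfderivWithin_univ] at h

theorem contMDiffAt_extChartAt_symm (p : M) {y : EuclideanSpace ℝ (Fin n)}
    (hy : y ∈ (extChartAt (𝓡 n) p).target) :
    ContMDiffAt 𝓘(ℝ, EuclideanSpace ℝ (Fin n)) (𝓡 n) ∞ (extChartAt (𝓡 n) p).symm y :=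
  (contMDiffOn_extChartAt_symm p).contMDiffAt ((isOpen_extChartAt_target p).mem_nhds hy)

theorem mfderiv_extChartAt_symm_apply (p : M) {y : EuclideanSpace ℝ (Fin n)}
    (hy : y ∈ (extChartAt (𝓡 n) p).target)
    (v : TangentSpace (𝓡 n) ((extChartAt (𝓡 n) p).symm y)) :
    mfderiv 𝓘(ℝ, EuclideanSpace ℝ (Fin n)) (𝓡 n) (extChartAt (𝓡 n) p).symm y
      (mfderiv (𝓡 n) 𝓘(ℝ, EuclideanSpace ℝ (Fin n)) (extChartAt (𝓡 n) p)
        ((extChartAt (𝓡 n) p).symm y) v) = v := by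
  have h := mfderivWithin_extChartAt_symm_comp_mfderiv_extChartAt (I := 𝓡 n) (x := p) hy
  rw [ModelWithCorners.range_eq_univ, mfderivWithin_univ] at h
  exact DFunLike.congr_fun h v

theorem mfderiv_extChartAt_apply (p : M) {y : EuclideanSpace ℝ (Fin n)}
    (hy : y ∈ (extChartAt (𝓡 n) p).target) (v : EuclideanSpace ℝ (Fin n)) :
    mfderiv (𝓡 n) 𝓘(ℝ, EuclideanSpace ℝ (Fin n)) (extChartAt (𝓡 n) p)
      ((extChartAt (𝓡 n) p).symm y)
      (mfderiv 𝓘(ℝ, EuclideanSpace ℝ (Fin n)) (𝓡 n) (extChartAt (𝓡 n) p).symm y v) = v := by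
  have h := mfderiv_extChartAt_comp_mfderivWithin_extChartAt_symm (I := 𝓡 n) (x := p) hy
  rw [ModelWithCorners.range_eq_univ, mfderivWithin_univ] at h
  exact DFunLike.congr_fun h v

theorem mlieBracket_eq_lieBracket {E : Type*} [NormedAddCommGroup E] [NormedSpace ℝ E]
    (V W : E → E) (y : E) :
    VectorField.mlieBracket 𝓘(ℝ, E) V W y = VectorField.lieBracket ℝ V W y := by
  have h := congrFun (VectorField.mlieBracketWithin_eq_lieBracketWithin (𝕜 := ℝ) (V := V) (W := W)
    (s := univ)) y
  rw [VectorField.lieBracketWithin_univ] at h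
  exact h

/-- The expression of a vector field in the chart about `p`. -/
noncomputable def chartField (p : M) (X : (x : M) → TangentSpace (𝓡 n) x)
    (y : EuclideanSpace ℝ (Fin n)) : EuclideanSpace ℝ (Fin n) :=
  VectorField.mpullback 𝓘(ℝ, EuclideanSpace ℝ (Fin n)) (𝓡 n) (extChartAt (𝓡 n) p).symm X y

variable {p : M} {X Y : (x : M) → TangentSpace (𝓡 n) x} {y : EuclideanSpace ℝ (Fin n)}

theorem mfderiv_extChartAt_symm_chartField (hy : y ∈ (extChartAt (𝓡 n) p).target) :
    mfderiv 𝓘(ℝ, EuclideanSpace ℝ (Fin n)) (𝓡 n) (extChartAt (𝓡 n) p).symm y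
      (chartField p X y) = X ((extChartAt (𝓡 n) p).symm y) := by
  have h := isInvertible_mfderiv_extChartAt_symm p hy
  exact h.self_apply_inverse _

theorem mfderiv_extChartAt_eq_chartField (hy : y ∈ (extChartAt (𝓡 n) p).target) :
    mfderiv (𝓡 n) 𝓘(ℝ, EuclideanSpace ℝ (Fin n)) (extChartAt (𝓡 n) p)
      ((extChartAt (𝓡 n) p).symm y) (X ((extChartAt (𝓡 n) p).symm y)) = chartField p X y := by
  have h := mfderiv_extChartAt_apply p hy (chartField p X y)
  rwa [mfderiv_extChartAt_symm_chartField hy] at h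

theorem contDiffAt_chartField (hy : y ∈ (extChartAt (𝓡 n) p).target)
    (hX : ContMDiffAt (𝓡 n) (𝓡 n).tangent ∞ (fun x => (⟨x, X x⟩ : TangentBundle (𝓡 n) M))
      ((extChartAt (𝓡 n) p).symm y)) :
    ContDiffAt ℝ ∞ (chartField p X) y := by
  refine contMDiffAt_vectorSpace_iff_contDiffAt.1 ?_
  exact ContMDiffAt.mpullback_vectorField_preimage hX (contMDiffAt_extChartAt_symm p hy)
    (isInvertible_mfderiv_extChartAt_symm p hy) (by simp)

theorem lieBracket_chartField (hy : y ∈ (extChartAt (𝓡 n) p).target)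
    (hX : MDifferentiableAt (𝓡 n) (𝓡 n).tangent (fun x => (⟨x, X x⟩ : TangentBundle (𝓡 n) M))
      ((extChartAt (𝓡 n) p).symm y))
    (hY : MDifferentiableAt (𝓡 n) (𝓡 n).tangent (fun x => (⟨x, Y x⟩ : TangentBundle (𝓡 n) M))
      ((extChartAt (𝓡 n) p).symm y)) :
    VectorField.lieBracket ℝ (chartField p X) (chartField p Y) y =
      chartField p (VectorField.mlieBracket (𝓡 n) X Y) y := by
  have : IsManifold (𝓡 n) (minSmoothness ℝ 2) M := by
    rw [minSmoothness_of_isRCLikeNormedField]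
    infer_instance
  have h := VectorField.mpullback_mlieBracket hX hY (contMDiffAt_extChartAt_symm p hy)
    (by rw [minSmoothness_of_isRCLikeNormedField]; exact ENat.LEInfty.out)
  exact (mlieBracket_eq_lieBracket _ _ _).symm.trans h.symm

end Charts

/-! ### The differential of a local flow in a moving frame -/

section Flows

open Set Filter Topology

variable {n : ℕ} {M : Type*} [TopologicalSpace M] [ChartedSpace (EuclideanSpace ℝ (Fin n)) M]
  {X : (x : M) → TangentSpace (𝓡 n) x} {U V : Set M} {a b : ℝ}
  {φ : ℝ → M → M}

theorem IsLocalFlow.subset (hφ : IsLocalFlow X U a b V φ) : V ⊆ U := fun x hx => by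
  have h := hφ.mapsTo 0 ⟨hφ.neg, hφ.pos⟩ x hx
  rwa [hφ.init x hx] at h

theorem IsLocalFlow.mdifferentiableAt (hφ : IsLocalFlow X U a b V φ) {t : ℝ} (ht : t ∈ Ioo a b)
    {x : M} (hx : x ∈ V) : MDifferentiableAt (𝓡 n) (𝓡 n) (φ t) x := by
  have h1 : ContMDiffAt (𝓘(ℝ, ℝ).prod (𝓡 n)) (𝓡 n) ∞ (fun q : ℝ × M => φ q.1 q.2) (t, x) :=
    hφ.smooth.contMDiffAt ((isOpen_Ioo.prod hφ.isOpen).mem_nhds ⟨ht, hx⟩)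
  have h2 : ContMDiffAt (𝓡 n) (𝓘(ℝ, ℝ).prod (𝓡 n)) ∞ (fun y : M => (t, y)) x :=
    contMDiffAt_const.prodMk contMDiffAt_id
  exact (ContMDiffAt.comp x h1 h2).mdifferentiableAt (by simp)

theorem IsLocalFlow.mfderiv_zero (hφ : IsLocalFlow X U a b V φ) {x : M} (hx : x ∈ V) :
    HasMFDerivAt (𝓡 n) (𝓡 n) (φ 0) x (ContinuousLinearMap.id ℝ (TangentSpace (𝓡 n) x)) := by
  refine (hasMFDerivAt_id x).congr_of_eventuallyEq ?_
  filter_upwards [hφ.isOpen.mem_nhds hx] with y hy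
  exact hφ.init y hy

variable [IsManifold (𝓡 n) ∞ M]

/-- The linear differential equation for the components of the differential of a flow in a smooth
local frame. -/
theorem IsLocalFlow.hasDerivAt_coeff (hφ : IsLocalFlow X U a b V φ) {p : M} (hU : IsOpen U)
    (hUp : U ⊆ (extChartAt (𝓡 n) p).source) (hX : SmoothFieldOn X U) {ι : Type*} [Fintype ι]
    [DecidableEq ι] {e : ι → (x : M) → TangentSpace (𝓡 n) x}
    (he : IsLocalFrameOn (𝓡 n) (EuclideanSpace ℝ (Fin n)) ∞ e U)
    {t : ℝ} (ht : t ∈ Ioo a b) {x : M} (hx : x ∈ V) (v : TangentSpace (𝓡 n) x) (i : ι) :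
    HasDerivAt (fun s => he.coeff i (φ s x) (mfderiv (𝓡 n) (𝓡 n) (φ s) x v))
      (-∑ k, he.coeff i (φ t x) (VectorField.mlieBracket (𝓡 n) X (e k) (φ t x)) *
        he.coeff k (φ t x) (mfderiv (𝓡 n) (𝓡 n) (φ t) x v)) t := by
  set ψ := extChartAt (𝓡 n) p with hψ
  -- Points are rewritten as ψ.symm y so that the differentials of ψ and its inverse compose between
  -- matching tangent spaces.
  have hsubst : ∀ z ∈ U, ∃ y ∈ ψ.target, ψ.symm y = z := fun z hz =>
    ⟨ψ z, ψ.map_source (hUp hz), ψ.left_inv (hUp hz)⟩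
  obtain ⟨x₀, hx₀, rfl⟩ := hsubst x (hφ.subset hx)
  let v₀ : EuclideanSpace ℝ (Fin n) :=
    mfderiv (𝓡 n) 𝓘(ℝ, EuclideanSpace ℝ (Fin n)) ψ (ψ.symm x₀) v
  let θ : ι → EuclideanSpace ℝ (Fin n) → EuclideanSpace ℝ (Fin n) →L[ℝ] ℝ := fun i y =>
    LinearMap.toContinuousLinearMap (E := EuclideanSpace ℝ (Fin n))
      ((he.coeff i (ψ.symm y)).comp
        (mfderiv 𝓘(ℝ, EuclideanSpace ℝ (Fin n)) (𝓡 n) ψ.symm y :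
          EuclideanSpace ℝ (Fin n) →L[ℝ] TangentSpace (𝓡 n) (ψ.symm y)).toLinearMap)
  have hθ : ∀ i y w, θ i y w = he.coeff i (ψ.symm y)
      (mfderiv 𝓘(ℝ, EuclideanSpace ℝ (Fin n)) (𝓡 n) ψ.symm y w) := fun i y w => rfl
  let F : ℝ → EuclideanSpace ℝ (Fin n) → EuclideanSpace ℝ (Fin n) := fun s y =>
    ψ (φ s (ψ.symm y))
  let V' := ψ.target ∩ ψ.symm ⁻¹' V
  have hV' : IsOpen V' := (continuousOn_extChartAt_symm p).isOpen_inter_preimage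
    (isOpen_extChartAt_target p) hφ.isOpen
  have hθψ : ∀ i, ∀ z ∈ U, ∀ u : TangentSpace (𝓡 n) z, θ i (ψ z)
      (mfderiv (𝓡 n) 𝓘(ℝ, EuclideanSpace ℝ (Fin n)) ψ z u) = he.coeff i z u := by
    intro i z hz u
    obtain ⟨y, hy, rfl⟩ := hsubst z hz
    have h1 : ψ (ψ.symm y) = y := ψ.right_inv hy
    have h2 := congrArg (fun y' => θ i y' (mfderiv (𝓡 n) 𝓘(ℝ, EuclideanSpace ℝ (Fin n)) ψ
      (ψ.symm y) u : EuclideanSpace ℝ (Fin n))) h1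
    refine h2.trans ?_
    change he.coeff i (ψ.symm y) (mfderiv 𝓘(ℝ, EuclideanSpace ℝ (Fin n)) (𝓡 n) ψ.symm y
      (mfderiv (𝓡 n) 𝓘(ℝ, EuclideanSpace ℝ (Fin n)) ψ (ψ.symm y) u)) = _
    rw [mfderiv_extChartAt_symm_apply p hy u]
  have hFmem : ∀ s ∈ Ioo a b, ∀ y ∈ V', F s y ∈ ψ.target ∧ ψ.symm (F s y) = φ s (ψ.symm y) := by
    intro s hs y hy
    have h1 := hUp (hφ.mapsTo s hs _ hy.2)
    exact ⟨ψ.map_source h1, ψ.left_inv h1⟩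
  have hFd : ∀ s ∈ Ioo a b, fderiv ℝ (F s) x₀ v₀ =
      mfderiv (𝓡 n) 𝓘(ℝ, EuclideanSpace ℝ (Fin n)) ψ (φ s (ψ.symm x₀))
        (mfderiv (𝓡 n) (𝓡 n) (φ s) (ψ.symm x₀) v) := by
    intro s hs
    have h1 := ((contMDiffAt_extChartAt_symm p hx₀).mdifferentiableAt (by simp)).hasMFDerivAt
    have h2 := (hφ.mdifferentiableAt hs hx).hasMFDerivAt
    have h3 := ((contMDiffAt_extChartAt' (n := ∞) (I := 𝓡 n) (x := p)
      (by rw [← extChartAt_source (𝓡 n)]; exact hUp (hφ.mapsTo s hs _ hx))).mdifferentiableAt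
      (by simp)).hasMFDerivAt
    obtain ⟨L, hL, hLv⟩ : ∃ L : EuclideanSpace ℝ (Fin n) →L[ℝ] EuclideanSpace ℝ (Fin n),
        HasFDerivAt (F s) L x₀ ∧ ∀ w, L w = mfderiv (𝓡 n) 𝓘(ℝ, EuclideanSpace ℝ (Fin n)) ψ
          (φ s (ψ.symm x₀)) (mfderiv (𝓡 n) (𝓡 n) (φ s) (ψ.symm x₀)
            (mfderiv 𝓘(ℝ, EuclideanSpace ℝ (Fin n)) (𝓡 n) ψ.symm x₀ w)) :=
      ⟨_, ((h3.comp _ h2).comp _ h1).hasFDerivAt, fun w => rfl⟩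
    rw [hL.fderiv, hLv]
    change mfderiv (𝓡 n) 𝓘(ℝ, EuclideanSpace ℝ (Fin n)) ψ (φ s (ψ.symm x₀))
      (mfderiv (𝓡 n) (𝓡 n) (φ s) (ψ.symm x₀)
        (mfderiv 𝓘(ℝ, EuclideanSpace ℝ (Fin n)) (𝓡 n) ψ.symm x₀ v₀)) = _
    rw [mfderiv_extChartAt_symm_apply p hx₀ v]
  have hFsmooth : ContDiffOn ℝ ∞ (fun q : ℝ × EuclideanSpace ℝ (Fin n) => F q.1 q.2)
      (Ioo a b ×ˢ V') := by
    rw [← contMDiffOn_iff_contDiffOn]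
    have h1 : ContMDiffOn 𝓘(ℝ, ℝ × EuclideanSpace ℝ (Fin n)) (𝓘(ℝ, ℝ).prod (𝓡 n)) ∞
        (fun q : ℝ × EuclideanSpace ℝ (Fin n) => (q.1, ψ.symm q.2)) (Ioo a b ×ˢ V') :=
      contDiff_fst.contMDiff.contMDiffOn.prodMk
        ((contMDiffOn_extChartAt_symm p).comp contDiff_snd.contMDiff.contMDiffOn
          fun q hq => hq.2.1)
    exact (contMDiffOn_extChartAt (I := 𝓡 n) (x := p)).comp
      (hφ.smooth.comp h1 fun q hq => ⟨hq.1, hq.2.2⟩)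
      fun q hq => by
        rw [← extChartAt_source (𝓡 n)]
        exact hUp (hφ.mapsTo _ hq.1 _ hq.2.2)
  have hXat : ∀ z ∈ U, ∀ {Y : (x : M) → TangentSpace (𝓡 n) x}, SmoothFieldOn Y U →
      DifferentiableAt ℝ (chartField p Y) (ψ z) := by
    intro z hz Y hY
    refine (contDiffAt_chartField (ψ.map_source (hUp hz)) ?_).differentiableAt (by simp)
    rw [ψ.left_inv (hUp hz)]
    exact hY.contMDiffAt hU hz
  have hFder : ∀ s ∈ Ioo a b, ∀ y ∈ V',
      HasDerivAt (fun s => F s y) (chartField p X (F s y)) s := by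
    intro s hs y hy
    have h1 := (hφ.integralCurve _ hy.2 s hs).hasMFDerivAt (isOpen_Ioo.mem_nhds hs)
    have h2 := hφ.mapsTo s hs _ hy.2
    have h3 := ((contMDiffAt_extChartAt' (n := ∞) (I := 𝓡 n) (x := p)
      (by rw [← extChartAt_source (𝓡 n)]; exact hUp h2)).mdifferentiableAt
      (by simp)).hasMFDerivAt
    obtain ⟨L, hL, hLv⟩ : ∃ L : ℝ →L[ℝ] EuclideanSpace ℝ (Fin n),
        HasFDerivAt (fun s => F s y) L s ∧ L 1 = mfderiv (𝓡 n) 𝓘(ℝ, EuclideanSpace ℝ (Fin n)) ψ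
          (φ s (ψ.symm y)) ((1 : ℝ) • X (φ s (ψ.symm y))) := by
      refine ⟨_, (HasMFDerivAt.comp (f := fun s => φ s (ψ.symm y)) s h3 h1).hasFDerivAt, ?_⟩
      rfl
    refine hL.hasDerivAt.congr_deriv ?_
    obtain ⟨h5, h6⟩ := hFmem s hs y hy
    have h7 := mfderiv_extChartAt_eq_chartField (X := X) h5
    rw [hLv]
    change mfderiv (𝓡 n) 𝓘(ℝ, EuclideanSpace ℝ (Fin n)) ψ (φ s (ψ.symm y))
      ((1 : ℝ) • X (φ s (ψ.symm y))) = _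
    rw [one_smul, ← h7, h6]
  have hmem : ∀ z ∈ U, ψ.target ∩ ψ.symm ⁻¹' U ∈ 𝓝 (ψ z) := fun z hz =>
    ((continuousOn_extChartAt_symm p).isOpen_inter_preimage (isOpen_extChartAt_target p)
      hU).mem_nhds ⟨ψ.map_source (hUp hz), by rw [mem_preimage, ψ.left_inv (hUp hz)]; exact hz⟩
  have htU := hφ.mapsTo t ht _ hx
  have hθd : ∀ i, DifferentiableAt ℝ (θ i) (F t x₀) := by
    intro i
    -- Smoothness of the form θ i is tested on constant vectors w. Each of these is the chart
    -- expression of a smooth field W on M, whose frame coefficients are smooth.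
    have h1 : ContDiffOn ℝ ∞ (θ i) (ψ.target ∩ ψ.symm ⁻¹' U) := by
      rw [contDiffOn_clm_apply]
      intro w y hy
      let W : (x : M) → TangentSpace (𝓡 n) x :=
        VectorField.mpullback (𝓡 n) 𝓘(ℝ, EuclideanSpace ℝ (Fin n)) ψ fun _ => w
      have hsource : ∀ y ∈ ψ.target, ψ.symm y ∈ ψ.source := fun y hy => ψ.map_target hy
      have hW : ∀ y ∈ ψ.target, W (ψ.symm y) =
          mfderiv 𝓘(ℝ, EuclideanSpace ℝ (Fin n)) (𝓡 n) ψ.symm y w := by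
        intro y hy
        have h2 := (isInvertible_mfderiv_extChartAt (I := 𝓡 n) (hsource y hy)).inverse_apply_self
          (mfderiv 𝓘(ℝ, EuclideanSpace ℝ (Fin n)) (𝓡 n) ψ.symm y w)
        rw [mfderiv_extChartAt_apply p hy w] at h2
        exact h2
      have hWs : ContMDiffAt (𝓡 n) (𝓡 n).tangent ∞
          (fun x => (⟨x, W x⟩ : TangentBundle (𝓡 n) M)) (ψ.symm y) := by
        refine ContMDiffAt.mpullback_vectorField_preimage (n := ∞) ?_ ?_
          (isInvertible_mfderiv_extChartAt (hsource y hy.1)) (by simp)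
        · exact contMDiffAt_vectorSpace_iff_contDiffAt.2 contDiffAt_const
        · exact contMDiffAt_extChartAt' (by rw [← extChartAt_source (𝓡 n)]; exact hsource y hy.1)
      have h3 := contMDiffAt_coeff he (hU.mem_nhds hy.2) le_rfl hWs i
      have h4 := (h3.comp y (contMDiffAt_extChartAt_symm p hy.1)).contDiffAt
      refine (h4.congr_of_eventuallyEq ?_).contDiffWithinAt
      filter_upwards [(isOpen_extChartAt_target p).mem_nhds hy.1] with z hz
      rw [hθ, ← hW z hz]
      rfl
    exact (h1.contDiffAt (hmem _ htU)).differentiableAt (by simp)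
  have hdual : ∀ i j, ∀ᶠ y in 𝓝 (F t x₀), θ i y (chartField p (e j) y) =
      if i = j then 1 else 0 := by
    intro i j
    filter_upwards [hmem _ htU] with y hy
    rw [hθ, mfderiv_extChartAt_symm_chartField hy.1, coeff_frame he hy.2]
  have hspan : ∀ w, w = ∑ k, θ k (F t x₀) w • chartField p (e k) (F t x₀) := by
    intro w
    have hy := ψ.map_source (hUp htU)
    have h1 := sum_coeff_smul he (x := ψ.symm (F t x₀)) (by rw [ψ.left_inv (hUp htU)]; exact htU)
      (mfderiv 𝓘(ℝ, EuclideanSpace ℝ (Fin n)) (𝓡 n) ψ.symm (F t x₀) w)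
    have h2 := mfderiv_extChartAt_apply p hy w
    rw [← h1, map_sum] at h2
    refine h2.symm.trans (Finset.sum_congr rfl fun k _ => ?_)
    rw [map_smul]
    exact congrArg _ (mfderiv_extChartAt_eq_chartField hy)
  have hkey := hasDerivAt_flow_component isOpen_Ioo hV' hFsmooth
    (fun s hs y hy => hXat _ (hφ.mapsTo s hs _ hy.2) hX) hFder
    (e := fun i => chartField p (e i)) (θ := θ) ht (x := x₀) ⟨hx₀, hx⟩
    (fun i => hXat _ htU (he.contMDiffOn i)) hθd hdual hspan v₀ i
  have hmd : ∀ {Y : (x : M) → TangentSpace (𝓡 n) x}, SmoothFieldOn Y U →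
      MDifferentiableAt (𝓡 n) (𝓡 n).tangent (fun x => (⟨x, Y x⟩ : TangentBundle (𝓡 n) M))
        (ψ.symm (F t x₀)) := by
    intro Y hY
    rw [ψ.left_inv (hUp htU)]
    exact hY.mdifferentiableAt hU htU
  refine hkey.congr_of_eventuallyEq ?_ |>.congr_deriv ?_
  · filter_upwards [isOpen_Ioo.mem_nhds ht] with s hs
    rw [hFd s hs]
    exact (hθψ i _ (hφ.mapsTo s hs _ hx) _).symm
  · rw [hFd t ht]
    refine congrArg _ (Finset.sum_congr rfl fun k _ => ?_)
    refine congrArg₂ _ ?_ (hθψ k _ htU _)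
    rw [lieBracket_chartField (ψ.map_source (hUp htU)) (hmd hX) (hmd (he.contMDiffOn k)), hθ,
      mfderiv_extChartAt_symm_chartField (ψ.map_source (hUp htU))]
    exact congrArg (fun z => he.coeff i z (VectorField.mlieBracket (𝓡 n) X (e k) z))
      (ψ.left_inv (hUp htU))

end Flows
-- Local flows, the equation X g = a, and curves on the manifold
section Existence

open Set Filter Topology

variable {n : ℕ} {M : Type*} [TopologicalSpace M] [ChartedSpace (EuclideanSpace ℝ (Fin n)) M]
  [IsManifold (𝓡 n) ∞ M] {X : (x : M) → TangentSpace (𝓡 n) x} {U : Set M} {p : M}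

theorem contDiffOn_chartField (hU : IsOpen U) (hX : SmoothFieldOn X U) :
    ContDiffOn ℝ ∞ (chartField p X)
      ((extChartAt (𝓡 n) p).target ∩ (extChartAt (𝓡 n) p).symm ⁻¹' U) := fun _ hy =>
  (contDiffAt_chartField hy.1 (hX.contMDiffAt hU hy.2)).contDiffWithinAt

/-- A smooth vector field has a local flow about each point. -/
theorem exists_isLocalFlow (hU : IsOpen U) (hX : SmoothFieldOn X U) (hp : p ∈ U) :
    ∃ ε : ℝ, ∃ V : Set M, p ∈ V ∧ ∃ φ : ℝ → M → M, IsLocalFlow X U (-ε) ε V φ := by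
  set ψ := extChartAt (𝓡 n) p with hψ
  have hpψ : p ∈ ψ.source := mem_extChartAt_source p
  have hΩ : IsOpen (ψ.target ∩ ψ.symm ⁻¹' U) :=
    (continuousOn_extChartAt_symm p).isOpen_inter_preimage (isOpen_extChartAt_target p) hU
  have hx₀ : ψ p ∈ ψ.target ∩ ψ.symm ⁻¹' U :=
    ⟨ψ.map_source hpψ, by rw [mem_preimage, ψ.left_inv hpψ]; exact hp⟩
  obtain ⟨ε, hε, V, hV, hpV, Φ, hΦ, hΦ0, hΦΩ, hΦd⟩ :=
    exists_smooth_flow hΩ (contDiffOn_chartField hU hX) hx₀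
  refine ⟨ε, ψ.source ∩ ψ ⁻¹' V, ⟨hpψ, hpV⟩, fun t x => ψ.symm (Φ t (ψ x)), ?_⟩
  refine
    { neg := by linarith
      pos := hε
      isOpen := isOpen_extChartAt_preimage' p hV
      mapsTo := fun t ht x hx => (hΦΩ t ht _ hx.2).2
      smooth := ?_
      init := fun x hx => by rw [hΦ0 _ hx.2, ψ.left_inv hx.1]
      integralCurve := fun x hx t ht => ?_ }
  · have h1 : ContMDiffOn (𝓘(ℝ, ℝ).prod (𝓡 n)) 𝓘(ℝ, ℝ × EuclideanSpace ℝ (Fin n)) ∞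
        (fun q : ℝ × M => (q.1, ψ q.2)) (Ioo (-ε) ε ×ˢ (ψ.source ∩ ψ ⁻¹' V)) :=
      contMDiffOn_fst.prodMk_space
        ((contMDiffOn_extChartAt (I := 𝓡 n) (x := p)).comp contMDiffOn_snd fun q hq => by
          rw [← extChartAt_source (𝓡 n)]
          exact hq.2.1)
    exact (contMDiffOn_extChartAt_symm p).comp
      ((contMDiffOn_iff_contDiffOn.2 hΦ).comp h1 fun q hq => ⟨hq.1, hq.2.2⟩)
      fun q hq => (hΦΩ _ hq.1 _ hq.2.2).1
  · have hy := (hΦΩ t ht _ hx.2).1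
    have h1 := ((contMDiffAt_extChartAt_symm p hy).mdifferentiableAt (by simp)).hasMFDerivAt
    have h2 := (hΦd t ht _ hx.2).hasFDerivAt.hasMFDerivAt
    have h3 := (HasMFDerivAt.comp (f := fun s => Φ s (ψ x)) t h1 h2)
    refine HasMFDerivAt.hasMFDerivWithinAt ?_
    refine h3.congr_mfderiv ?_
    ext1
    change mfderiv 𝓘(ℝ, EuclideanSpace ℝ (Fin n)) (𝓡 n) ψ.symm (Φ t (ψ x))
      ((1 : ℝ) • chartField p X (Φ t (ψ x))) = (1 : ℝ) • X (ψ.symm (Φ t (ψ x)))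
    rw [one_smul, one_smul, mfderiv_extChartAt_symm_chartField hy]

/-- The equation `X g = a` is locally solvable where `X` does not vanish. -/
theorem exists_mvfderiv_apply_eq (hU : IsOpen U) (hX : SmoothFieldOn X U) (hp : p ∈ U)
    (hXp : X p ≠ 0) {a : M → ℝ} (ha : ContMDiffOn (𝓡 n) 𝓘(ℝ, ℝ) ∞ a U) :
    ∃ W ⊆ U, IsOpen W ∧ p ∈ W ∧ ∃ g : M → ℝ, ContMDiffOn (𝓡 n) 𝓘(ℝ, ℝ) ∞ g W ∧
      ∀ x ∈ W, mvfderiv (𝓡 n) g x (X x) = a x := by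
  set ψ := extChartAt (𝓡 n) p with hψ
  have hpψ : p ∈ ψ.source := mem_extChartAt_source p
  have hΩ : IsOpen (ψ.target ∩ ψ.symm ⁻¹' U) :=
    (continuousOn_extChartAt_symm p).isOpen_inter_preimage (isOpen_extChartAt_target p) hU
  have hx₀ : ψ p ∈ ψ.target ∩ ψ.symm ⁻¹' U :=
    ⟨ψ.map_source hpψ, by rw [mem_preimage, ψ.left_inv hpψ]; exact hp⟩
  have ha' : ContDiffOn ℝ ∞ (a ∘ ψ.symm) (ψ.target ∩ ψ.symm ⁻¹' U) := by
    rw [← contMDiffOn_iff_contDiffOn]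
    exact ha.comp ((contMDiffOn_extChartAt_symm p).mono inter_subset_left) fun y hy => hy.2
  have h0 : chartField p X (ψ p) ≠ 0 := by
    intro h0
    have h1 := mfderiv_extChartAt_symm_chartField (X := X) (ψ.map_source hpψ)
    rw [h0] at h1
    have h2 : X (ψ.symm (ψ p)) = 0 := by
      rw [← h1]
      exact map_zero _
    rw [ψ.left_inv hpψ] at h2
    exact hXp h2
  obtain ⟨W, hW, hpW, g, hg, hgf⟩ :=
    exists_primitive_along_field hΩ (contDiffOn_chartField hU hX) ha' hx₀ h0
  refine ⟨(ψ.source ∩ ψ ⁻¹' W) ∩ U, inter_subset_right,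
    (isOpen_extChartAt_preimage' p hW).inter hU, ⟨⟨hpψ, hpW⟩, hp⟩, g ∘ ψ, ?_, ?_⟩
  · exact (contMDiffOn_iff_contDiffOn.2 hg).comp
      ((contMDiffOn_extChartAt (I := 𝓡 n) (x := p)).mono fun x hx => by
        rw [← extChartAt_source (𝓡 n)]
        exact hx.1.1) fun x hx => hx.1.2
  · rintro x ⟨⟨hxψ, hxW⟩, hxU⟩
    have h1 := ((contMDiffAt_extChartAt' (n := ∞) (I := 𝓡 n) (x := p)
      (by rw [← extChartAt_source (𝓡 n)]; exact hxψ)).mdifferentiableAt (by simp)).hasMFDerivAt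
    have h2 := ((hg.contDiffAt (hW.mem_nhds hxW)).differentiableAt
      (by simp)).hasFDerivAt.hasMFDerivAt
    have h3 := HasMFDerivAt.comp x h2 h1
    rw [mvfderiv, h3.mfderiv]
    have h4 := mfderiv_extChartAt_eq_chartField (X := X) (ψ.map_source hxψ)
    rw [ψ.left_inv hxψ] at h4
    have h5 := hgf _ hxW
    change fderiv ℝ g (ψ x) (mfderiv (𝓡 n) 𝓘(ℝ, EuclideanSpace ℝ (Fin n)) ψ x (X x)) = _
    rw [h4, h5, Function.comp, ψ.left_inv hxψ]

/-- Every tangent vector is the velocity of a curve. -/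
theorem exists_curve (x : M) (v : TangentSpace (𝓡 n) x) :
    ∃ γ : ℝ → M, Tendsto γ (𝓝 0) (𝓝 x) ∧ γ 0 = x ∧
      ∀ g : M → ℝ, MDifferentiableAt (𝓡 n) 𝓘(ℝ, ℝ) g x →
        HasDerivAt (fun s => g (γ s)) (mvfderiv (𝓡 n) g x v) 0 := by
  obtain ⟨p, hp⟩ : ∃ p : M, x ∈ (extChartAt (𝓡 n) p).source := ⟨x, mem_extChartAt_source x⟩
  set ψ := extChartAt (𝓡 n) p with hψ
  obtain ⟨y, hy, rfl⟩ : ∃ y ∈ ψ.target, ψ.symm y = x := ⟨ψ x, ψ.map_source hp, ψ.left_inv hp⟩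
  let w : EuclideanSpace ℝ (Fin n) :=
    mfderiv (𝓡 n) 𝓘(ℝ, EuclideanSpace ℝ (Fin n)) ψ (ψ.symm y) v
  have hline : HasDerivAt (fun s : ℝ => y + s • w) w 0 := by
    simpa using ((hasDerivAt_id (0 : ℝ)).smul_const w).const_add y
  have hψd := (contMDiffAt_extChartAt_symm p hy).mdifferentiableAt (by simp)
  refine ⟨fun s => ψ.symm (y + s • w), ?_, by simp, fun g hg => ?_⟩
  · have h1 := hline.continuousAt
    have h2 : y + (0 : ℝ) • w = y := by rw [zero_smul, add_zero]
    rw [ContinuousAt, h2] at h1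
    exact hψd.continuousAt.tendsto.comp h1
  · obtain ⟨L, hL, hLw⟩ : ∃ L : EuclideanSpace ℝ (Fin n) →L[ℝ] ℝ, HasFDerivAt (g ∘ ψ.symm) L y ∧
        L w = mfderiv (𝓡 n) 𝓘(ℝ, ℝ) g (ψ.symm y)
          (mfderiv 𝓘(ℝ, EuclideanSpace ℝ (Fin n)) (𝓡 n) ψ.symm y w) := by
      refine ⟨_, (HasMFDerivAt.comp y hg.hasMFDerivAt hψd.hasMFDerivAt).hasFDerivAt, ?_⟩
      rfl
    have h1 : HasFDerivAt (g ∘ ψ.symm) L (y + (0 : ℝ) • w) := by simpa using hL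
    have h2 := h1.comp_hasDerivAt 0 hline
    rw [hLw, mfderiv_extChartAt_symm_apply p hy v] at h2
    exact h2

end Existence
/-! ### Sections of `G`-structures and infinitesimal automorphisms -/

section Sections

open Set Filter Topology

variable {n : ℕ} {M : Type*} [TopologicalSpace M] [ChartedSpace (EuclideanSpace ℝ (Fin n)) M]

theorem frameMap_frameMul {x : M} (u : Fin n → TangentSpace (𝓡 n) x)
    (a : Matrix (Fin n) (Fin n) ℝ) (w : Fin n → ℝ) :
    frameMap (frameMul u a) w = frameMap u (a *ᵥ w) := by
  simp only [frameMap, frameMul, Finset.smul_sum, smul_smul, Matrix.mulVec, dotProduct,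
    Finset.sum_smul]
  rw [Finset.sum_comm]
  simp only [mul_comm]

variable [IsManifold (𝓡 n) ∞ M] {G : Subgroup (GL (Fin n) ℝ)} {P : GStructure G M}
  {e : Fin n → (x : M) → TangentSpace (𝓡 n) x} {U W : Set M}

theorem GStructure.IsLocalSection.mono (he : P.IsLocalSection e U) (h : W ⊆ U) :
    P.IsLocalSection e W :=
  ⟨fun i => ContMDiffOn.mono (he.1 i) h, fun x hx => he.2 x (h hx)⟩

theorem GStructure.IsLocalSection.isLocalFrameOn (he : P.IsLocalSection e U) :
    IsLocalFrameOn (𝓡 n) (EuclideanSpace ℝ (Fin n)) ∞ e U where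
  linearIndependent hx := P.linearIndependent _ _ (he.2 _ hx)
  generating {x} hx := by
    have : FiniteDimensional ℝ (TangentSpace (𝓡 n) x) :=
      inferInstanceAs (FiniteDimensional ℝ (EuclideanSpace ℝ (Fin n)))
    have h := (P.linearIndependent _ _ (he.2 _ hx)).span_eq_top_of_card_eq_finrank' (by
      change _ = Module.finrank ℝ (EuclideanSpace ℝ (Fin n))
      simp)
    exact h.ge
  contMDiffOn := he.1

theorem GStructure.IsInfAutOn.mono {X : (x : M) → TangentSpace (𝓡 n) x} (hX : P.IsInfAutOn X U)
    (h : W ⊆ U) : P.IsInfAutOn X W := fun a b V φ hφ =>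
  hX a b V φ { hφ with mapsTo := fun t ht x hx => h (hφ.mapsTo t ht x hx) }

theorem frameMul_coeff (he : IsLocalFrameOn (𝓡 n) (EuclideanSpace ℝ (Fin n)) ∞ e U) {x : M}
    (hx : x ∈ U) (u : Fin n → TangentSpace (𝓡 n) x) :
    frameMul (fun i => e i x) (Matrix.of fun i j => he.coeff i x (u j)) = u := by
  ext1 j
  exact sum_coeff_smul he hx (u j)

theorem coeff_frameMul (he : IsLocalFrameOn (𝓡 n) (EuclideanSpace ℝ (Fin n)) ∞ e U) {x : M}
    (hx : x ∈ U) (a : Matrix (Fin n) (Fin n) ℝ) (i j : Fin n) :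
    he.coeff i x (frameMul (fun i => e i x) a j) = a i j :=
  coeff_sum_smul he hx (fun i => a i j) i

theorem contMDiffAt_mlieBracket {X Y : (x : M) → TangentSpace (𝓡 n) x} {x : M}
    (hX : ContMDiffAt (𝓡 n) (𝓡 n).tangent ∞ (fun y => (⟨y, X y⟩ : TangentBundle (𝓡 n) M)) x)
    (hY : ContMDiffAt (𝓡 n) (𝓡 n).tangent ∞ (fun y => (⟨y, Y y⟩ : TangentBundle (𝓡 n) M)) x) :
    ContMDiffAt (𝓡 n) (𝓡 n).tangent ∞
      (fun y => (⟨y, VectorField.mlieBracket (𝓡 n) X Y y⟩ : TangentBundle (𝓡 n) M)) x := by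
  have : IsManifold (𝓡 n) (minSmoothness ℝ 2) M := by
    rw [minSmoothness_of_isRCLikeNormedField]
    infer_instance
  have : IsManifold (𝓡 n) (((⊤ : ℕ∞) : WithTop ℕ∞) + 1) M := by
    simpa
  exact ContMDiffAt.mlieBracket_vectorField (n := ⊤) (m := ⊤) hX hY
    (by rw [minSmoothness_of_isRCLikeNormedField]; simp)

end Sections

/-! ### The null distributions and infinitesimal automorphisms in a section -/

section GNSections

open Set Filter Topology

variable {m : ℕ} {M : Type*} [TopologicalSpace M]
  [ChartedSpace (EuclideanSpace ℝ (Fin (m + 2))) M] [IsManifold (𝓡 (m + 2)) ∞ M]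
  {P : GStructure (GN m) M} {e : Fin (m + 2) → (x : M) → TangentSpace (𝓡 (m + 2)) x} {U : Set M}

/-- The fibre is a single `GN`-orbit, so membership is a condition on the matrix relating u to the
section at x. -/
theorem mem_fibre_iff (he : P.IsLocalSection e U) {x : M} (hx : x ∈ U)
    (u : Fin (m + 2) → TangentSpace (𝓡 (m + 2)) x) :
    u ∈ P.fibre x ↔ IsGN (Matrix.of fun i j => he.isLocalFrameOn.coeff i x (u j)) := by
  constructor
  · intro hu
    obtain ⟨a, ha, rfl⟩ := P.transitive x _ (he.2 x hx) u hu
    simp only [coeff_frameMul he.isLocalFrameOn hx]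
    exact ha
  · intro h
    obtain ⟨g, hg, hgA⟩ := h.exists_mem_GN
    rw [← frameMul_coeff he.isLocalFrameOn hx u, ← hgA]
    exact P.mul_mem x _ (he.2 x hx) g hg

/-- Since η(k, w) = w 1 and `GN` preserves k^⊥, the hyperplane is the kernel of the coefficient of
index 1 in any section. -/
theorem mem_nullPerp_iff (he : P.IsLocalSection e U) {x : M} (hx : x ∈ U)
    (v : TangentSpace (𝓡 (m + 2)) x) :
    v ∈ nullPerp P x ↔ he.isLocalFrameOn.coeff 1 x v = 0 := by
  constructor
  · rintro ⟨u, hu, w, hw, rfl⟩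
    obtain ⟨a, ha, rfl⟩ := P.transitive x _ (he.2 x hx) u hu
    rw [frameMap_frameMul, frameMap, coeff_sum_smul he.isLocalFrameOn hx,
      ← eta_kVec ((a : Matrix (Fin (m + 2)) (Fin (m + 2)) ℝ) *ᵥ w)]
    exact (IsGN.perp_iff ha w).2 hw
  · intro h
    exact ⟨_, he.2 x hx, fun i => he.isLocalFrameOn.coeff i x v, by rw [eta_kVec, h],
      (sum_coeff_smul he.isLocalFrameOn hx v).symm⟩

theorem mem_nullLine_iff (he : P.IsLocalSection e U) {x : M} (hx : x ∈ U)
    (v : TangentSpace (𝓡 (m + 2)) x) :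
    v ∈ nullLine P x ↔ ∃ c : ℝ, v = c • e 0 x := by
  have hk : ∀ (c : ℝ), frameMap (fun i => e i x) (c • kVec m) = c • e 0 x := by
    intro c
    simp [frameMap, kVec, Pi.single_apply]
  constructor
  · rintro ⟨u, hu, w, hw, rfl⟩
    obtain ⟨a, ha, rfl⟩ := P.transitive x _ (he.2 x hx) u hu
    obtain ⟨c, rfl⟩ := Submodule.mem_span_singleton.1 hw
    obtain ⟨d, -, hd⟩ := IsGN.exists_map_k ha
    refine ⟨c * d, ?_⟩
    rw [frameMap_frameMul, Matrix.mulVec_smul, hd, smul_smul, hk]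
  · rintro ⟨c, rfl⟩
    exact ⟨_, he.2 x hx, c • kVec m, Submodule.smul_mem _ _ (Submodule.mem_span_singleton_self _),
      (hk c).symm⟩

variable {X : (x : M) → TangentSpace (𝓡 (m + 2)) x} {p : M}

/-- Initial value of the component equation. The differential of φ 0 takes values over φ 0 x, which
is only propositionally equal to x, hence the passage through the model space. -/
theorem coeff_mfderiv_flow_zero (he : P.IsLocalSection e U) {a b : ℝ} {V : Set M} {φ : ℝ → M → M}
    (hφ : IsLocalFlow X U a b V φ) {x : M} (hx : x ∈ V) (i : Fin (m + 2))
    (v : TangentSpace (𝓡 (m + 2)) x) :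
    he.isLocalFrameOn.coeff i (φ 0 x) (mfderiv (𝓡 (m + 2)) (𝓡 (m + 2)) (φ 0) x v) =
      he.isLocalFrameOn.coeff i x v := by
  rw [(hφ.mfderiv_zero hx).mfderiv]
  exact congrArg (fun z => he.isLocalFrameOn.coeff i z (v : EuclideanSpace ℝ (Fin (m + 2))))
    (hφ.init x hx)

/-- An infinitesimal automorphism satisfies the infinitesimal condition on the bracket. -/
theorem isInfGN_mlieBracket (he : P.IsLocalSection e U) (hU : IsOpen U)
    (hUp : U ⊆ (extChartAt (𝓡 (m + 2)) p).source) (hX : SmoothFieldOn X U)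
    (hXP : P.IsInfAutOn X U) {x : M} (hx : x ∈ U) :
    IsInfGN (Matrix.of fun i j => he.isLocalFrameOn.coeff i x
      (VectorField.mlieBracket (𝓡 (m + 2)) X (e j) x)) := by
  obtain ⟨ε, V, hxV, φ, hφ⟩ := exists_isLocalFlow hU hX hx
  have h0 : (0 : ℝ) ∈ Ioo (-ε) ε := ⟨hφ.neg, hφ.pos⟩
  have hC0 : ∀ i j, he.isLocalFrameOn.coeff i (φ 0 x)
      (mfderiv (𝓡 (m + 2)) (𝓡 (m + 2)) (φ 0) x (e j x)) = if i = j then 1 else 0 := by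
    intro i j
    rw [coeff_mfderiv_flow_zero he hφ hxV, coeff_frame he.isLocalFrameOn hx]
  -- With C(0) = 1, the logarithmic derivative of C at 0 is C'(0), which is minus the bracket
  -- matrix; the sign is removed at the end.
  have h1 : IsInfGN (-(Matrix.of fun i j => he.isLocalFrameOn.coeff i x
      (VectorField.mlieBracket (𝓡 (m + 2)) X (e j) x))) := by
    refine isInfGN_of_hasDerivAt (t := 0) (C' := -(Matrix.of fun i j => he.isLocalFrameOn.coeff i x
      (VectorField.mlieBracket (𝓡 (m + 2)) X (e j) x)))
      (C := fun s => Matrix.of fun i j => he.isLocalFrameOn.coeff i (φ s x)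
      (mfderiv (𝓡 (m + 2)) (𝓡 (m + 2)) (φ s) x (e j x))) ?_ (fun i j => ?_) ?_
    · filter_upwards [isOpen_Ioo.mem_nhds h0] with s hs
      exact (mem_fibre_iff he (hφ.mapsTo s hs x hxV) _).1 (hXP _ _ _ _ hφ s hs x hxV _ (he.2 x hx))
    · refine (hφ.hasDerivAt_coeff hU hUp hX he.isLocalFrameOn h0 hxV (e j x) i).congr_deriv ?_
      simp only [hC0, mul_ite, mul_one, mul_zero, Finset.sum_ite_eq', Finset.mem_univ, if_true]
      rw [hφ.init x hxV]
      rfl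
    · have h2 : (Matrix.of fun i j => he.isLocalFrameOn.coeff i (φ 0 x)
          (mfderiv (𝓡 (m + 2)) (𝓡 (m + 2)) (φ 0) x (e j x))) = 1 := by
        ext i j
        rw [Matrix.of_apply, hC0, Matrix.one_apply]
      rw [h2, one_mul]
  simpa using h1.neg

/-- The infinitesimal condition on the bracket characterizes infinitesimal automorphisms. -/
theorem isInfAutOn_of_isInfGN (he : P.IsLocalSection e U) (hU : IsOpen U)
    (hUp : U ⊆ (extChartAt (𝓡 (m + 2)) p).source) (hX : SmoothFieldOn X U)
    (h : ∀ x ∈ U, IsInfGN (Matrix.of fun i j => he.isLocalFrameOn.coeff i x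
      (VectorField.mlieBracket (𝓡 (m + 2)) X (e j) x))) : P.IsInfAutOn X U := by
  intro a b V φ hφ t ht x hx u hu
  have hxU := hφ.subset hx
  have hGN := isGN_of_hasDerivAt hφ.neg hφ.pos
    (C := fun s => Matrix.of fun i j => he.isLocalFrameOn.coeff i (φ s x)
      (mfderiv (𝓡 (m + 2)) (𝓡 (m + 2)) (φ s) x (e j x)))
    (D := fun s => -(Matrix.of fun i j => he.isLocalFrameOn.coeff i (φ s x)
      (VectorField.mlieBracket (𝓡 (m + 2)) X (e j) (φ s x)))) ?_
    (fun s hs => (h _ (hφ.mapsTo s hs x hx)).neg) (fun s hs i j => ?_) ?_ t ht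
  · rw [mem_fibre_iff he hxU] at hu
    rw [mem_fibre_iff he (hφ.mapsTo t ht x hx)]
    -- The transported frame has matrix C(t) times the matrix of u, since C(t) is the matrix of the
    -- differential on the section.
    convert! hGN.mul hu using 1
    ext i j
    rw [Matrix.mul_apply, Matrix.of_apply]
    conv_lhs => rw [← sum_coeff_smul he.isLocalFrameOn hxU (u j)]
    simp only [map_sum, map_smul, Matrix.of_apply, smul_eq_mul]
    exact Finset.sum_congr rfl fun k _ => mul_comm _ _
  · intro i j s hs
    have h1 := contMDiffAt_coeff he.isLocalFrameOn (hU.mem_nhds (hφ.mapsTo s hs x hx)) le_rfl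
      (contMDiffAt_mlieBracket (hX.contMDiffAt hU (hφ.mapsTo s hs x hx))
        ((he.1 j).contMDiffAt hU (hφ.mapsTo s hs x hx))) i
    have h2 := (hφ.integralCurve x hx s hs).continuousWithinAt
    exact (ContinuousAt.comp_continuousWithinAt (f := fun s => φ s x) h1.continuousAt h2).neg
  · refine (hφ.hasDerivAt_coeff hU hUp hX he.isLocalFrameOn hs hx (e j x) i).congr_deriv ?_
    rw [neg_mul, Matrix.neg_apply, Matrix.mul_apply]
    rfl
  · ext i j
    rw [Matrix.of_apply, coeff_mfderiv_flow_zero he hφ hx, coeff_frame he.isLocalFrameOn hxU,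
      Matrix.one_apply]

end GNSections
/-! ### Torsion-free `GN`-connections give Kundt structures -/

section CovariantDerivative

open Set Filter Topology

variable {n : ℕ} {M : Type*} [TopologicalSpace M] [ChartedSpace (EuclideanSpace ℝ (Fin n)) M]
  [IsManifold (𝓡 n) ∞ M] {ι : Type*}
  {cov : ((x : M) → TangentSpace (𝓡 n) x) →
    ((x : M) → TangentSpace (𝓡 n) x →L[ℝ] TangentSpace (𝓡 n) x)}
  {U W : Set M} {e : ι → (x : M) → TangentSpace (𝓡 n) x}

theorem cov_sum (hcov : IsCovariantDerivativeOn (EuclideanSpace ℝ (Fin n)) cov U) {x : M}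
    (hx : x ∈ U) (s : Finset ι) (σ : ι → (x : M) → TangentSpace (𝓡 n) x)
    (hσ : ∀ j, MDifferentiableAt (𝓡 n) (𝓡 n).tangent
      (fun y => (⟨y, σ j y⟩ : TangentBundle (𝓡 n) M)) x) :
    cov (fun y => ∑ j ∈ s, σ j y) x = ∑ j ∈ s, cov (σ j) x := by
  classical
  induction s using Finset.induction_on with
  | empty =>
    simp only [Finset.sum_empty]
    exact hcov.zero hx
  | insert a s ha ih =>
    simp only [Finset.sum_insert ha, ← ih]
    exact hcov.add (hσ a) (MDifferentiableAt.sum_section fun j _ => hσ j) hx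

variable [Fintype ι]

/-- The components of a covariant derivative in a local frame. -/
theorem coeff_cov (hcov : IsCovariantDerivativeOn (EuclideanSpace ℝ (Fin n)) cov U)
    (he : IsLocalFrameOn (𝓡 n) (EuclideanSpace ℝ (Fin n)) ∞ e W) (hW : IsOpen W) (hWU : W ⊆ U)
    {x : M} (hx : x ∈ W) {Y : (x : M) → TangentSpace (𝓡 n) x}
    (hY : MDifferentiableAt (𝓡 n) (𝓡 n).tangent
      (fun y => (⟨y, Y y⟩ : TangentBundle (𝓡 n) M)) x) (i : ι) (v : TangentSpace (𝓡 n) x) :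
    he.coeff i x (cov Y x v) = mvfderiv (𝓡 n) (fun y => he.coeff i y (Y y)) x v +
      ∑ j, he.coeff j x (Y x) * he.coeff i x (cov (e j) x v) := by
  classical
  have hc : ∀ j, MDifferentiableAt (𝓡 n) 𝓘(ℝ, ℝ) (fun y => he.coeff j y (Y y)) x := fun j =>
    mdifferentiableAt_coeff he (hW.mem_nhds hx) hY j
  have hej : ∀ j, MDifferentiableAt (𝓡 n) (𝓡 n).tangent
      (fun y => (⟨y, e j y⟩ : TangentBundle (𝓡 n) M)) x := fun j =>
    SmoothFieldOn.mdifferentiableAt (he.contMDiffOn j) hW hx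
  have hσ : ∀ j, MDifferentiableAt (𝓡 n) (𝓡 n).tangent (fun y =>
      (⟨y, he.coeff j y (Y y) • e j y⟩ : TangentBundle (𝓡 n) M)) x := fun j =>
    (hc j).smul_section (hej j)
  have h1 : cov Y x = cov (fun y => ∑ j, he.coeff j y (Y y) • e j y) x := by
    refine hcov.congr_of_eventuallyEq hY (MDifferentiableAt.sum_section fun j _ => hσ j)
      (mem_of_superset (hW.mem_nhds hx) hWU) ?_
    filter_upwards [hW.mem_nhds hx] with y hy
    exact (sum_coeff_smul he hy (Y y)).symm
  have h2 : ∀ j, cov (fun y => he.coeff j y (Y y) • e j y) x v =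
      he.coeff j x (Y x) • cov (e j) x v +
        mvfderiv (𝓡 n) (fun y => he.coeff j y (Y y)) x v • e j x := by
    intro j
    have h3 := hcov.leibniz (hej j) (hc j) (hWU hx)
    exact DFunLike.congr_fun h3 v
  rw [h1, cov_sum hcov (hWU hx) _ _ hσ, sum_apply, map_sum]
  simp only [h2, map_add, map_smul, smul_eq_mul, coeff_frame he hx, mul_ite, mul_one, mul_zero,
    Finset.sum_add_distrib, Finset.sum_ite_eq, Finset.mem_univ, if_true]
  exact add_comm _ _

/-- A smooth vector field near a point agrees near it with a globally smooth one. -/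
theorem exists_smoothFieldOn_univ [T2Space M] {X : (x : M) → TangentSpace (𝓡 n) x}
    (hW : IsOpen W) (hX : SmoothFieldOn X W) {p : M} (hp : p ∈ W) :
    ∃ Y : (x : M) → TangentSpace (𝓡 n) x, SmoothFieldOn Y univ ∧ ∃ W' ⊆ W, IsOpen W' ∧ p ∈ W' ∧
      ∀ x ∈ W', Y x = X x := by
  obtain ⟨f, -, hf⟩ := (SmoothBumpFunction.nhds_basis_tsupport (I := 𝓡 n) p).mem_iff.1
    (hW.mem_nhds hp)
  obtain ⟨W', hW'f, hW', hpW'⟩ := mem_nhds_iff.1 f.eventuallyEq_one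
  refine ⟨fun x => f x • X x, ?_, W' ∩ W, inter_subset_right, hW'.inter hW, ⟨hpW', hp⟩, ?_⟩
  · exact (ContMDiffOn.smul_section_of_tsupport f.contMDiff.contMDiffOn hW hf hX).contMDiffOn
  · intro x hx
    have h1 : f x = 1 := hW'f hx.1
    change f x • X x = X x
    rw [h1]
    exact one_smul ℝ (X x)

/-- Smoothness of a connection is stated for fields smooth on all of U, whereas Y is smooth only on
W. A cut-off of Y agrees with it near x, and the covariant derivative is local. -/
theorem contMDiffAt_cov [T2Space M] (hcov : IsConnectionOn cov U) (hU : IsOpen U) (hW : IsOpen W)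
    (hWU : W ⊆ U) {X Y : (x : M) → TangentSpace (𝓡 n) x} (hX : SmoothFieldOn X W)
    (hY : SmoothFieldOn Y W) {x : M} (hx : x ∈ W) :
    ContMDiffAt (𝓡 n) (𝓡 n).tangent ∞
      (fun y => (⟨y, cov Y y (X y)⟩ : TangentBundle (𝓡 n) M)) x := by
  obtain ⟨Z, hZ, W', hW'W, hW', hxW', hZY⟩ := exists_smoothFieldOn_univ hW hY hx
  have h1 := (hcov.smooth.contMDiff (σ := Z) (ContMDiffOn.mono hZ (subset_univ _))).contMDiffAt
    (hU.mem_nhds (hWU hx))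
  have h2 := ContMDiffAt.clm_bundle_apply h1 (hX.contMDiffAt hW hx)
  refine h2.congr_of_eventuallyEq ?_
  filter_upwards [hW'.mem_nhds hxW'] with y hy
  have h3 : cov Y y = cov Z y := by
    refine hcov.isCovariantDerivativeOn.congr_of_eventuallyEq (hY.mdifferentiableAt hW (hW'W hy))
      (hZ.mdifferentiableAt isOpen_univ (mem_univ y)) (hU.mem_nhds (hWU (hW'W hy))) ?_
    filter_upwards [hW'.mem_nhds hy] with z hz
    exact (hZY z hz).symm
  rw [h3]

end CovariantDerivative

/-! ### Integrability of Λ and the rescaled null field -/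

section Kundt

open Set Filter Topology

variable {m : ℕ} {M : Type*} [TopologicalSpace M]
  [ChartedSpace (EuclideanSpace ℝ (Fin (m + 2))) M] [IsManifold (𝓡 (m + 2)) ∞ M]
  {P : GStructure (GN m) M} {e : Fin (m + 2) → (x : M) → TangentSpace (𝓡 (m + 2)) x} {U W : Set M}
  {cov : ((x : M) → TangentSpace (𝓡 (m + 2)) x) →
    ((x : M) → TangentSpace (𝓡 (m + 2)) x →L[ℝ] TangentSpace (𝓡 (m + 2)) x)}

theorem isInfGN_connectionForm (hP : P.HasConnectionOn cov U) (hW : IsOpen W) (hWU : W ⊆ U)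
    (he : P.IsLocalSection e W) {x : M} (hx : x ∈ W) (v : TangentSpace (𝓡 (m + 2)) x) :
    IsInfGN (Matrix.of fun i j => he.isLocalFrameOn.coeff i x (cov (e j) x v)) := by
  obtain ⟨A, hA, hAv⟩ := hP W hW hWU e he x hx v
  simp only [hAv, coeff_sum_smul he.isLocalFrameOn hx]
  exact mem_matrixLieAlgebra_GN.1 hA

/-- The covariant derivative of a field in `Λ` is in `Λ`. -/
theorem cov_mem_nullPerp (hcov : IsConnectionOn cov U) (hP : P.HasConnectionOn cov U)
    (hW : IsOpen W) (hWU : W ⊆ U) (he : P.IsLocalSection e W) {x : M} (hx : x ∈ W)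
    {Y : (x : M) → TangentSpace (𝓡 (m + 2)) x}
    (hY : MDifferentiableAt (𝓡 (m + 2)) (𝓡 (m + 2)).tangent
      (fun y => (⟨y, Y y⟩ : TangentBundle (𝓡 (m + 2)) M)) x)
    (hYP : ∀ᶠ y in 𝓝 x, Y y ∈ nullPerp P y) (v : TangentSpace (𝓡 (m + 2)) x) :
    cov Y x v ∈ nullPerp P x := by
  have h0 : ∀ᶠ y in 𝓝 x, he.isLocalFrameOn.coeff 1 y (Y y) = 0 := by
    filter_upwards [hYP, hW.mem_nhds hx] with y hy hyW
    exact (mem_nullPerp_iff he hyW _).1 hy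
  have hA := isInfGN_iff.1 (isInfGN_connectionForm hP hW hWU he hx v)
  rw [mem_nullPerp_iff he hx, coeff_cov hcov.isCovariantDerivativeOn he.isLocalFrameOn hW hWU hx hY]
  have h1 : mvfderiv (𝓡 (m + 2)) (fun y => he.isLocalFrameOn.coeff 1 y (Y y)) x = 0 :=
    ((hasMFDerivAt_const (0 : ℝ) x).congr_of_eventuallyEq h0).mfderiv
  -- In row 1 the connection form has only its diagonal entry, and that entry is multiplied by the
  -- coefficient of Y of index 1, which is 0.
  rw [h1, Fin.sum_univ_succ, Fin.sum_univ_succ]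
  have h2 := hA.1 1 (by simp)
  have h3 := hA.2.1
  simp only [Matrix.of_apply] at h2 h3
  have h4 : he.isLocalFrameOn.coeff (Fin.succ 0) x (Y x) = 0 := h0.self_of_nhds
  simp only [h2, h3, h4, mul_zero, zero_mul, Finset.sum_const_zero, add_zero]
  rfl

/-- Without torsion the bracket is ∇_X Y - ∇_Y X, and both terms stay in Λ because ∇ preserves it.
-/
theorem isIntegrable_nullPerp (h : ∀ p : M, ∃ U : Set M, IsOpen U ∧ p ∈ U ∧
    ∃ cov : ((x : M) → TangentSpace (𝓡 (m + 2)) x) →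
      ((x : M) → TangentSpace (𝓡 (m + 2)) x →L[ℝ] TangentSpace (𝓡 (m + 2)) x),
      IsConnectionOn cov U ∧ P.HasConnectionOn cov U ∧ IsTorsionFreeOn cov U) :
    IsIntegrable (nullPerp P) := by
  intro V hV X Y hX hY hXP hYP x hx
  obtain ⟨U, hU, hxU, cov, hcov, hP, hT⟩ := h x
  obtain ⟨W, hW, hxW, e, he⟩ := P.exists_section x
  have he' : P.IsLocalSection e (W ∩ U) := GStructure.IsLocalSection.mono he inter_subset_left
  have hXd := hX.mdifferentiableAt hV hx
  have hYd := hY.mdifferentiableAt hV hx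
  rw [← hT x hxU X Y hXd hYd]
  have hWU := hW.inter hU
  have h1 := cov_mem_nullPerp hcov hP hWU inter_subset_right he' ⟨hxW, hxU⟩ hYd
    (mem_of_superset (hV.mem_nhds hx) hYP) (X x)
  have h2 := cov_mem_nullPerp hcov hP hWU inter_subset_right he' ⟨hxW, hxU⟩ hXd
    (mem_of_superset (hV.mem_nhds hx) hXP) (Y x)
  rw [mem_nullPerp_iff he' ⟨hxW, hxU⟩] at h1 h2 ⊢
  rw [map_sub, h1, h2, sub_zero]

/-- Rescaling the null frame field by a solution of a linear equation gives an infinitesimal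
automorphism. -/
theorem exists_isInfAutOn [T2Space M] (hU : IsOpen U) (hcov : IsConnectionOn cov U)
    (hP : P.HasConnectionOn cov U) (hT : IsTorsionFreeOn cov U) {p : M} (hp : p ∈ U) :
    ∃ W : Set M, IsOpen W ∧ p ∈ W ∧ ∃ X : (x : M) → TangentSpace (𝓡 (m + 2)) x,
      SmoothFieldOn X W ∧ (∀ x ∈ W, X x ∈ nullLine P x) ∧ (∀ x ∈ W, X x ≠ 0) ∧
        P.IsInfAutOn X W := by
  obtain ⟨V₀, hV₀, hpV₀, e, he₀⟩ := P.exists_section p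
  set V := (V₀ ∩ U) ∩ (extChartAt (𝓡 (m + 2)) p).source with hVdef
  have hV : IsOpen V := (hV₀.inter hU).inter (isOpen_extChartAt_source p)
  have hVU : V ⊆ U := fun x hx => hx.1.2
  have hpV : p ∈ V := ⟨⟨hpV₀, hp⟩, mem_extChartAt_source p⟩
  have he : P.IsLocalSection e V := GStructure.IsLocalSection.mono he₀ fun x hx => hx.1.1
  have he0 : ∀ x ∈ V, e 0 x ≠ 0 := fun x hx => (he.isLocalFrameOn.linearIndependent hx).ne_zero 0
  -- α is the rate at which e 0 is rescaled by parallel transport along itself. With f = exp g and e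
  -- 0 (g) = -α, the factor f compensates it and never vanishes.
  let α : M → ℝ := fun x => he.isLocalFrameOn.coeff 0 x (cov (e 0) x (e 0 x))
  have hα : ContMDiffOn (𝓡 (m + 2)) 𝓘(ℝ, ℝ) ∞ (fun x => -α x) V := fun x hx =>
    (contMDiffAt_coeff he.isLocalFrameOn (hV.mem_nhds hx) le_rfl
      (contMDiffAt_cov hcov hU hV hVU (he.1 0) (he.1 0) hx) 0).neg.contMDiffWithinAt
  obtain ⟨W, hWV, hW, hpW, g, hg, hgα⟩ :=
    exists_mvfderiv_apply_eq hV (he.1 0) hpV (he0 p hpV) hα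
  have heW := GStructure.IsLocalSection.mono he hWV
  let f : M → ℝ := fun x => Real.exp (g x)
  have hf : ContMDiffOn (𝓡 (m + 2)) 𝓘(ℝ, ℝ) ∞ f W :=
    Real.contDiff_exp.contMDiff.comp_contMDiffOn hg
  have hfd : ∀ x ∈ W, MDifferentiableAt (𝓡 (m + 2)) 𝓘(ℝ, ℝ) f x := fun x hx =>
    (hf.contMDiffAt (hW.mem_nhds hx)).mdifferentiableAt (by simp)
  have hfα : ∀ x ∈ W, mvfderiv (𝓡 (m + 2)) f x (e 0 x) = -(f x * α x) := by
    intro x hx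
    have h1 := ((hg.contMDiffAt (hW.mem_nhds hx)).mdifferentiableAt (by simp)).hasMFDerivAt
    have h2 := (Real.hasDerivAt_exp (g x)).hasFDerivAt.hasMFDerivAt
    have h3 := (HasMFDerivAt.comp x h2 h1).mfderiv
    have h4 : mvfderiv (𝓡 (m + 2)) f x (e 0 x) =
        mvfderiv (𝓡 (m + 2)) g x (e 0 x) * Real.exp (g x) :=
      DFunLike.congr_fun h3 (e 0 x)
    rw [h4, hgα x hx]
    simp only [f]
    ring
  have hX : SmoothFieldOn (fun x => f x • e 0 x) W := hf.smul_section (heW.1 0)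
  refine ⟨W, hW, hpW, fun x => f x • e 0 x, hX, fun x hx => ?_, fun x hx => ?_, ?_⟩
  · exact (mem_nullLine_iff heW hx _).2 ⟨f x, rfl⟩
  · exact smul_ne_zero (Real.exp_ne_zero (g x)) (he0 x (hWV hx))
  refine isInfAutOn_of_isInfGN heW hW (fun x hx => (hWV hx).2) hX fun x hx => ?_
  have hA := isInfGN_iff.1 (isInfGN_connectionForm hP hW (hWV.trans hVU) heW hx (e 0 x))
  have hB := fun j => isInfGN_iff.1 (isInfGN_connectionForm hP hW (hWV.trans hVU) heW hx (e j x))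
  -- Vanishing torsion and the Leibniz rule express the bracket by the connection. The subtracted
  -- terms have only a component along e 0, since each ∇ e 0 is a multiple of e 0.
  have hbr : ∀ i j, heW.isLocalFrameOn.coeff i x (VectorField.mlieBracket (𝓡 (m + 2))
      (fun x => f x • e 0 x) (e j) x) = f x * heW.isLocalFrameOn.coeff i x (cov (e j) x (e 0 x)) -
        ((if i = 0 then mvfderiv (𝓡 (m + 2)) f x (e j x) else 0) +
          f x * heW.isLocalFrameOn.coeff i x (cov (e 0) x (e j x))) := by
    intro i j
    rw [← hT x (hVU (hWV hx)) _ _ (hX.mdifferentiableAt hW hx)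
      (SmoothFieldOn.mdifferentiableAt (heW.1 j) hW hx)]
    have h1 : cov (fun x => f x • e 0 x) x (e j x) = f x • cov (e 0) x (e j x) +
        mvfderiv (𝓡 (m + 2)) f x (e j x) • e 0 x :=
      DFunLike.congr_fun (hcov.isCovariantDerivativeOn.leibniz
        (SmoothFieldOn.mdifferentiableAt (heW.1 0) hW hx) (hfd x hx) (hVU (hWV hx))) (e j x)
    rw [h1, map_smul, map_sub, map_add, map_smul, map_smul, map_smul,
      coeff_frame heW.isLocalFrameOn hx]
    simp only [smul_eq_mul, mul_ite, mul_one, mul_zero]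
    rw [add_comm (f x * _)]
  rw [isInfGN_iff]
  simp only [Matrix.of_apply, hbr] at hA hB ⊢
  -- α was formed with the coefficients of the frame on V, the rest uses those of its restriction to
  -- W; the two agree by expanding the same vector.
  have hαx : α x = heW.isLocalFrameOn.coeff 0 x (cov (e 0) x (e 0 x)) := by
    simp only [α]
    rw [← sum_coeff_smul heW.isLocalFrameOn hx (cov (e 0) x (e 0 x)),
      coeff_sum_smul he.isLocalFrameOn (hWV hx), coeff_sum_smul heW.isLocalFrameOn hx]
  refine ⟨fun i hi => ?_, fun j => ?_, ?_, fun i j => ?_⟩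
  · simp [hi]
  · simp [hA.2.1, (hB _).1 1]
  -- The only condition involving f: f (A 0 0 + A 1 1) vanishes, and the remaining terms cancel
  -- because e 0 (f) = -f α.
  · have h1 := (hB 1).1 1 (by simp)
    rw [hfα x hx, hαx]
    simp only [if_true, one_ne_zero, if_false, h1]
    linear_combination f x * hA.2.2.1
  · rw [(hB _).1 _ (Fin.succ_ne_zero _), (hB _).1 _ (Fin.succ_ne_zero _)]
    simp only [Fin.succ_ne_zero, if_false]
    linear_combination f x * hA.2.2.2 i j

end Kundt
/-! ### Kundt structures admit torsion-free connections -/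

section Christoffel

variable {m : ℕ}

/-- The components `Γ a i j` of a torsion-free `GN`-connection in a frame with structure functions
`c a i j`. -/
noncomputable def christoffel (c : Fin (m + 2) → Fin (m + 2) → Fin (m + 2) → ℝ)
    (a i j : Fin (m + 2)) : ℝ :=
  if i = 0 then c a 0 j + (if a = 0 then c 1 1 j else 0)
  else if i = 1 then (if a = 0 ∧ j ≠ 0 ∧ j ≠ 1 then c 0 1 j else 0)
  else if j = 0 then (if a = 0 then c 1 1 i else 0)
  else if j = 1 then (if a = 0 then 0 else -c a 1 i)
  else if a = 0 then c 0 i j / 2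
  else if a = 1 then 0
  else (c a i j - c i j a + c j a i) / 2

variable {c : Fin (m + 2) → Fin (m + 2) → Fin (m + 2) → ℝ}

theorem forall_fin_iff {p : Fin (m + 2) → Prop} :
    (∀ i : Fin (m + 2), i ≠ 0 → i ≠ 1 → p i) ↔ ∀ i : Fin m, p i.succ.succ := by
  constructor
  · intro h i
    exact h _ (Fin.succ_ne_zero _) fun h1 => Fin.succ_ne_zero i (Fin.succ_injective _ h1)
  · intro h i
    refine Fin.cases (fun h0 => absurd rfl h0) (fun i => ?_) i
    exact Fin.cases (fun _ h1 => absurd rfl h1) (fun i _ _ => h i) i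

theorem isInfGN_iff' {A : Matrix (Fin (m + 2)) (Fin (m + 2)) ℝ} :
    IsInfGN A ↔ (∀ i, i ≠ 0 → A i 0 = 0) ∧ (∀ j, j ≠ 0 → j ≠ 1 → A 1 j = 0) ∧
      A 0 0 + A 1 1 = 0 ∧
      ∀ i, i ≠ 0 → i ≠ 1 → ∀ j, j ≠ 0 → j ≠ 1 → A i j + A j i = 0 := by
  rw [isInfGN_iff, forall_fin_iff, forall_fin_iff]
  simp only [forall_fin_iff]

/-- The term c 1 1 j added to row 0 for i = 0 forces Γ 0 i 0 = c 1 1 i when the torsion vanishes,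
which balances Γ 1 i 1 = -c 1 1 i in the condition on the first two diagonal entries. The other
choices either lie in free entries or, in the block of indices at least 2, come from Koszul's
formula and are skew. -/
theorem isInfGN_christoffel (hc : ∀ a i j, c a i j = -c a j i)
    (h0 : IsInfGN (Matrix.of fun a j => c a 0 j)) (i : Fin (m + 2)) :
    IsInfGN (Matrix.of fun a j => christoffel c a i j) := by
  have hd : ∀ a j, c a j j = 0 := fun a j => by linarith [hc a j j]
  rw [isInfGN_iff'] at h0 ⊢
  simp only [Matrix.of_apply] at h0 ⊢
  obtain ⟨-, h2, h3, h4⟩ := h0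
  -- c 0 0 0 = 0 by antisymmetry, so the diagonal condition for i = 0 gives c 1 0 1 = 0. The term
  -- added to row 0 therefore does not disturb the entry (0, 0).
  have h11 : c 1 0 1 = 0 := by linarith [hd 0 0]
  have h10 : c 1 1 0 = 0 := by linarith [hc 1 0 1]
  refine ⟨fun a ha => ?_, fun j hj hj' => ?_, ?_, fun a ha ha' j hj hj' => ?_⟩
  · by_cases hi : i = 0 <;> by_cases hi' : i = 1 <;> simp [christoffel, hi, hi', ha, hd]
  · by_cases hi : i = 0 <;> by_cases hi' : i = 1 <;> simp [christoffel, hi, hi', hj, hj', h2 j]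
  · by_cases hi : i = 0 <;> by_cases hi' : i = 1 <;>
      simp [christoffel, hi, hi', hd, h10, h11]
  · by_cases hi : i = 0
    · simpa [christoffel, hi, ha, hj] using h4 a ha ha' j hj hj'
    · by_cases hi' : i = 1
      · simp [christoffel, hi', ha, hj]
      · simp only [christoffel, hi, hi', ha, ha', hj, hj', if_false]
        linarith [hc a i j, hc i j a, hc j a i]

/-- Each component of the torsion is carried by one of the two symbols, except where indices at
least 2 share it evenly or by Koszul's formula. The component a = 1 with i, j ≥ 2 has both symbols
zero, which is where integrability of Λ is needed. -/
theorem christoffel_sub_christoffel (hc : ∀ a i j, c a i j = -c a j i)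
    (h1 : ∀ i j, i ≠ 1 → j ≠ 1 → c 1 i j = 0)
    (a i j : Fin (m + 2)) : christoffel c a i j - christoffel c a j i = c a i j := by
  have hd : ∀ a j, c a j j = 0 := fun a j => by linarith [hc a j j]
  have key0 : ∀ j, christoffel c a 0 j - christoffel c a j 0 = c a 0 j := by
    intro j
    by_cases hj : j = 0
    · simp [hj, hd]
    · by_cases hj' : j = 1 <;> by_cases ha : a = 0 <;> simp [christoffel, hj, hj', ha, hd]
  have key1 : ∀ j, j ≠ 0 → christoffel c a 1 j - christoffel c a j 1 = c a 1 j := by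
    intro j hj
    by_cases hj' : j = 1
    · simp [hj', hd]
    · by_cases ha : a = 0 <;> simp [christoffel, hj, hj', ha]
  by_cases hi : i = 0
  · rw [hi, key0]
  by_cases hj : j = 0
  · rw [hj]
    linarith [key0 i, hc a i 0]
  by_cases hi' : i = 1
  · rw [hi', key1 j hj]
  by_cases hj' : j = 1
  · rw [hj']
    linarith [key1 i hi, hc a i 1]
  by_cases ha : a = 0
  · simp only [christoffel, ha, hi, hi', hj, hj', if_true, if_false]
    linarith [hc 0 i j]
  by_cases ha' : a = 1
  · simp [christoffel, ha', hi, hi', hj, hj', h1 i j hi' hj']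
  · simp only [christoffel, ha, ha', hi, hi', hj, hj', if_false]
    linarith [hc a i j, hc i j a, hc j a i]

end Christoffel
-- The connection with prescribed components in a frame
section FrameConnection

open Set Filter Topology

variable {n : ℕ} {M : Type*} [TopologicalSpace M] [ChartedSpace (EuclideanSpace ℝ (Fin n)) M]
  [IsManifold (𝓡 n) ∞ M] {ι : Type*}
  {e : ι → (x : M) → TangentSpace (𝓡 n) x} {U : Set M}

/-- The coefficient functionals of a local frame as continuous linear forms. -/
noncomputable def coframe (he : IsLocalFrameOn (𝓡 n) (EuclideanSpace ℝ (Fin n)) ∞ e U) (i : ι)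
    (x : M) : TangentSpace (𝓡 n) x →L[ℝ] ℝ :=
  let L : EuclideanSpace ℝ (Fin n) →L[ℝ] ℝ := LinearMap.toContinuousLinearMap (he.coeff i x)
  L

theorem coframe_apply (he : IsLocalFrameOn (𝓡 n) (EuclideanSpace ℝ (Fin n)) ∞ e U) (i : ι) (x : M)
    (v : TangentSpace (𝓡 n) x) : coframe he i x v = he.coeff i x v := rfl

variable [Fintype ι]

/-- The connection with components `Γ a i j` in a local frame: `∇_{e_i} e_j = ∑ₐ Γ a i j eₐ`. -/
noncomputable def frameConnection
    (he : IsLocalFrameOn (𝓡 n) (EuclideanSpace ℝ (Fin n)) ∞ e U) (Γ : ι → ι → ι → M → ℝ)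
    (Y : (x : M) → TangentSpace (𝓡 n) x) (x : M) : TangentSpace (𝓡 n) x →L[ℝ] TangentSpace (𝓡 n) x :=
  ∑ a, (mvfderiv (𝓡 n) (fun y => he.coeff a y (Y y)) x +
    ∑ i, (∑ j, he.coeff j x (Y x) * Γ a i j x) • coframe he i x).smulRight (e a x)

variable (he : IsLocalFrameOn (𝓡 n) (EuclideanSpace ℝ (Fin n)) ∞ e U) {Γ : ι → ι → ι → M → ℝ}
  {X Y : (x : M) → TangentSpace (𝓡 n) x} {x : M}

theorem coeff_frameConnection (hx : x ∈ U) (v : TangentSpace (𝓡 n) x) (a : ι) :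
    he.coeff a x (frameConnection he Γ Y x v) = mvfderiv (𝓡 n) (fun y => he.coeff a y (Y y)) x v +
      ∑ i, (∑ j, he.coeff j x (Y x) * Γ a i j x) * he.coeff i x v := by
  have h1 : frameConnection he Γ Y x v = ∑ a, (mvfderiv (𝓡 n) (fun y => he.coeff a y (Y y)) x v +
      ∑ i, (∑ j, he.coeff j x (Y x) * Γ a i j x) * he.coeff i x v) • e a x := by
    simp only [frameConnection, sum_apply, ContinuousLinearMap.smulRight_apply, add_apply,
      smul_apply, smul_eq_mul, coframe_apply]
  rw [h1, coeff_sum_smul he hx]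

theorem isCovariantDerivativeOn_frameConnection (hU : IsOpen U) :
    IsCovariantDerivativeOn (EuclideanSpace ℝ (Fin n)) (frameConnection he Γ) U where
  add {σ σ' x} hσ hσ' hx := by
    ext1 v
    refine ext_coeff he hx fun a => ?_
    have h1 := mdifferentiableAt_coeff he (hU.mem_nhds hx) hσ a
    have h2 := mdifferentiableAt_coeff he (hU.mem_nhds hx) hσ' a
    have h3 : mvfderiv (𝓡 n) (fun y => he.coeff a y ((σ + σ') y)) x v =
        mvfderiv (𝓡 n) (fun y => he.coeff a y (σ y)) x v +
          mvfderiv (𝓡 n) (fun y => he.coeff a y (σ' y)) x v := by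
      have h4 : (fun y => he.coeff a y ((σ + σ') y)) =
          (fun y => he.coeff a y (σ y)) + fun y => he.coeff a y (σ' y) := by
        ext y
        exact map_add (he.coeff a y) (σ y) (σ' y)
      rw [h4, mvfderiv_add h1 h2]
      rfl
    rw [add_apply, map_add, coeff_frameConnection he hx, coeff_frameConnection he hx,
      coeff_frameConnection he hx, h3]
    simp only [Pi.add_apply, map_add, add_mul, Finset.sum_add_distrib]
    ring
  leibniz {σ g x} hσ hg hx := by
    ext1 v
    refine ext_coeff he hx fun a => ?_
    have h1 := mdifferentiableAt_coeff he (hU.mem_nhds hx) hσ a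
    have h3 : mvfderiv (𝓡 n) (fun y => he.coeff a y ((g • σ) y)) x v =
        g x * mvfderiv (𝓡 n) (fun y => he.coeff a y (σ y)) x v +
          he.coeff a x (σ x) * mvfderiv (𝓡 n) g x v := by
      have h4 : (fun y => he.coeff a y ((g • σ) y)) = g * fun y => he.coeff a y (σ y) := by
        ext y
        exact map_smul (he.coeff a y) (g y) (σ y)
      rw [h4, mvfderiv_mul hg h1]
      rfl
    rw [add_apply, map_add, smul_apply, map_smul, ContinuousLinearMap.smulRight_apply, map_smul,
      coeff_frameConnection he hx, coeff_frameConnection he hx, h3]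
    simp only [Pi.smul_apply', map_smul, smul_eq_mul, mul_assoc, ← Finset.mul_sum]
    ring

theorem isConnectionOn_frameConnection (hU : IsOpen U)
    (hΓ : ∀ a i j, ContMDiffOn (𝓡 n) 𝓘(ℝ, ℝ) ∞ (Γ a i j) U) :
    IsConnectionOn (frameConnection he Γ) U where
  isCovariantDerivativeOn := isCovariantDerivativeOn_frameConnection he hU
  smooth := by
    classical
    refine ⟨fun {σ} hσ x hx => ?_⟩
    have hσ' : SmoothFieldOn σ U := by simpa using! hσ
    have hc : ∀ a, ContMDiffOn (𝓡 n) 𝓘(ℝ, ℝ) ∞ (fun y => he.coeff a y (σ y)) U := fun a y hy =>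
      (contMDiffAt_coeff he (hU.mem_nhds hy) le_rfl (hσ'.contMDiffAt hU hy) a).contMDiffWithinAt
    refine (contMDiffAt_hom_of_frame he (hU.mem_nhds hx) fun i => ?_).contMDiffWithinAt
    refine he.contMDiffAt_of_coeff (fun a => ?_) (hU.mem_nhds hx)
    -- Evaluated on e i, component a of the covariant derivative of σ is the derivative of its
    -- coefficient along e i plus a smooth zeroth-order term.
    have h1 : ContMDiffAt (𝓡 n) 𝓘(ℝ, ℝ) ∞ (fun y =>
        mvfderiv (𝓡 n) (fun y => he.coeff a y (σ y)) y (e i y) +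
          ∑ j, he.coeff j y (σ y) * Γ a i j y) x := by
      refine (contMDiffAt_mvfderiv_apply hU (hc a) hx
        (SmoothFieldOn.contMDiffAt (he.contMDiffOn i) hU hx)).add (ContMDiffAt.sum fun j _ => ?_)
      exact ((hc j).contMDiffAt (hU.mem_nhds hx)).mul ((hΓ a i j).contMDiffAt (hU.mem_nhds hx))
    refine h1.congr_of_eventuallyEq ?_
    filter_upwards [hU.mem_nhds hx] with y hy
    refine (coeff_frameConnection he hy (e i y) a).trans ?_
    simp [coeff_frame he hy]

include he in
/-- A tensorial expression vanishing on a local frame vanishes. -/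
theorem tensorialAt_eq_zero {A : Type*} [AddCommGroup A] [Module ℝ A]
    {Φ : ((x : M) → TangentSpace (𝓡 n) x) → A}
    (hΦ : TensorialAt (𝓡 n) (EuclideanSpace ℝ (Fin n)) Φ x) (hU : IsOpen U) (hx : x ∈ U)
    (h : ∀ i, Φ (e i) = 0) (hX : MDifferentiableAt (𝓡 n) (𝓡 n).tangent
      (fun y => (⟨y, X y⟩ : TangentBundle (𝓡 n) M)) x) : Φ X = 0 := by
  have hej : ∀ j, MDifferentiableAt (𝓡 n) (𝓡 n).tangent
      (fun y => (⟨y, e j y⟩ : TangentBundle (𝓡 n) M)) x := fun j =>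
    SmoothFieldOn.mdifferentiableAt (he.contMDiffOn j) hU hx
  have hcj : ∀ j, MDifferentiableAt (𝓡 n) 𝓘(ℝ, ℝ) (fun _ : M => he.coeff j x (X x)) x := fun j =>
    mdifferentiableAt_const
  have hσ : ∀ j, MDifferentiableAt (𝓡 n) (𝓡 n).tangent (fun y =>
      (⟨y, he.coeff j x (X x) • e j y⟩ : TangentBundle (𝓡 n) M)) x := fun j =>
    (hcj j).smul_section (hej j)
  have h1 : Φ X = Φ (fun y => ∑ j, he.coeff j x (X x) • e j y) :=
    hΦ.pointwise hX (MDifferentiableAt.sum_section fun j _ => hσ j) (sum_coeff_smul he hx (X x)).symm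
  rw [h1, hΦ.sum _ fun j _ => hσ j]
  refine Finset.sum_eq_zero fun j _ => ?_
  have h2 : Φ (fun y => he.coeff j x (X x) • e j y) = he.coeff j x (X x) • Φ (e j) :=
    hΦ.smul (hcj j) (hej j)
  rw [h2, h, smul_zero]

/-- The torsion minus the bracket is tensorial in its first slot, hence by antisymmetry in the
second, so only pairs of frame fields matter. There the coefficients are constant and the identity
on Γ is all that remains. -/
theorem isTorsionFreeOn_frameConnection (hU : IsOpen U)
    (hΓ : ∀ x ∈ U, ∀ a i j, Γ a i j x - Γ a j i x =
      he.coeff a x (VectorField.mlieBracket (𝓡 n) (e i) (e j) x)) :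
    IsTorsionFreeOn (frameConnection he Γ) U := by
  classical
  intro x hx X Y hX hY
  have hcov := isCovariantDerivativeOn_frameConnection he (Γ := Γ) hU
  have hM : IsManifold (𝓡 n) (minSmoothness ℝ 2) M := by
    rw [minSmoothness_of_isRCLikeNormedField]
    infer_instance
  let Φ : ((x : M) → TangentSpace (𝓡 n) x) → ((x : M) → TangentSpace (𝓡 n) x) →
      TangentSpace (𝓡 n) x := fun X Y => frameConnection he Γ Y x (X x) -
    frameConnection he Γ X x (Y x) - VectorField.mlieBracket (𝓡 n) X Y x
  have hanti : ∀ X Y, Φ X Y = -Φ Y X := by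
    intro X Y
    simp only [Φ]
    rw [VectorField.mlieBracket_swap_apply]
    abel
  have hΦ : ∀ Y, TensorialAt (𝓡 n) (EuclideanSpace ℝ (Fin n)) (Φ · Y) x := by
    intro Y
    refine ⟨fun {f σ} hf hσ => ?_, fun {σ σ'} hσ hσ' => ?_⟩
    · have h1 := DFunLike.congr_fun (hcov.leibniz hσ hf hx) (Y x)
      have h2 := VectorField.mlieBracket_smul_left (W := Y) hf hσ
      simp only [Φ]
      rw [h1, h2, add_apply, smul_apply, ContinuousLinearMap.smulRight_apply, Pi.smul_apply',
        map_smul]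
      module
    · have h1 := DFunLike.congr_fun (hcov.add hσ hσ' hx) (Y x)
      have h2 := VectorField.mlieBracket_add_left (W := Y) hσ hσ'
      simp only [Φ]
      rw [h1, h2, add_apply, Pi.add_apply, map_add]
      module
  have hframe : ∀ i j, Φ (e i) (e j) = 0 := by
    intro i j
    refine ext_coeff he hx fun a => ?_
    have h1 : ∀ j, mvfderiv (𝓡 n) (fun y => he.coeff a y (e j y)) x = 0 := by
      intro j
      have h2 : HasMFDerivAt (𝓡 n) 𝓘(ℝ, ℝ) (fun y => he.coeff a y (e j y)) x 0 := by
        refine (hasMFDerivAt_const (if a = j then (1 : ℝ) else 0) x).congr_of_eventuallyEq ?_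
        filter_upwards [hU.mem_nhds hx] with y hy
        exact coeff_frame he hy a j
      rw [mvfderiv, h2.mfderiv]
      exact ContinuousLinearMap.comp_zero _
    simp only [Φ, map_sub, coeff_frameConnection he hx, h1, coeff_frame he hx]
    simp [← hΓ x hx]
  have h1 : Φ X Y = 0 := by
    refine tensorialAt_eq_zero he (Φ := (Φ · Y)) (hΦ Y) hU hx (fun i => ?_) hX
    have h2 : Φ Y (e i) = 0 :=
      tensorialAt_eq_zero he (Φ := (Φ · (e i))) (hΦ (e i)) hU hx (fun j => hframe j i) hY
    rw [hanti, h2, neg_zero]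
  exact sub_eq_zero.1 h1

end FrameConnection
-- Torsion-free connections of a Kundt structure
section GNConnection

open Set Filter Topology

variable {m : ℕ} {M : Type*} [TopologicalSpace M]
  [ChartedSpace (EuclideanSpace ℝ (Fin (m + 2))) M] [IsManifold (𝓡 (m + 2)) ∞ M]
  {P : GStructure (GN m) M} {e : Fin (m + 2) → (x : M) → TangentSpace (𝓡 (m + 2)) x} {U : Set M}

/-- A connection whose form is infinitesimally in `GN` in one section is a connection in `P`. -/
theorem hasConnectionOn_frameConnection (he : P.IsLocalSection e U)
    {Γ : Fin (m + 2) → Fin (m + 2) → Fin (m + 2) → M → ℝ}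
    (hΓ : ∀ x ∈ U, ∀ i, IsInfGN (Matrix.of fun a j => Γ a i j x)) :
    P.HasConnectionOn (frameConnection he.isLocalFrameOn Γ) U := by
  intro W hW hWU e' he' x hx v
  have hf := he.isLocalFrameOn
  have hf' := he'.isLocalFrameOn
  let A : Matrix (Fin (m + 2)) (Fin (m + 2)) ℝ := Matrix.of fun i j =>
    hf'.coeff i x (frameConnection he.isLocalFrameOn Γ (e' j) x v)
  refine ⟨A, mem_matrixLieAlgebra_GN.2 ?_, fun j => (sum_coeff_smul hf' hx _).symm⟩
  let a : M → Matrix (Fin (m + 2)) (Fin (m + 2)) ℝ := fun y => Matrix.of fun i j =>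
    hf.coeff i y (e' j y)
  have haGN : ∀ y ∈ W, IsGN (a y) := fun y hy => (mem_fibre_iff he (hWU hy) _).1 (he'.2 y hy)
  let Ω : Matrix (Fin (m + 2)) (Fin (m + 2)) ℝ :=
    ∑ i, hf.coeff i x v • Matrix.of fun a j => Γ a i j x
  have hΩ : IsInfGN Ω := IsInfGN.sum _ fun i => (hΓ x (hWU hx) i).smul _
  let a' : Matrix (Fin (m + 2)) (Fin (m + 2)) ℝ := Matrix.of fun i j =>
    mvfderiv (𝓡 (m + 2)) (fun y => hf.coeff i y (e' j y)) x v
  -- The gauge transformation law a A = da(v) + Ω a for passing from the section e to e' = e a, with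
  -- Ω the form in e.
  have hkey : a x * A = a' + Ω * a x := by
    ext r j
    have h1 : (a x * A) r j = hf.coeff r x (frameConnection he.isLocalFrameOn Γ (e' j) x v) := by
      conv_rhs => rw [← sum_coeff_smul hf' hx (frameConnection he.isLocalFrameOn Γ (e' j) x v)]
      simp only [map_sum, map_smul, smul_eq_mul, Matrix.mul_apply, a, A, Matrix.of_apply]
      exact Finset.sum_congr rfl fun k _ => mul_comm _ _
    rw [h1, coeff_frameConnection he.isLocalFrameOn (hWU hx), Matrix.add_apply]
    refine congrArg _ ?_
    simp only [Matrix.mul_apply, Ω, a, Matrix.sum_apply, Matrix.smul_apply, Matrix.of_apply,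
      smul_eq_mul, Finset.sum_mul]
    rw [Finset.sum_comm]
    refine Finset.sum_congr rfl fun k _ => Finset.sum_congr rfl fun i _ => ?_
    ring
  obtain ⟨g, -, hg⟩ := (haGN x hx).exists_mem_GN
  -- B is the conjugate of Ω by a x; what is left, A - B, is the logarithmic derivative of a along
  -- v.
  let B : Matrix (Fin (m + 2)) (Fin (m + 2)) ℝ :=
    ((g⁻¹ : GL (Fin (m + 2)) ℝ) : Matrix (Fin (m + 2)) (Fin (m + 2)) ℝ) * (Ω * a x)
  have hB : a x * B = Ω * a x := by
    simp only [B]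
    rw [← mul_assoc, ← hg, ← Units.val_mul, mul_inv_cancel, Units.val_one, one_mul]
  have hBgn : IsInfGN B := IsInfGN.conj (haGN x hx) hΩ hB
  have hAB : IsInfGN (A - B) := by
    -- A curve with velocity v turns a into a curve in `GN`, whose logarithmic derivative is
    -- infinitesimally in `GN`.
    obtain ⟨γ, hγ, hγ0, hγd⟩ := exists_curve x v
    refine isInfGN_of_hasDerivAt (t := 0) (C := fun s => a (γ s)) (C' := a')
      ((hγ.eventually (hW.mem_nhds hx)).mono fun s hs => haGN _ hs) (fun i j => ?_) ?_
    · exact hγd _ (mdifferentiableAt_coeff hf (mem_of_superset (hW.mem_nhds hx) hWU)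
        (SmoothFieldOn.mdifferentiableAt (he'.1 j) hW hx) i)
    · rw [hγ0, mul_sub, hB, hkey, add_sub_cancel_right]
  have h2 := hAB.add hBgn
  rwa [sub_add_cancel] at h2

/-- These are the boosts: reciprocal scalings of e₀ and e₁ keep the pairing with k and do not affect
η on k^⊥, where the index 1 component is zero. They let e 0 be replaced by any nonvanishing field in
λ. -/
theorem isGN_diagonal {d : Fin (m + 2) → ℝ} (h01 : d 0 * d 1 = 1)
    (hd : ∀ i : Fin m, d i.succ.succ = 1) : IsGN (Matrix.diagonal d) := by
  have hk : Matrix.diagonal d *ᵥ kVec m = d 0 • kVec m := by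
    ext i
    rw [Matrix.mulVec_diagonal]
    by_cases hi : i = 0
    · simp [hi]
    · simp [kVec_of_ne hi]
  refine ⟨?_, fun w w' hw hw' => ?_, fun z => ?_⟩
  · rw [hk]
    exact Submodule.smul_mem _ _ (Submodule.mem_span_singleton_self _)
  · rw [eta_kVec] at hw hw'
    simp [eta, Matrix.mulVec_diagonal, hd, hw, hw']
  · rw [hk, eta_smul_left, eta_kVec, eta_kVec, Matrix.mulVec_diagonal, ← mul_assoc, h01, one_mul]

theorem GStructure.IsInfAutOn.congr {X Y : (x : M) → TangentSpace (𝓡 (m + 2)) x}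
    (hX : P.IsInfAutOn X U) (h : ∀ x ∈ U, X x = Y x) : P.IsInfAutOn Y U := by
  intro a b V φ hφ
  refine hX a b V φ { hφ with integralCurve := fun x hx t ht => ?_ }
  rw [h _ (hφ.mapsTo t ht x hx)]
  exact hφ.integralCurve x hx t ht

/-- A nowhere vanishing infinitesimal automorphism in `λ` is the first field of a section. -/
theorem exists_section_isInfAutOn (hP : IsKundt P) (p : M) :
    ∃ U : Set M, IsOpen U ∧ p ∈ U ∧ U ⊆ (extChartAt (𝓡 (m + 2)) p).source ∧
      ∃ e : Fin (m + 2) → (x : M) → TangentSpace (𝓡 (m + 2)) x, P.IsLocalSection e U ∧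
        P.IsInfAutOn (e 0) U := by
  obtain ⟨U₁, hU₁, hpU₁, X, hX, hXl, hX0, hXP⟩ := hP.exists_infAut p
  obtain ⟨V, hV, hpV, e, he⟩ := P.exists_section p
  set U := (V ∩ U₁) ∩ (extChartAt (𝓡 (m + 2)) p).source with hUdef
  have hU : IsOpen U := (hV.inter hU₁).inter (isOpen_extChartAt_source p)
  have heU : P.IsLocalSection e U := GStructure.IsLocalSection.mono he fun x hx => hx.1.1
  have hXU : SmoothFieldOn X U := ContMDiffOn.mono hX fun x hx => hx.1.2
  let f : M → ℝ := fun x => heU.isLocalFrameOn.coeff 0 x (X x)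
  have hfX : ∀ x ∈ U, X x = f x • e 0 x := by
    intro x hx
    obtain ⟨c, hc⟩ := (mem_nullLine_iff heU hx _).1 (hXl x hx.1.2)
    have h1 : f x = c := by
      simp only [f]
      rw [hc, map_smul, coeff_frame heU.isLocalFrameOn hx]
      simp
    rw [h1, hc]
  have hf0 : ∀ x ∈ U, f x ≠ 0 := by
    intro x hx h0
    apply hX0 x hx.1.2
    rw [hfX x hx, h0, zero_smul]
  have hf : ContMDiffOn (𝓡 (m + 2)) 𝓘(ℝ, ℝ) ∞ f U := fun x hx =>
    (contMDiffAt_coeff heU.isLocalFrameOn (hU.mem_nhds hx) le_rfl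
      (hXU.contMDiffAt hU hx) 0).contMDiffWithinAt
  -- The boost carrying e 0 to f e 0 = X; the factor on e 1 must be the inverse of f for the new
  -- frame to stay in P.
  let d : Fin (m + 2) → M → ℝ := fun i x => if i = 0 then f x else if i = 1 then (f x)⁻¹ else 1
  have hd : ∀ i, ContMDiffOn (𝓡 (m + 2)) 𝓘(ℝ, ℝ) ∞ (d i) U := by
    intro i
    by_cases hi : i = 0
    · simpa [d, hi] using hf
    · by_cases hi' : i = 1
      · simpa [d, hi'] using hf.inv₀ hf0
      · simpa [d, hi, hi'] using contMDiffOn_const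
  refine ⟨U, hU, ⟨⟨hpV, hpU₁⟩, mem_extChartAt_source p⟩, inter_subset_right,
    fun i x => d i x • e i x, ⟨fun i => (hd i).smul_section (heU.1 i), fun x hx => ?_⟩, ?_⟩
  · have h1 : IsGN (Matrix.diagonal fun i => d i x) := by
      refine isGN_diagonal ?_ fun i => ?_
      · simp [d, mul_inv_cancel₀ (hf0 x hx)]
      · have h2 := (forall_fin_iff (p := fun i => d i x = 1)).1 fun i hi hi' => by simp [d, hi, hi']
        exact h2 i
    obtain ⟨g, hg, hgd⟩ := h1.exists_mem_GN
    convert! P.mul_mem x _ (heU.2 x hx) g hg using 1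
    ext1 j
    simp only [frameMul, hgd, Matrix.diagonal_apply, ite_smul, zero_smul, Finset.sum_ite_eq',
      Finset.mem_univ, if_true]
  · exact (hXP.mono fun x hx => hx.1.2).congr fun x hx => hfX x hx

/-- About each point of a Kundt structure there is a torsion-free connection. -/
theorem exists_torsionFree_connection (hP : IsKundt P) (p : M) :
    ∃ U : Set M, IsOpen U ∧ p ∈ U ∧
      ∃ cov : ((x : M) → TangentSpace (𝓡 (m + 2)) x) →
        ((x : M) → TangentSpace (𝓡 (m + 2)) x →L[ℝ] TangentSpace (𝓡 (m + 2)) x),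
        IsConnectionOn cov U ∧ P.HasConnectionOn cov U ∧ IsTorsionFreeOn cov U := by
  obtain ⟨U, hU, hpU, hUp, e, he, heP⟩ := exists_section_isInfAutOn hP p
  have hf := he.isLocalFrameOn
  let c : M → Fin (m + 2) → Fin (m + 2) → Fin (m + 2) → ℝ := fun x a i j =>
    hf.coeff a x (VectorField.mlieBracket (𝓡 (m + 2)) (e i) (e j) x)
  have hcs : ∀ a i j, ContMDiffOn (𝓡 (m + 2)) 𝓘(ℝ, ℝ) ∞ (fun x => c x a i j) U := fun a i j x hx =>
    (contMDiffAt_coeff hf (hU.mem_nhds hx) le_rfl (contMDiffAt_mlieBracket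
      ((he.1 i).contMDiffAt hU hx) ((he.1 j).contMDiffAt hU hx)) a).contMDiffWithinAt
  have hanti : ∀ x a i j, c x a i j = -c x a j i := by
    intro x a i j
    simp only [c]
    rw [VectorField.mlieBracket_swap_apply, map_neg]
  have h0 : ∀ x ∈ U, IsInfGN (Matrix.of fun a j => c x a 0 j) := fun x hx =>
    isInfGN_mlieBracket he hU hUp (he.1 0) heP hx
  -- All frame fields except e 1 lie in Λ, so integrability kills the component of index 1 of their
  -- brackets.
  have h1 : ∀ x ∈ U, ∀ i j, i ≠ 1 → j ≠ 1 → c x 1 i j = 0 := by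
    have hmem : ∀ i, i ≠ 1 → ∀ x ∈ U, e i x ∈ nullPerp P x := by
      intro i hi x hx
      rw [mem_nullPerp_iff he hx, coeff_frame hf hx, if_neg (Ne.symm hi)]
    intro x hx i j hi hj
    exact (mem_nullPerp_iff he hx _).1
      (hP.integrable U hU _ _ (he.1 i) (he.1 j) (hmem i hi) (hmem j hj) x hx)
  let Γ : Fin (m + 2) → Fin (m + 2) → Fin (m + 2) → M → ℝ := fun a i j x =>
    christoffel (c x) a i j
  have hΓ : ∀ a i j, ContMDiffOn (𝓡 (m + 2)) 𝓘(ℝ, ℝ) ∞ (Γ a i j) U := by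
    intro a i j
    simp only [Γ, christoffel, div_eq_mul_inv]
    split_ifs
    · exact (hcs _ _ _).add (hcs _ _ _)
    · exact (hcs _ _ _).add contMDiffOn_const
    · exact hcs _ _ _
    · exact contMDiffOn_const
    · exact hcs _ _ _
    · exact contMDiffOn_const
    · exact contMDiffOn_const
    · exact (hcs _ _ _).neg
    · exact (hcs _ _ _).mul contMDiffOn_const
    · exact contMDiffOn_const
    · exact (((hcs _ _ _).sub (hcs _ _ _)).add (hcs _ _ _)).mul contMDiffOn_const
  exact ⟨U, hU, hpU, frameConnection hf Γ, isConnectionOn_frameConnection hf hU hΓ,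
    hasConnectionOn_frameConnection he fun x hx i => isInfGN_christoffel (hanti x) (h0 x hx) i,
    isTorsionFreeOn_frameConnection hf hU fun x hx a i j =>
      christoffel_sub_christoffel (hanti x) (h1 x hx) a i j⟩

end GNConnection
end KundtGN

theorem mainTheorem4 (m : ℕ) (M : Type*) [TopologicalSpace M] [T2Space M]
    [ChartedSpace (EuclideanSpace ℝ (Fin (m + 2))) M] [IsManifold (𝓡 (m + 2)) ∞ M]
    (P : KundtGN.GStructure (KundtGN.GN m) M) :
    KundtGN.IsKundt P ↔
      ∀ p : M, ∃ U : Set M, IsOpen U ∧ p ∈ U ∧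
        ∃ cov : ((x : M) → TangentSpace (𝓡 (m + 2)) x) →
            ((x : M) → TangentSpace (𝓡 (m + 2)) x →L[ℝ] TangentSpace (𝓡 (m + 2)) x),
          KundtGN.IsConnectionOn cov U ∧ P.HasConnectionOn cov U ∧
            KundtGN.IsTorsionFreeOn cov U := by
  constructor
  · intro h p
    exact KundtGN.exists_torsionFree_connection h p
  · intro h
    refine ⟨KundtGN.isIntegrable_nullPerp h, fun p => ?_⟩
    obtain ⟨U, hU, hpU, cov, hcov, hP, hT⟩ := h p
    exact KundtGN.exists_isInfAutOn hU hcov hP hT hpU
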